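/- Let $(M,\gamma)$ be a closed (compact, without boundary) smooth Riemannian $3$-manifold which is Einstein with constant $-\frac29$, i.e. $\mathrm{Ric}[\gamma]=-\frac29\,\gamma$ (in dimension three $\gamma$ is then automatically hyperbolic, that is, of constant negative sectional curvature). Let $$\Delta_E=\nabla^*\nabla-2\mathring R,\qquad (\mathring R h)_{ij}=R_{ikjl}h^{kl},$$ be the Einstein operator acting on smooth symmetric $2$-tensors $h$ on $M$, where $\nabla^*\nabla h_{ij}=-\gamma^{kl}\nabla_k\nabla_l h_{ij}$ and the sign of the curvature is such that $R_{ikjl}\gamma^{kl}=\mathrm{Ric}_{ij}$. Call $\lambda\in\mathbb R$ an eigenvalue of $\Delta_E$ if $\Delta_E h=\lambda h$ for some smooth symmetric $2$-tensor $h\neq 0$ (an eigentensor for $\lambda$). Then: 1. The lowest positive eigenvalue $\lambda_0$ of $\Delta_E$ satisfies $\lambda_0\ge\frac19$; indeed, every eigenvalue $\lambda$ of $\Delta_E$ satisfies $\lambda\geq\frac19$. 2. Every eigentensor $h$ of $\Delta_E$ with eigenvalue $\lambda<\frac49$ is a TT-tensor, i.e. $\gamma^{ij}h_{ij}=0$ and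 $\gamma^{jk}\nabla_k h_{ij}=0$. 3. $\ker\Delta_E=\{0\}$. -/

import Mathlib

open Bundle
open scoped Manifold ContDiff

noncomputable section

/-- The model space `ℝ³`. -/
abbrev E3 : Type := EuclideanSpace ℝ (Fin 3)

/-! ### Tensor calculus in a coordinate domain of `ℝ³`

`g` is the field of matrices `g_{ij}` of a metric and `h` the field of matrices `h_{ij}` of a
2-tensor, both given in coordinates. -/

namespace Coord

/-- The partial derivative `∂_i f` at `y`. -/
def pd (i : Fin 3) (f : E3 → ℝ) (y : E3) : ℝ :=
  fderiv ℝ f y (EuclideanSpace.single i 1)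

/-- The inverse metric `g^{ij}`. -/
def ginv (g : E3 → Matrix (Fin 3) (Fin 3) ℝ) (i j : Fin 3) (y : E3) : ℝ :=
  (g y)⁻¹ i j

/-- The Christoffel symbols of the Levi-Civita connection,
`Γ^k_{ij} = ½ g^{kl} (∂_i g_{jl} + ∂_j g_{il} - ∂_l g_{ij})`. -/
def christoffel (g : E3 → Matrix (Fin 3) (Fin 3) ℝ) (k i j : Fin 3) (y : E3) : ℝ :=
  (1 / 2 : ℝ) * ∑ l, ginv g k l y *
    (pd i (fun z => g z j l) y + pd j (fun z => g z i l) y - pd l (fun z => g z i j) y)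

/-- The curvature `R(∂_i, ∂_j) ∂_k = ∇_i ∇_j ∂_k - ∇_j ∇_i ∂_k`, component along `∂_l`. -/
def curv (g : E3 → Matrix (Fin 3) (Fin 3) ℝ) (l i j k : Fin 3) (y : E3) : ℝ :=
  pd i (christoffel g l j k) y - pd j (christoffel g l i k) y
    + ∑ m, (christoffel g l i m y * christoffel g m j k y
      - christoffel g l j m y * christoffel g m i k y)

/-- The Ricci curvature `Ric(∂_j, ∂_k) = tr (X ↦ R(X, ∂_j) ∂_k)`. -/
def ricci (g : E3 → Matrix (Fin 3) (Fin 3) ℝ) (j k : Fin 3) (y : E3) : ℝ :=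
  ∑ i, curv g i i j k y

/-- The covariant curvature tensor `R_{abcd} = g(R(∂_a, ∂_b) ∂_d, ∂_c)`; with this (usual) sign
`R_{ikjl} g^{kl} = Ric_{ij}`, and `R_{abab} > 0` for `a ≠ b` on a round sphere. -/
def riem (g : E3 → Matrix (Fin 3) (Fin 3) ℝ) (a b c d : Fin 3) (y : E3) : ℝ :=
  ∑ m, g y c m * curv g m a b d y

/-- The covariant derivative of a 2-tensor, `(∇_k h)_{ij}`. -/
def nabla (g h : E3 → Matrix (Fin 3) (Fin 3) ℝ) (k i j : Fin 3) (y : E3) : ℝ :=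
  pd k (fun z => h z i j) y
    - ∑ m, (christoffel g m k i y * h y m j + christoffel g m k j y * h y i m)

/-- The second covariant derivative of a 2-tensor, `(∇_l ∇_k h)_{ij}` (the covariant derivative
of the 3-tensor `∇h`). -/
def nabla2 (g h : E3 → Matrix (Fin 3) (Fin 3) ℝ) (l k i j : Fin 3) (y : E3) : ℝ :=
  pd l (nabla g h k i j) y
    - ∑ m, (christoffel g m l k y * nabla g h m i j y + christoffel g m l i y * nabla g h k m j y
      + christoffel g m l j y * nabla g h k i m y)

/-- The rough Laplacian `(∇*∇h)_{ij} = -g^{lk} (∇_l ∇_k h)_{ij}`. -/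
def roughLaplacian (g h : E3 → Matrix (Fin 3) (Fin 3) ℝ) (i j : Fin 3) (y : E3) : ℝ :=
  -∑ l, ∑ k, ginv g l k y * nabla2 g h l k i j y

/-- The action of the curvature, `(R̊h)_{ij} = R_{ikjl} h^{kl}`, with the indices of `h` raised
by `g`. -/
def curvAction (g h : E3 → Matrix (Fin 3) (Fin 3) ℝ) (i j : Fin 3) (y : E3) : ℝ :=
  ∑ k, ∑ l, riem g i k j l y * ∑ p, ∑ q, ginv g k p y * ginv g l q y * h y p q

/-- The Einstein operator `Δ_E = ∇*∇ - 2R̊`. -/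
def einsteinOp (g h : E3 → Matrix (Fin 3) (Fin 3) ℝ) (i j : Fin 3) (y : E3) : ℝ :=
  roughLaplacian g h i j y - 2 * curvAction g h i j y

/-- The trace `g^{ij} h_{ij}`. -/
def trace (g h : E3 → Matrix (Fin 3) (Fin 3) ℝ) (y : E3) : ℝ :=
  ∑ i, ∑ j, ginv g i j y * h y i j

/-- The divergence `g^{jk} (∇_k h)_{ij}` of a symmetric 2-tensor. -/
def divergence (g h : E3 → Matrix (Fin 3) (Fin 3) ℝ) (i : Fin 3) (y : E3) : ℝ :=
  ∑ j, ∑ k, ginv g j k y * nabla g h k i j y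

end Coord

/-! ### Metrics and symmetric 2-tensors on a smooth 3-manifold -/

section Manifold

variable (M : Type*) [TopologicalSpace M] [ChartedSpace E3 M] [IsManifold (𝓡 3) ∞ M]

/-- Smooth Riemannian metrics on `M`. -/
abbrev SmoothMetric : Type _ :=
  ContMDiffRiemannianMetric (𝓡 3) ∞ E3 (fun x : M => TangentSpace (𝓡 3) x)

/-- Smooth symmetric (covariant) 2-tensor fields on `M`. -/
structure SymTensor where
  /-- The bilinear form on each tangent space. -/
  toFun (x : M) : TangentSpace (𝓡 3) x →L[ℝ] TangentSpace (𝓡 3) x →L[ℝ] ℝ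
  symm (x : M) (v w : TangentSpace (𝓡 3) x) : toFun x v w = toFun x w v
  contMDiff : ContMDiff (𝓡 3) ((𝓡 3).prod 𝓘(ℝ, E3 →L[ℝ] E3 →L[ℝ] ℝ)) ∞
    (fun x => TotalSpace.mk' (E3 →L[ℝ] E3 →L[ℝ] ℝ) x (toFun x))

set_option synthInstance.maxHeartbeats 400000 in
/-- The bundle of bilinear forms on the tangent spaces is a vector bundle. -/
theorem bilinVectorBundle : VectorBundle ℝ (E3 →L[ℝ] E3 →L[ℝ] ℝ)
    (fun x : M => TangentSpace (𝓡 3) x →L[ℝ] TangentSpace (𝓡 3) x →L[ℝ] ℝ) := by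
  infer_instance

set_option synthInstance.maxHeartbeats 400000 in
/-- The zero tensor field. -/
instance SymTensor.instZero : Zero (SymTensor M) where
  zero :=
    { toFun := fun _ => 0
      symm := fun _ _ _ => rfl
      contMDiff := by
        have := bilinVectorBundle M
        exact Bundle.contMDiff_zeroSection ℝ
          (fun x : M => TangentSpace (𝓡 3) x →L[ℝ] TangentSpace (𝓡 3) x →L[ℝ] ℝ) }

set_option synthInstance.maxHeartbeats 400000 in
/-- Multiplication of a tensor field by a constant. -/
instance SymTensor.instSMul : SMul ℝ (SymTensor M) where
  smul c h :=
    { toFun := fun x => c • h.toFun x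
      symm := fun x v w => congrArg (c * ·) (h.symm x v w)
      contMDiff := by
        have := bilinVectorBundle M
        exact ContMDiff.const_smul_section h.contMDiff }

variable {M}

/-- The coordinate vector field `∂_i` of the chart `φ`, at the point with coordinates `y`. -/
def coordVec (φ : OpenPartialHomeomorph M E3) (i : Fin 3) (y : E3) :
    TangentSpace (𝓡 3) (φ.symm y) :=
  mfderiv (𝓡 3) (𝓡 3) φ.symm y (EuclideanSpace.single i (1 : ℝ) : E3)

/-- The components `b_{ij} = b(∂_i, ∂_j)` in the chart `φ` of a field `b` of bilinear forms, as
functions of the coordinates. -/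
def components (b : ∀ x : M, TangentSpace (𝓡 3) x →L[ℝ] TangentSpace (𝓡 3) x →L[ℝ] ℝ)
    (φ : OpenPartialHomeomorph M E3) (y : E3) : Matrix (Fin 3) (Fin 3) ℝ :=
  Matrix.of fun i j => b (φ.symm y) (coordVec φ i y) (coordVec φ j y)

/-- The metric `γ` is Einstein with constant `μ`: `Ric[γ] = μ γ`, in every smooth chart. -/
def IsEinsteinMetric (γ : SmoothMetric M) (μ : ℝ) : Prop :=
  ∀ φ ∈ IsManifold.maximalAtlas (𝓡 3) ∞ M, ∀ y ∈ φ.target, ∀ i j : Fin 3,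
    Coord.ricci (components γ.inner φ) i j y = μ * components γ.inner φ y i j

/-- `Δ_E h = k`, an equality of tensor fields, expressed by equality of the components in every
smooth chart. -/
def EinsteinOpEq (γ : SmoothMetric M) (h k : SymTensor M) : Prop :=
  ∀ φ ∈ IsManifold.maximalAtlas (𝓡 3) ∞ M, ∀ y ∈ φ.target, ∀ i j : Fin 3,
    Coord.einsteinOp (components γ.inner φ) (components h.toFun φ) i j y
      = components k.toFun φ y i j

/-- `h` is an eigentensor of `Δ_E` with eigenvalue `lam`. -/
def IsEigentensor (γ : SmoothMetric M) (lam : ℝ) (h : SymTensor M) : Prop :=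
  h ≠ 0 ∧ EinsteinOpEq γ h (lam • h)

/-- `lam` is an eigenvalue of `Δ_E` acting on smooth symmetric 2-tensors. -/
def IsEinsteinEigenvalue (γ : SmoothMetric M) (lam : ℝ) : Prop :=
  ∃ h : SymTensor M, IsEigentensor γ lam h

/-- `h` is a TT-tensor: trace-free and divergence-free. -/
def IsTT (γ : SmoothMetric M) (h : SymTensor M) : Prop :=
  ∀ φ ∈ IsManifold.maximalAtlas (𝓡 3) ∞ M, ∀ y ∈ φ.target,
    Coord.trace (components γ.inner φ) (components h.toFun φ) y = 0 ∧
    ∀ i : Fin 3,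
      Coord.divergence (components γ.inner φ) (components h.toFun φ) i y = 0

/-- The kernel of `Δ_E` on smooth symmetric 2-tensors. -/
def einsteinKernel (γ : SmoothMetric M) : Set (SymTensor M) :=
  {h | EinsteinOpEq γ h 0}

end Manifold

end

/-!
# Eigenvalues of the Einstein operator on closed Einstein 3-manifolds

In dimension three `Ric = -(2/9) γ` forces constant sectional curvature `-1/9`
(`curvature_algebra`), so that `Δ_E h = ∇*∇ h - (2/9) h + (2/9) (tr h) γ`. Let `Δ_E h = λ h`, and
write `u = tr h`, `η_i = ∇^j h_{ij}` and `W_{ij} = ∇_i η_j`. The theorem rests on three identities,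
each of which exhibits a sum of squares as the divergence of a covector field; on a closed manifold
such a sum vanishes (`diver_eq_zero_of_nonneg`).

* For `ξ_k = u ∇_k u` the divergence is `|∇u|² + (4/9 - λ) u²`, so `u = 0` if `λ < 4/9`.
* If `u = 0` and `ξ_k = h^{ij} ∇_k h_{ij} - h^{ij} ∇_i h_{jk} + h_k^i η_i`, the divergence is
  `½ |∇_k h_{ij} - ∇_i h_{kj}|² + |η|² + (1/9 - λ) |h|²`. Hence `h = 0` if `λ < 1/9`.
* If `u = 0` and `ξ_k = W^{ij} ∇_i h_{jk} - W^{ij} ∇_k h_{ij} - (λ - 1/9) h_k^i η_i - η^i W_{ik}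
  + (tr W) η_k`, the divergence is `½ |W_{ij} - W_{ji}|² + (div η)² + (4/9 - λ) |η|²`. Hence `η = 0`
  if `λ < 4/9`.

These are `trace_algebra`, `bound_algebra` and `divergence_free_algebra`. The third one replaces the
argument that `Δ_E` commutes with the divergence up to the Hodge Laplacian on covectors, and thereby
avoids third derivatives of `h`. The kernel of `Δ_E` is zero because `0 < 1/9`.

Tensor fields are represented by their components in all smooth charts, subject to the
transformation law (`IsTensor1`, `IsTensor2`, `IsTensor3`); covariant differentiation and
contraction preserve the law. The identities are checked at the centre of a normal chart
(`IsMetric.exists_isNormalAt`), where the Christoffel symbols vanish and covariant derivatives of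
first order are partial derivatives. The divergence theorem follows from integration by parts in
`ℝ³`, a partition of unity and the change of variables formula.
-/

noncomputable section

open Set Filter Topology MeasureTheory

/-! ### Forms with given components -/

/-- The vector `∂_i` of the standard basis of `ℝ³`. -/
abbrev stdVec (i : Fin 3) : E3 := EuclideanSpace.single i (1 : ℝ)

/-- The linear form with components `a_i`. -/
def form1 (a : Fin 3 → ℝ) (v : E3) : ℝ := ∑ i, a i * v i

/-- The bilinear form with components `a_{ij}`. -/
def form2 (a : Matrix (Fin 3) (Fin 3) ℝ) (v w : E3) : ℝ := ∑ i, ∑ j, a i j * (v i * w j)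

/-- The trilinear form with components `a_{kij}`. -/
def form3 (a : Fin 3 → Fin 3 → Fin 3 → ℝ) (u v w : E3) : ℝ :=
  ∑ k, ∑ i, ∑ j, a k i j * (u k * (v i * w j))

@[simp] theorem form1_stdVec (a : Fin 3 → ℝ) (i : Fin 3) : form1 a (stdVec i) = a i := by
  simp [form1]

@[simp] theorem form2_stdVec (a : Matrix (Fin 3) (Fin 3) ℝ) (i j : Fin 3) :
    form2 a (stdVec i) (stdVec j) = a i j := by
  simp [form2]

@[simp] theorem form3_stdVec (a : Fin 3 → Fin 3 → Fin 3 → ℝ) (k i j : Fin 3) :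
    form3 a (stdVec k) (stdVec i) (stdVec j) = a k i j := by
  simp [form3]

theorem sum_smul_stdVec (v : E3) : ∑ i, v i • stdVec i = v := by
  ext j
  simp [Pi.single_apply]

/-! ### Changes of coordinates -/

section Overlap

variable {M : Type*} [TopologicalSpace M]

/-- The change of coordinates from the chart `ψ` to the chart `φ`. -/
def coordChange (φ ψ : OpenPartialHomeomorph M E3) (y : E3) : E3 := φ (ψ.symm y)

/-- The part of `ψ.target` on which `coordChange φ ψ` is the change of coordinates. -/
def overlap (φ ψ : OpenPartialHomeomorph M E3) : Set E3 := ψ.target ∩ ψ.symm ⁻¹' φ.source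

theorem isOpen_overlap (φ ψ : OpenPartialHomeomorph M E3) : IsOpen (overlap φ ψ) :=
  ψ.isOpen_inter_preimage_symm φ.open_source

theorem coordChange_mem_overlap {φ ψ : OpenPartialHomeomorph M E3} {y : E3}
    (hy : y ∈ overlap φ ψ) : coordChange φ ψ y ∈ overlap ψ φ := by
  refine ⟨φ.map_source hy.2, ?_⟩
  simp only [coordChange, mem_preimage, φ.left_inv hy.2]
  exact ψ.map_target hy.1

theorem coordChange_coordChange {φ ψ : OpenPartialHomeomorph M E3} {y : E3}
    (hy : y ∈ overlap φ ψ) : coordChange ψ φ (coordChange φ ψ y) = y := by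
  simp only [coordChange, φ.left_inv hy.2, ψ.right_inv hy.1]

theorem symm_coordChange {φ ψ : OpenPartialHomeomorph M E3} {y : E3}
    (hy : y ∈ overlap φ ψ) : φ.symm (coordChange φ ψ y) = ψ.symm y :=
  φ.left_inv hy.2

/-- The differential of a change of coordinates. -/
def jac (φ ψ : OpenPartialHomeomorph M E3) (y : E3) : E3 →L[ℝ] E3 :=
  fderiv ℝ (coordChange φ ψ) y

end Overlap

section Charts

variable {M : Type*} [TopologicalSpace M] [ChartedSpace E3 M]

theorem contDiffOn_coordChange {φ ψ : OpenPartialHomeomorph M E3}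
    (hφ : φ ∈ IsManifold.maximalAtlas (𝓡 3) ∞ M) (hψ : ψ ∈ IsManifold.maximalAtlas (𝓡 3) ∞ M) :
    ContDiffOn ℝ ∞ (coordChange φ ψ) (overlap φ ψ) := by
  rw [← contMDiffOn_iff_contDiffOn]
  exact (contMDiffOn_of_mem_maximalAtlas hφ).comp'
    (contMDiffOn_symm_of_mem_maximalAtlas hψ)

theorem contDiffAt_coordChange {φ ψ : OpenPartialHomeomorph M E3}
    (hφ : φ ∈ IsManifold.maximalAtlas (𝓡 3) ∞ M) (hψ : ψ ∈ IsManifold.maximalAtlas (𝓡 3) ∞ M)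
    {y : E3} (hy : y ∈ overlap φ ψ) : ContDiffAt ℝ ∞ (coordChange φ ψ) y :=
  (contDiffOn_coordChange hφ hψ).contDiffAt ((isOpen_overlap φ ψ).mem_nhds hy)

theorem hasFDerivAt_coordChange {φ ψ : OpenPartialHomeomorph M E3}
    (hφ : φ ∈ IsManifold.maximalAtlas (𝓡 3) ∞ M) (hψ : ψ ∈ IsManifold.maximalAtlas (𝓡 3) ∞ M)
    {y : E3} (hy : y ∈ overlap φ ψ) : HasFDerivAt (coordChange φ ψ) (jac φ ψ y) y :=
  ((contDiffAt_coordChange hφ hψ hy).differentiableAt (by simp)).hasFDerivAt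

theorem jac_jac {φ ψ : OpenPartialHomeomorph M E3}
    (hφ : φ ∈ IsManifold.maximalAtlas (𝓡 3) ∞ M) (hψ : ψ ∈ IsManifold.maximalAtlas (𝓡 3) ∞ M)
    {y : E3} (hy : y ∈ overlap φ ψ) (v : E3) :
    jac ψ φ (coordChange φ ψ y) (jac φ ψ y v) = v := by
  have h1 := hasFDerivAt_coordChange hφ hψ hy
  have h2 := hasFDerivAt_coordChange hψ hφ (coordChange_mem_overlap hy)
  have h3 := h2.comp y h1
  have h4 : (coordChange ψ φ ∘ coordChange φ ψ) =ᶠ[𝓝 y] id := by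
    filter_upwards [(isOpen_overlap φ ψ).mem_nhds hy] with z hz
    exact coordChange_coordChange hz
  have h5 := (h3.congr_of_eventuallyEq h4.symm).unique (hasFDerivAt_id y)
  exact congrArg (fun L : E3 →L[ℝ] E3 => L v) h5

theorem jac_injective {φ ψ : OpenPartialHomeomorph M E3}
    (hφ : φ ∈ IsManifold.maximalAtlas (𝓡 3) ∞ M) (hψ : ψ ∈ IsManifold.maximalAtlas (𝓡 3) ∞ M)
    {y : E3} (hy : y ∈ overlap φ ψ) : Function.Injective (jac φ ψ y) :=
  Function.LeftInverse.injective (jac_jac hφ hψ hy)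

theorem jac_surjective {φ ψ : OpenPartialHomeomorph M E3}
    (hφ : φ ∈ IsManifold.maximalAtlas (𝓡 3) ∞ M) (hψ : ψ ∈ IsManifold.maximalAtlas (𝓡 3) ∞ M)
    {y : E3} (hy : y ∈ overlap φ ψ) : Function.Surjective (jac φ ψ y) :=
  LinearMap.surjective_of_injective (f := (jac φ ψ y).toLinearMap) (jac_injective hφ hψ hy)

/-- Transport of a field of bilinear forms along an equality of points; the tangent spaces are all
identified with `E3`. -/
theorem bilin_apply_congr
    (b : ∀ x : M, TangentSpace (𝓡 3) x →L[ℝ] TangentSpace (𝓡 3) x →L[ℝ] ℝ) {x x' : M}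
    (h : x = x') (v w : E3) :
    (b x : E3 →L[ℝ] E3 →L[ℝ] ℝ) v w = (b x' : E3 →L[ℝ] E3 →L[ℝ] ℝ) v w := by
  subst h; rfl

theorem form2_components (b : ∀ x : M, TangentSpace (𝓡 3) x →L[ℝ] TangentSpace (𝓡 3) x →L[ℝ] ℝ)
    (φ : OpenPartialHomeomorph M E3) (y v w : E3) :
    form2 (components b φ y) v w =
      b (φ.symm y) (mfderiv (𝓡 3) (𝓡 3) φ.symm y v) (mfderiv (𝓡 3) (𝓡 3) φ.symm y w) := by
  set L : E3 →L[ℝ] E3 := mfderiv (𝓡 3) (𝓡 3) φ.symm y with hL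
  set B : E3 →L[ℝ] E3 →L[ℝ] ℝ := b (φ.symm y) with hB
  have key : form2 (components b φ y) v w = B (L v) (L w) := by
    conv_rhs => rw [← sum_smul_stdVec v, ← sum_smul_stdVec w]
    simp only [map_sum, map_smul, _root_.sum_apply, _root_.smul_apply,
      smul_eq_mul, Finset.mul_sum]
    unfold form2
    rw [Finset.sum_comm]
    refine Finset.sum_congr rfl fun i _ => Finset.sum_congr rfl fun j _ => ?_
    change B (L (stdVec _)) (L (stdVec _)) * _ = _
    ring
  exact key

/-- The transformation law of the components of a field of bilinear forms. -/
theorem components_coordChange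
    (b : ∀ x : M, TangentSpace (𝓡 3) x →L[ℝ] TangentSpace (𝓡 3) x →L[ℝ] ℝ)
    {φ ψ : OpenPartialHomeomorph M E3}
    (hφ : φ ∈ IsManifold.maximalAtlas (𝓡 3) ∞ M) (hψ : ψ ∈ IsManifold.maximalAtlas (𝓡 3) ∞ M)
    {y : E3} (hy : y ∈ overlap φ ψ) (v w : E3) :
    form2 (components b ψ y) v w =
      form2 (components b φ (coordChange φ ψ y)) (jac φ ψ y v) (jac φ ψ y w) := by
  have hcomp : ∀ u : E3, (mfderiv (𝓡 3) (𝓡 3) ψ.symm y : E3 →L[ℝ] E3) u =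
      (mfderiv (𝓡 3) (𝓡 3) φ.symm (coordChange φ ψ y) : E3 →L[ℝ] E3) (jac φ ψ y u) := by
    intro u
    have h1 : (ψ.symm : E3 → M) =ᶠ[𝓝 y] φ.symm ∘ coordChange φ ψ := by
      filter_upwards [(isOpen_overlap φ ψ).mem_nhds hy] with z hz
      exact (symm_coordChange hz).symm
    have h2 : MDifferentiableAt (𝓡 3) (𝓡 3) φ.symm (coordChange φ ψ y) :=
      (contMDiffAt_symm_of_mem_maximalAtlas hφ (coordChange_mem_overlap hy).1).mdifferentiableAt
        (by simp)
    have h3 : HasMFDerivAt (𝓡 3) (𝓡 3) (coordChange φ ψ) y (jac φ ψ y) :=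
      (hasFDerivAt_coordChange hφ hψ hy).hasMFDerivAt
    have h4 := (h2.hasMFDerivAt.comp y h3).congr_of_eventuallyEq h1
    have h5 := h4.mfderiv
    exact congrArg (fun L : E3 →L[ℝ] E3 => L u) h5
  rw [form2_components, form2_components]
  have := bilin_apply_congr b (symm_coordChange hy).symm
    ((mfderiv (𝓡 3) (𝓡 3) ψ.symm y : E3 →L[ℝ] E3) v)
    ((mfderiv (𝓡 3) (𝓡 3) ψ.symm y : E3 →L[ℝ] E3) w)
  rw [hcomp v, hcomp w] at this
  rw [← this]
  have e1 := hcomp v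
  have e2 := hcomp w
  change (b (ψ.symm y) : E3 →L[ℝ] E3 →L[ℝ] ℝ) _ _ = (b (ψ.symm y) : E3 →L[ℝ] E3 →L[ℝ] ℝ) _ _
  rw [← e1, ← e2]

variable [IsManifold (𝓡 3) ∞ M]

theorem contMDiffOn_vectorField {φ : OpenPartialHomeomorph M E3}
    (hφ : φ ∈ IsManifold.maximalAtlas (𝓡 3) ∞ M) (i : Fin 3) :
    ContMDiffOn (𝓡 3) (𝓡 3).tangent ∞
      (fun y : E3 => (⟨φ.symm y, coordVec φ i y⟩ : TangentBundle (𝓡 3) M)) φ.target := by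
  have h1 := contMDiffOn_symm_of_mem_maximalAtlas hφ
  have h2 := h1.contMDiffOn_tangentMapWithin (m := ∞) (by simp) φ.open_target.uniqueMDiffOn
  have h3 : ContMDiff (𝓡 3) (𝓡 3).tangent ∞
      (fun y : E3 => (⟨y, stdVec i⟩ : TangentBundle (𝓡 3) E3)) := by
    exact contMDiff_vectorSpace_iff_contDiff.2 contDiff_const
  have h4 := h2.comp h3.contMDiffOn (s := φ.target) (fun y hy => hy)
  refine h4.congr fun y hy => ?_
  simp only [Function.comp, tangentMapWithin, coordVec]
  rw [mfderivWithin_of_isOpen φ.open_target hy]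

/-- The components of a smooth field of bilinear forms in a chart are smooth. -/
theorem contDiffOn_components
    {b : ∀ x : M, TangentSpace (𝓡 3) x →L[ℝ] TangentSpace (𝓡 3) x →L[ℝ] ℝ}
    (hb : ContMDiff (𝓡 3) ((𝓡 3).prod 𝓘(ℝ, E3 →L[ℝ] E3 →L[ℝ] ℝ)) ∞
      (fun x => TotalSpace.mk' (E3 →L[ℝ] E3 →L[ℝ] ℝ) x (b x)))
    {φ : OpenPartialHomeomorph M E3} (hφ : φ ∈ IsManifold.maximalAtlas (𝓡 3) ∞ M) (i j : Fin 3) :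
    ContDiffOn ℝ ∞ (fun y => components b φ y i j) φ.target := by
  have h1 := contMDiffOn_symm_of_mem_maximalAtlas hφ
  have h2 := hb.comp_contMDiffOn h1
  have : ContMDiffOn (𝓡 3) ((𝓡 3).prod 𝓘(ℝ, ℝ)) ∞
      (fun y : E3 ↦ TotalSpace.mk' ℝ (E := Bundle.Trivial M ℝ) (φ.symm y)
        (b (φ.symm y) (coordVec φ i y) (coordVec φ j y))) φ.target := by
    apply ContMDiffOn.clm_bundle_apply₂ (F₁ := E3) (F₂ := E3)
    · exact h2
    · exact contMDiffOn_vectorField hφ i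
    · exact contMDiffOn_vectorField hφ j
  rw [← contMDiffOn_iff_contDiffOn]
  intro y hy
  have h3 := this y hy
  simp only [contMDiffWithinAt_totalSpace] at h3
  exact h3.2

end Charts

/-! ### Multilinearity of forms -/

section FormAlgebra

theorem form1_add (a : Fin 3 → ℝ) (v v' : E3) : form1 a (v + v') = form1 a v + form1 a v' := by
  simp only [form1, PiLp.add_apply, mul_add, Finset.sum_add_distrib]

theorem form1_smul (a : Fin 3 → ℝ) (c : ℝ) (v : E3) : form1 a (c • v) = c * form1 a v := by
  simp only [form1, PiLp.smul_apply, smul_eq_mul, Finset.mul_sum]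
  exact Finset.sum_congr rfl fun i _ => by ring

theorem form2_add_left (a : Matrix (Fin 3) (Fin 3) ℝ) (v v' w : E3) :
    form2 a (v + v') w = form2 a v w + form2 a v' w := by
  simp only [form2, PiLp.add_apply, mul_add, add_mul, Finset.sum_add_distrib]

theorem form2_add_right (a : Matrix (Fin 3) (Fin 3) ℝ) (v w w' : E3) :
    form2 a v (w + w') = form2 a v w + form2 a v w' := by
  simp only [form2, PiLp.add_apply, mul_add, Finset.sum_add_distrib]

theorem form2_smul_left (a : Matrix (Fin 3) (Fin 3) ℝ) (c : ℝ) (v w : E3) :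
    form2 a (c • v) w = c * form2 a v w := by
  simp only [form2, PiLp.smul_apply, smul_eq_mul, Finset.mul_sum]
  exact Finset.sum_congr rfl fun i _ => Finset.sum_congr rfl fun j _ => by ring

theorem form2_smul_right (a : Matrix (Fin 3) (Fin 3) ℝ) (c : ℝ) (v w : E3) :
    form2 a v (c • w) = c * form2 a v w := by
  simp only [form2, PiLp.smul_apply, smul_eq_mul, Finset.mul_sum]
  exact Finset.sum_congr rfl fun i _ => Finset.sum_congr rfl fun j _ => by ring

theorem form2_symm {a : Matrix (Fin 3) (Fin 3) ℝ} (ha : ∀ i j, a i j = a j i) (v w : E3) :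
    form2 a v w = form2 a w v := by
  unfold form2
  rw [Finset.sum_comm]
  exact Finset.sum_congr rfl fun i _ => Finset.sum_congr rfl fun j _ => by rw [ha]; ring

theorem form3_add_left (a : Fin 3 → Fin 3 → Fin 3 → ℝ) (u u' v w : E3) :
    form3 a (u + u') v w = form3 a u v w + form3 a u' v w := by
  simp only [form3, PiLp.add_apply, mul_add, add_mul, Finset.sum_add_distrib]

theorem form3_add_mid (a : Fin 3 → Fin 3 → Fin 3 → ℝ) (u v v' w : E3) :
    form3 a u (v + v') w = form3 a u v w + form3 a u v' w := by
  simp only [form3, PiLp.add_apply, mul_add, add_mul, Finset.sum_add_distrib]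

theorem form3_add_right (a : Fin 3 → Fin 3 → Fin 3 → ℝ) (u v w w' : E3) :
    form3 a u v (w + w') = form3 a u v w + form3 a u v w' := by
  simp only [form3, PiLp.add_apply, mul_add, Finset.sum_add_distrib]

theorem form3_smul_left (a : Fin 3 → Fin 3 → Fin 3 → ℝ) (c : ℝ) (u v w : E3) :
    form3 a (c • u) v w = c * form3 a u v w := by
  simp only [form3, PiLp.smul_apply, smul_eq_mul, Finset.mul_sum]
  exact Finset.sum_congr rfl fun k _ => Finset.sum_congr rfl fun i _ =>
    Finset.sum_congr rfl fun j _ => by ring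

theorem form3_smul_mid (a : Fin 3 → Fin 3 → Fin 3 → ℝ) (c : ℝ) (u v w : E3) :
    form3 a u (c • v) w = c * form3 a u v w := by
  simp only [form3, PiLp.smul_apply, smul_eq_mul, Finset.mul_sum]
  exact Finset.sum_congr rfl fun k _ => Finset.sum_congr rfl fun i _ =>
    Finset.sum_congr rfl fun j _ => by ring

theorem form3_smul_right (a : Fin 3 → Fin 3 → Fin 3 → ℝ) (c : ℝ) (u v w : E3) :
    form3 a u v (c • w) = c * form3 a u v w := by
  simp only [form3, PiLp.smul_apply, smul_eq_mul, Finset.mul_sum]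
  exact Finset.sum_congr rfl fun k _ => Finset.sum_congr rfl fun i _ =>
    Finset.sum_congr rfl fun j _ => by ring

end FormAlgebra

/-! ### The Levi-Civita connection under changes of coordinates -/

section LocalCalculus

open Coord

/-- The partial derivatives `∂_i η_j` of the components of a covector field. -/
def pd1 (η : E3 → Fin 3 → ℝ) (y : E3) : Matrix (Fin 3) (Fin 3) ℝ :=
  Matrix.of fun k i => pd k (fun z => η z i) y

/-- The partial derivatives `∂_k h_{ij}` of the components of a 2-tensor field. -/
def pd2 (h : E3 → Matrix (Fin 3) (Fin 3) ℝ) (y : E3) (k i j : Fin 3) : ℝ :=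
  pd k (fun z => h z i j) y

theorem fderiv_eq_sum_pd (f : E3 → ℝ) (y u : E3) : fderiv ℝ f y u = ∑ k, pd k f y * u k := by
  conv_lhs => rw [← sum_smul_stdVec u]
  simp only [map_sum, map_smul, smul_eq_mul, pd]
  exact Finset.sum_congr rfl fun k _ => mul_comm _ _

theorem HasFDerivAt.coord {V : E3 → E3} {V' : E3 →L[ℝ] E3} {y : E3} (hV : HasFDerivAt V V' y)
    (i : Fin 3) :
    HasFDerivAt (fun z => V z i) ((PiLp.proj 2 (fun _ : Fin 3 => ℝ) i : E3 →L[ℝ] ℝ).comp V') y :=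
  ((PiLp.proj 2 (fun _ : Fin 3 => ℝ) i : E3 →L[ℝ] ℝ).hasFDerivAt.comp y hV)

theorem fderiv_form1_comp {η : E3 → Fin 3 → ℝ} {f V : E3 → E3} {f' V' : E3 →L[ℝ] E3} {y : E3}
    (hη : ∀ i, DifferentiableAt ℝ (fun z => η z i) (f y)) (hf : HasFDerivAt f f' y)
    (hV : HasFDerivAt V V' y) (u : E3) :
    fderiv ℝ (fun z => form1 (η (f z)) (V z)) y u =
      form2 (pd1 η (f y)) (f' u) (V y) + form1 (η (f y)) (V' u) := by
  have h := HasFDerivAt.fun_sum (u := Finset.univ) fun i _ =>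
    ((hη i).hasFDerivAt.comp y hf).mul (hV.coord i)
  have h' : HasFDerivAt (fun z => form1 (η (f z)) (V z)) _ y := h
  rw [h'.fderiv]
  simp only [_root_.sum_apply, _root_.add_apply, _root_.smul_apply, smul_eq_mul,
    ContinuousLinearMap.comp_apply, Function.comp, fderiv_eq_sum_pd, PiLp.proj_apply,
    Finset.sum_add_distrib]
  rw [add_comm]
  congr 1
  simp only [form2, pd1, Matrix.of_apply]
  rw [Finset.sum_comm]
  simp only [Finset.mul_sum]
  exact Finset.sum_congr rfl fun i _ => Finset.sum_congr rfl fun j _ => by ring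

theorem fderiv_form2_comp {h : E3 → Matrix (Fin 3) (Fin 3) ℝ} {f V W : E3 → E3}
    {f' V' W' : E3 →L[ℝ] E3} {y : E3}
    (hh : ∀ i j, DifferentiableAt ℝ (fun z => h z i j) (f y)) (hf : HasFDerivAt f f' y)
    (hV : HasFDerivAt V V' y) (hW : HasFDerivAt W W' y) (u : E3) :
    fderiv ℝ (fun z => form2 (h (f z)) (V z) (W z)) y u =
      form3 (pd2 h (f y)) (f' u) (V y) (W y) + form2 (h (f y)) (V' u) (W y)
        + form2 (h (f y)) (V y) (W' u) := by
  have h0 := HasFDerivAt.fun_sum (u := Finset.univ) fun i _ =>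
    HasFDerivAt.fun_sum (u := Finset.univ) fun j _ =>
      ((hh i j).hasFDerivAt.comp y hf).mul ((hV.coord i).mul (hW.coord j))
  have h' : HasFDerivAt (fun z => form2 (h (f z)) (V z) (W z)) _ y := h0
  rw [h'.fderiv]
  simp only [_root_.add_apply, _root_.smul_apply, smul_eq_mul,
    ContinuousLinearMap.comp_apply, Function.comp, fderiv_eq_sum_pd, PiLp.proj_apply,
    Pi.mul_apply, form2, form3, pd2, Fin.sum_univ_three]
  ring

theorem fderiv_form1 {η : E3 → Fin 3 → ℝ} {y : E3}
    (hη : ∀ i, DifferentiableAt ℝ (fun z => η z i) y) (u v : E3) :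
    fderiv ℝ (fun z => form1 (η z) v) y u = form2 (pd1 η y) u v := by
  have := fderiv_form1_comp (f := id) hη (hasFDerivAt_id y) (hasFDerivAt_const v y) u
  simpa [form1] using this

theorem fderiv_form2 {h : E3 → Matrix (Fin 3) (Fin 3) ℝ} {y : E3}
    (hh : ∀ i j, DifferentiableAt ℝ (fun z => h z i j) y) (u v w : E3) :
    fderiv ℝ (fun z => form2 (h z) v w) y u = form3 (pd2 h y) u v w := by
  have := fderiv_form2_comp (f := id) hh (hasFDerivAt_id y) (hasFDerivAt_const v y)
    (hasFDerivAt_const w y) u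
  simpa [form2] using this

/-- The vector `Γ(u, v)` with components `Γ^k_{ij} u^i v^j`. -/
def chr (g : E3 → Matrix (Fin 3) (Fin 3) ℝ) (y u v : E3) : E3 :=
  WithLp.toLp 2 fun k => ∑ i, ∑ j, christoffel g k i j y * (u i * v j)

/-- The Koszul formula: `g(Γ(u, v), w)` in terms of the derivatives of `g`. -/
theorem form2_chr {g : E3 → Matrix (Fin 3) (Fin 3) ℝ} {y : E3}
    (hsym : ∀ z i j, g z i j = g z j i)
    (hdet : (g y).det ≠ 0) (u v w : E3) :
    form2 (g y) (chr g y u v) w = (1 / 2 : ℝ) * (form3 (pd2 g y) u v w + form3 (pd2 g y) v u w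
      - form3 (pd2 g y) w u v) := by
  have hmul : g y * (g y)⁻¹ = 1 := Matrix.mul_nonsing_inv _ (isUnit_iff_ne_zero.2 hdet)
  have key : ∀ l i j, ∑ k, g y k l * christoffel g k i j y =
      (1 / 2 : ℝ) * (pd2 g y i j l + pd2 g y j i l - pd2 g y l i j) := by
    intro l i j
    have e : ∀ m, ∑ k, g y k l * (g y)⁻¹ k m = if l = m then 1 else 0 := by
      intro m
      have := congrFun (congrFun hmul l) m
      rw [Matrix.mul_apply, Matrix.one_apply] at this
      rw [← this]
      exact Finset.sum_congr rfl fun k _ => by rw [hsym]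
    calc ∑ k, g y k l * christoffel g k i j y
        = (1 / 2 : ℝ) * ∑ m, (∑ k, g y k l * (g y)⁻¹ k m) *
            (pd2 g y i j m + pd2 g y j i m - pd2 g y m i j) := by
          simp only [christoffel, ginv, pd2, Fin.sum_univ_three]
          ring
      _ = _ := by simp [e]
  have e : form2 (g y) (chr g y u v) w =
      form3 (fun i j l => ∑ k, g y k l * christoffel g k i j y) u v w := by
    simp only [form2, form3, chr, Fin.sum_univ_three]
    ring
  rw [e]
  simp only [key, form3, Fin.sum_univ_three]
  ring

theorem chr_symm {g : E3 → Matrix (Fin 3) (Fin 3) ℝ} (hsym : ∀ z i j, g z i j = g z j i)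
    (k i j : Fin 3) (y : E3) : christoffel g k i j y = christoffel g k j i y := by
  have : (fun z => g z i j) = fun z => g z j i := funext fun z => hsym z i j
  simp only [christoffel, this]
  congr 1
  exact Finset.sum_congr rfl fun l _ => by ring

theorem pd2_symm {g : E3 → Matrix (Fin 3) (Fin 3) ℝ} (hsym : ∀ z i j, g z i j = g z j i)
    (y : E3) (k i j : Fin 3) : pd2 g y k i j = pd2 g y k j i := by
  have : (fun z => g z i j) = fun z => g z j i := funext fun z => hsym z i j
  simp only [pd2, this]

theorem form3_symm {a : Fin 3 → Fin 3 → Fin 3 → ℝ} (ha : ∀ k i j, a k i j = a k j i)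
    (u v w : E3) : form3 a u v w = form3 a u w v := by
  unfold form3
  refine Finset.sum_congr rfl fun k _ => ?_
  rw [Finset.sum_comm]
  exact Finset.sum_congr rfl fun i _ => Finset.sum_congr rfl fun j _ => by rw [ha]; ring

/-- The Levi-Civita connection is compatible with the metric. -/
theorem form3_pd2_metric {g : E3 → Matrix (Fin 3) (Fin 3) ℝ} {y : E3}
    (hsym : ∀ z i j, g z i j = g z j i) (hdet : (g y).det ≠ 0) (u v w : E3) :
    form3 (pd2 g y) u v w = form2 (g y) (chr g y u v) w + form2 (g y) v (chr g y u w) := by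
  rw [form2_symm (hsym y) v, form2_chr hsym hdet, form2_chr hsym hdet,
    form3_symm (pd2_symm hsym y) v u w, form3_symm (pd2_symm hsym y) w u v,
    form3_symm (pd2_symm hsym y) u v w, form3_symm (pd2_symm hsym y) v w u,
    form3_symm (pd2_symm hsym y) w v u]
  ring

/-- The components `∇_k η_i` of the covariant derivative of a covector field. -/
def cov1 (g : E3 → Matrix (Fin 3) (Fin 3) ℝ) (η : E3 → Fin 3 → ℝ) (y : E3) :
    Matrix (Fin 3) (Fin 3) ℝ :=
  Matrix.of fun k i => pd k (fun z => η z i) y - ∑ m, christoffel g m k i y * η y m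

theorem form2_cov1 (g : E3 → Matrix (Fin 3) (Fin 3) ℝ) (η : E3 → Fin 3 → ℝ) (y u v : E3) :
    form2 (cov1 g η y) u v = form2 (pd1 η y) u v - form1 (η y) (chr g y u v) := by
  simp only [form2, form1, chr, cov1, pd1, Matrix.of_apply, Fin.sum_univ_three]
  ring

/-- The components `∇_k h_{ij}` of the covariant derivative of a 2-tensor field. -/
def cov2 (g h : E3 → Matrix (Fin 3) (Fin 3) ℝ) (y : E3) (k i j : Fin 3) : ℝ := nabla g h k i j y

theorem form3_cov2 (g h : E3 → Matrix (Fin 3) (Fin 3) ℝ) (y u v w : E3) :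
    form3 (cov2 g h y) u v w =
      form3 (pd2 h y) u v w - form2 (h y) (chr g y u v) w - form2 (h y) v (chr g y u w) := by
  simp only [form3, form2, chr, cov2, nabla, pd2, Fin.sum_univ_three]
  ring

/-- `h'` is the pull-back of the 2-tensor field `h` under `f`, near `y`. -/
def PullsBack2 (f : E3 → E3) (h h' : E3 → Matrix (Fin 3) (Fin 3) ℝ) (y : E3) : Prop :=
  ∀ᶠ z in 𝓝 y, ∀ v w, form2 (h' z) v w = form2 (h (f z)) (fderiv ℝ f z v) (fderiv ℝ f z w)

/-- `η'` is the pull-back of the covector field `η` under `f`, near `y`. -/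
def PullsBack1 (f : E3 → E3) (η η' : E3 → Fin 3 → ℝ) (y : E3) : Prop :=
  ∀ᶠ z in 𝓝 y, ∀ v, form1 (η' z) v = form1 (η (f z)) (fderiv ℝ f z v)

theorem hasFDerivAt_fderiv_apply {f : E3 → E3} {y : E3} (hf : ContDiffAt ℝ ∞ f y) (v : E3) :
    HasFDerivAt (fun z => fderiv ℝ f z v) ((fderiv ℝ (fderiv ℝ f) y).flip v) y := by
  have h1 : ContDiffAt ℝ 1 (fderiv ℝ f) y := hf.fderiv_right (by norm_cast)
  have h2 := (h1.differentiableAt (by simp)).hasFDerivAt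
  exact h2.clm_apply (hasFDerivAt_const v y) |>.congr_fderiv (by ext; simp)

/-- The partial derivatives of a pulled back 2-tensor field are not tensorial: the second
derivatives of the change of coordinates enter. -/
theorem form3_pd2_pullback {f : E3 → E3} {h h' : E3 → Matrix (Fin 3) (Fin 3) ℝ} {y : E3}
    (hf : ContDiffAt ℝ ∞ f y) (hp : PullsBack2 f h h' y)
    (hh : ∀ i j, DifferentiableAt ℝ (fun z => h z i j) (f y))
    (hh' : ∀ i j, DifferentiableAt ℝ (fun z => h' z i j) y) (u v w : E3) :
    form3 (pd2 h' y) u v w =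
      form3 (pd2 h (f y)) (fderiv ℝ f y u) (fderiv ℝ f y v) (fderiv ℝ f y w)
      + form2 (h (f y)) (fderiv ℝ (fderiv ℝ f) y u v) (fderiv ℝ f y w)
      + form2 (h (f y)) (fderiv ℝ f y v) (fderiv ℝ (fderiv ℝ f) y u w) := by
  rw [← fderiv_form2 hh']
  have e : (fun z => form2 (h' z) v w) =ᶠ[𝓝 y]
      fun z => form2 (h (f z)) (fderiv ℝ f z v) (fderiv ℝ f z w) := by
    filter_upwards [hp] with z hz using hz v w
  rw [e.fderiv_eq, fderiv_form2_comp hh (hf.differentiableAt (by simp)).hasFDerivAt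
    (hasFDerivAt_fderiv_apply hf v) (hasFDerivAt_fderiv_apply hf w)]
  simp

theorem form2_pd1_pullback {f : E3 → E3} {η η' : E3 → Fin 3 → ℝ} {y : E3}
    (hf : ContDiffAt ℝ ∞ f y) (hp : PullsBack1 f η η' y)
    (hη : ∀ i, DifferentiableAt ℝ (fun z => η z i) (f y))
    (hη' : ∀ i, DifferentiableAt ℝ (fun z => η' z i) y) (u v : E3) :
    form2 (pd1 η' y) u v = form2 (pd1 η (f y)) (fderiv ℝ f y u) (fderiv ℝ f y v)
      + form1 (η (f y)) (fderiv ℝ (fderiv ℝ f) y u v) := by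
  rw [← fderiv_form1 hη']
  have e : (fun z => form1 (η' z) v) =ᶠ[𝓝 y] fun z => form1 (η (f z)) (fderiv ℝ f z v) := by
    filter_upwards [hp] with z hz using hz v
  rw [e.fderiv_eq, fderiv_form1_comp hη (hf.differentiableAt (by simp)).hasFDerivAt
    (hasFDerivAt_fderiv_apply hf v)]
  simp

theorem form2_left_injective {a : Matrix (Fin 3) (Fin 3) ℝ} (ha : a.det ≠ 0) {v v' : E3}
    (h : ∀ w, form2 a v w = form2 a v' w) : v = v' := by
  have h1 : Matrix.vecMul (v.ofLp) a = Matrix.vecMul (v'.ofLp) a := by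
    ext j
    have := h (stdVec j)
    simp only [form2] at this
    simp only [Matrix.vecMul, dotProduct]
    simpa [mul_comm] using this
  have h2 := Matrix.vecMul_injective_of_isUnit ((Matrix.isUnit_iff_isUnit_det a).2
    (isUnit_iff_ne_zero.2 ha)) h1
  exact WithLp.ofLp_injective 2 h2

/-- The transformation law of the Christoffel symbols, `Df Γ'(u, v) = Γ(Df u, Df v) + D²f(u, v)`.
Both sides are compared by pairing with the vectors `Df w` and applying the Koszul formula. -/
theorem chr_pullback {f : E3 → E3} {g g' : E3 → Matrix (Fin 3) (Fin 3) ℝ} {y : E3}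
    (hf : ContDiffAt ℝ ∞ f y) (hsurj : Function.Surjective (fderiv ℝ f y))
    (hp : PullsBack2 f g g' y)
    (hg : ∀ i j, DifferentiableAt ℝ (fun z => g z i j) (f y))
    (hg' : ∀ i j, DifferentiableAt ℝ (fun z => g' z i j) y)
    (hsym : ∀ z i j, g z i j = g z j i) (hsym' : ∀ z i j, g' z i j = g' z j i)
    (hdet : (g (f y)).det ≠ 0) (hdet' : (g' y).det ≠ 0) (u v : E3) :
    fderiv ℝ f y (chr g' y u v) =
      chr g (f y) (fderiv ℝ f y u) (fderiv ℝ f y v) + fderiv ℝ (fderiv ℝ f) y u v := by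
  refine form2_left_injective hdet fun w => ?_
  obtain ⟨w, rfl⟩ := hsurj w
  have hs : ∀ a b, fderiv ℝ (fderiv ℝ f) y a b = fderiv ℝ (fderiv ℝ f) y b a := fun a b =>
    (hf.isSymmSndFDerivAt (by
      simp only [minSmoothness_of_isRCLikeNormedField]
      exact WithTop.coe_le_coe.2 (le_top : (2 : ℕ∞) ≤ ⊤))).eq a b
  rw [← hp.self_of_nhds, form2_chr hsym' hdet', form2_add_left, form2_chr hsym hdet,
    form3_pd2_pullback hf hp hg hg', form3_pd2_pullback hf hp hg hg',
    form3_pd2_pullback hf hp hg hg', hs v u, hs w u, hs w v,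
    form2_symm (hsym (f y)) (fderiv ℝ f y v), form2_symm (hsym (f y)) (fderiv ℝ f y u)]
  ring

/-- A change of coordinates `f` near `y` pulling back the metric `g` to the metric `g'`. -/
structure IsIsometryAt (f : E3 → E3) (g g' : E3 → Matrix (Fin 3) (Fin 3) ℝ) (y : E3) : Prop where
  contDiffAt : ContDiffAt ℝ ∞ f y
  surjective : Function.Surjective (fderiv ℝ f y)
  pullsBack : PullsBack2 f g g' y
  diff : ∀ i j, DifferentiableAt ℝ (fun z => g z i j) (f y)
  diff' : ∀ i j, DifferentiableAt ℝ (fun z => g' z i j) y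
  symm : ∀ z i j, g z i j = g z j i
  symm' : ∀ z i j, g' z i j = g' z j i
  det : (g (f y)).det ≠ 0
  det' : (g' y).det ≠ 0

variable {f : E3 → E3} {g g' : E3 → Matrix (Fin 3) (Fin 3) ℝ} {y : E3}

theorem IsIsometryAt.fderiv_chr (hf : IsIsometryAt f g g' y) (u v : E3) :
    fderiv ℝ f y (chr g' y u v) =
      chr g (f y) (fderiv ℝ f y u) (fderiv ℝ f y v) + fderiv ℝ (fderiv ℝ f) y u v :=
  chr_pullback hf.contDiffAt hf.surjective hf.pullsBack hf.diff hf.diff' hf.symm hf.symm' hf.det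
    hf.det' u v

/-- Covariant differentiation of covector fields commutes with changes of coordinates. -/
theorem IsIsometryAt.form2_cov1 (hf : IsIsometryAt f g g' y) {η η' : E3 → Fin 3 → ℝ}
    (hp : PullsBack1 f η η' y) (hη : ∀ i, DifferentiableAt ℝ (fun z => η z i) (f y))
    (hη' : ∀ i, DifferentiableAt ℝ (fun z => η' z i) y) (u v : E3) :
    form2 (cov1 g' η' y) u v = form2 (cov1 g η (f y)) (fderiv ℝ f y u) (fderiv ℝ f y v) := by
  rw [_root_.form2_cov1, _root_.form2_cov1, form2_pd1_pullback hf.contDiffAt hp hη hη',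
    hp.self_of_nhds, hf.fderiv_chr, form1_add]
  ring

/-- Covariant differentiation of 2-tensor fields commutes with changes of coordinates. -/
theorem IsIsometryAt.form3_cov2 (hf : IsIsometryAt f g g' y)
    {h h' : E3 → Matrix (Fin 3) (Fin 3) ℝ} (hp : PullsBack2 f h h' y)
    (hh : ∀ i j, DifferentiableAt ℝ (fun z => h z i j) (f y))
    (hh' : ∀ i j, DifferentiableAt ℝ (fun z => h' z i j) y) (u v w : E3) :
    form3 (cov2 g' h' y) u v w =
      form3 (cov2 g h (f y)) (fderiv ℝ f y u) (fderiv ℝ f y v) (fderiv ℝ f y w) := by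
  rw [_root_.form3_cov2, _root_.form3_cov2, form3_pd2_pullback hf.contDiffAt hp hh hh',
    hp.self_of_nhds, hp.self_of_nhds, hf.fderiv_chr, hf.fderiv_chr, form2_add_left,
    form2_add_right]
  ring

end LocalCalculus

/-! ### Contraction of a bilinear form with a metric -/

section Contraction

/-- Bilinearity of a function of two vectors. -/
structure IsBilin (B : E3 → E3 → ℝ) : Prop where
  add_left : ∀ v v' w, B (v + v') w = B v w + B v' w
  smul_left : ∀ (c : ℝ) v w, B (c • v) w = c * B v w
  add_right : ∀ v w w', B v (w + w') = B v w + B v w'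
  smul_right : ∀ (c : ℝ) v w, B v (c • w) = c * B v w

theorem IsBilin.eq_form2 {B : E3 → E3 → ℝ} (hB : IsBilin B) (v w : E3) :
    B v w = form2 (Matrix.of fun i j => B (stdVec i) (stdVec j)) v w := by
  have hl : ∀ w, B v w = ∑ i, v i * B (stdVec i) w := by
    intro w
    conv_lhs => rw [← sum_smul_stdVec v]
    simp only [Fin.sum_univ_three, hB.add_left, hB.smul_left]
  have hr : ∀ i, B (stdVec i) w = ∑ j, w j * B (stdVec i) (stdVec j) := by
    intro i
    conv_lhs => rw [← sum_smul_stdVec w]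
    simp only [Fin.sum_univ_three, hB.add_right, hB.smul_right]
  rw [hl]
  simp only [hr, form2, Matrix.of_apply, Finset.mul_sum]
  exact Finset.sum_congr rfl fun i _ => Finset.sum_congr rfl fun j _ => by ring

/-- The contraction `g^{ij} B(∂_i, ∂_j)` of a bilinear form with the inverse of the metric `a`. -/
def contr (a : Matrix (Fin 3) (Fin 3) ℝ) (B : E3 → E3 → ℝ) : ℝ :=
  ∑ i, ∑ j, a⁻¹ i j * B (stdVec i) (stdVec j)

/-- The matrix of a linear map `J`. -/
def toMat (J : E3 →L[ℝ] E3) : Matrix (Fin 3) (Fin 3) ℝ := Matrix.of fun k i => J (stdVec i) k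

theorem eq_transpose_mul_mul {a a' : Matrix (Fin 3) (Fin 3) ℝ} {J : E3 →L[ℝ] E3}
    (h : ∀ v w, form2 a' v w = form2 a (J v) (J w)) : a' = (toMat J).transpose * a * toMat J := by
  ext i j
  rw [← form2_stdVec a' i j, h]
  simp only [form2, toMat, Matrix.mul_apply, Matrix.transpose_apply, Matrix.of_apply,
    Fin.sum_univ_three]
  ring

/-- Contractions are independent of the choice of coordinates. -/
theorem contr_comp {a a' : Matrix (Fin 3) (Fin 3) ℝ} {J : E3 →L[ℝ] E3} (ha' : a'.det ≠ 0)
    (h : ∀ v w, form2 a' v w = form2 a (J v) (J w)) {B : E3 → E3 → ℝ} (hB : IsBilin B) :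
    contr a' (fun v w => B (J v) (J w)) = contr a B := by
  set P := toMat J with hP
  have e : a' = P.transpose * a * P := eq_transpose_mul_mul h
  have hd : P.det * a.det * P.det ≠ 0 := by
    have := ha'
    rwa [e, Matrix.det_mul, Matrix.det_mul, Matrix.det_transpose] at this
  have hPdet : IsUnit P.det := isUnit_iff_ne_zero.2 (right_ne_zero_of_mul hd)
  have hPt : IsUnit P.transpose.det := by rwa [Matrix.det_transpose]
  have e2 : P * a'⁻¹ * P.transpose = a⁻¹ := by
    rw [e, Matrix.mul_inv_rev, Matrix.mul_inv_rev, ← Matrix.mul_assoc,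
      Matrix.mul_nonsing_inv _ hPdet, Matrix.one_mul, Matrix.mul_assoc,
      Matrix.nonsing_inv_mul _ hPt, Matrix.mul_one]
  unfold contr
  rw [← e2]
  simp only [hB.eq_form2 (J _) (J _)]
  simp only [form2, Matrix.mul_apply, Matrix.transpose_apply, Matrix.of_apply, hP, toMat,
    Fin.sum_univ_three]
  ring

end Contraction

/-! ### Smoothness of coordinate expressions -/

section Smoothness

open Coord

variable {U : Set E3} {g h : E3 → Matrix (Fin 3) (Fin 3) ℝ} {η : E3 → Fin 3 → ℝ}

theorem contDiffOn_pd (hU : IsOpen U) {f : E3 → ℝ} (hf : ContDiffOn ℝ ∞ f U) (k : Fin 3) :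
    ContDiffOn ℝ ∞ (pd k f) U :=
  (hf.fderiv_of_isOpen hU (m := ∞) (by simp)).clm_apply contDiffOn_const

theorem contDiffOn_det (hg : ∀ i j, ContDiffOn ℝ ∞ (fun y => g y i j) U) :
    ContDiffOn ℝ ∞ (fun y => (g y).det) U := by
  simp only [Matrix.det_fin_three]
  exact ((((((((hg _ _).mul (hg _ _)).mul (hg _ _)).sub (((hg _ _).mul (hg _ _)).mul (hg _ _))).sub
    (((hg _ _).mul (hg _ _)).mul (hg _ _))).add (((hg _ _).mul (hg _ _)).mul (hg _ _))).add
    (((hg _ _).mul (hg _ _)).mul (hg _ _))).sub (((hg _ _).mul (hg _ _)).mul (hg _ _)))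

theorem contDiffOn_ginv (hg : ∀ i j, ContDiffOn ℝ ∞ (fun y => g y i j) U)
    (hdet : ∀ y ∈ U, (g y).det ≠ 0) (i j : Fin 3) :
    ContDiffOn ℝ ∞ (fun y => (g y)⁻¹ i j) U := by
  have h1 : (fun y => (g y)⁻¹ i j) = fun y => ((g y).det)⁻¹ * (g y).adjugate i j := by
    funext y
    rw [Matrix.inv_def, Matrix.smul_apply, Ring.inverse_eq_inv', smul_eq_mul]
  rw [h1]
  refine ((contDiffOn_det hg).inv hdet).mul ?_
  simp only [Matrix.adjugate_fin_three]
  fin_cases i <;> fin_cases j <;>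
  first
  | exact ((hg _ _).mul (hg _ _)).sub ((hg _ _).mul (hg _ _))
  | exact (((hg _ _).mul (hg _ _)).neg).add ((hg _ _).mul (hg _ _))

theorem contDiffOn_christoffel (hU : IsOpen U) (hg : ∀ i j, ContDiffOn ℝ ∞ (fun y => g y i j) U)
    (hdet : ∀ y ∈ U, (g y).det ≠ 0) (k i j : Fin 3) :
    ContDiffOn ℝ ∞ (christoffel g k i j) U := by
  refine contDiffOn_const.mul (ContDiffOn.sum fun l _ => (contDiffOn_ginv hg hdet _ _).mul ?_)
  exact ((contDiffOn_pd hU (hg _ _) _).add (contDiffOn_pd hU (hg _ _) _)).sub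
    (contDiffOn_pd hU (hg _ _) _)

theorem contDiffOn_cov1 (hU : IsOpen U) (hg : ∀ i j, ContDiffOn ℝ ∞ (fun y => g y i j) U)
    (hdet : ∀ y ∈ U, (g y).det ≠ 0) (hη : ∀ i, ContDiffOn ℝ ∞ (fun y => η y i) U) (k i : Fin 3) :
    ContDiffOn ℝ ∞ (fun y => cov1 g η y k i) U :=
  (contDiffOn_pd hU (hη _) _).sub
    (ContDiffOn.sum fun _ _ => (contDiffOn_christoffel hU hg hdet _ _ _).mul (hη _))

theorem contDiffOn_cov2 (hU : IsOpen U) (hg : ∀ i j, ContDiffOn ℝ ∞ (fun y => g y i j) U)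
    (hdet : ∀ y ∈ U, (g y).det ≠ 0) (hh : ∀ i j, ContDiffOn ℝ ∞ (fun y => h y i j) U)
    (k i j : Fin 3) : ContDiffOn ℝ ∞ (fun y => cov2 g h y k i j) U :=
  (contDiffOn_pd hU (hh _ _) _).sub (ContDiffOn.sum fun _ _ =>
    ((contDiffOn_christoffel hU hg hdet _ _ _).mul (hh _ _)).add
      ((contDiffOn_christoffel hU hg hdet _ _ _).mul (hh _ _)))

end Smoothness

/-! ### Tensor fields given by their components in all charts -/

section TensorFields

variable {M : Type*} [TopologicalSpace M] [ChartedSpace E3 M]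

/-- A smooth function on `M`, given in every smooth chart. -/
structure IsScalar (s : OpenPartialHomeomorph M E3 → E3 → ℝ) : Prop where
  smooth : ∀ φ ∈ IsManifold.maximalAtlas (𝓡 3) ∞ M, ContDiffOn ℝ ∞ (s φ) φ.target
  law : ∀ φ ∈ IsManifold.maximalAtlas (𝓡 3) ∞ M, ∀ ψ ∈ IsManifold.maximalAtlas (𝓡 3) ∞ M,
    ∀ y ∈ overlap φ ψ, s ψ y = s φ (coordChange φ ψ y)

/-- A smooth covector field on `M`, given by its components in every smooth chart. -/
structure IsTensor1 (ξ : OpenPartialHomeomorph M E3 → E3 → Fin 3 → ℝ) : Prop where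
  smooth : ∀ φ ∈ IsManifold.maximalAtlas (𝓡 3) ∞ M, ∀ i,
    ContDiffOn ℝ ∞ (fun y => ξ φ y i) φ.target
  law : ∀ φ ∈ IsManifold.maximalAtlas (𝓡 3) ∞ M, ∀ ψ ∈ IsManifold.maximalAtlas (𝓡 3) ∞ M,
    ∀ y ∈ overlap φ ψ, ∀ v, form1 (ξ ψ y) v = form1 (ξ φ (coordChange φ ψ y)) (jac φ ψ y v)

/-- A smooth 2-tensor field on `M`, given by its components in every smooth chart. -/
structure IsTensor2 (b : OpenPartialHomeomorph M E3 → E3 → Matrix (Fin 3) (Fin 3) ℝ) : Prop where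
  smooth : ∀ φ ∈ IsManifold.maximalAtlas (𝓡 3) ∞ M, ∀ i j,
    ContDiffOn ℝ ∞ (fun y => b φ y i j) φ.target
  law : ∀ φ ∈ IsManifold.maximalAtlas (𝓡 3) ∞ M, ∀ ψ ∈ IsManifold.maximalAtlas (𝓡 3) ∞ M,
    ∀ y ∈ overlap φ ψ, ∀ v w,
      form2 (b ψ y) v w = form2 (b φ (coordChange φ ψ y)) (jac φ ψ y v) (jac φ ψ y w)

/-- A smooth 3-tensor field on `M`, given by its components in every smooth chart. -/
structure IsTensor3 (D : OpenPartialHomeomorph M E3 → E3 → Fin 3 → Fin 3 → Fin 3 → ℝ) :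
    Prop where
  smooth : ∀ φ ∈ IsManifold.maximalAtlas (𝓡 3) ∞ M, ∀ k i j,
    ContDiffOn ℝ ∞ (fun y => D φ y k i j) φ.target
  law : ∀ φ ∈ IsManifold.maximalAtlas (𝓡 3) ∞ M, ∀ ψ ∈ IsManifold.maximalAtlas (𝓡 3) ∞ M,
    ∀ y ∈ overlap φ ψ, ∀ u v w, form3 (D ψ y) u v w =
      form3 (D φ (coordChange φ ψ y)) (jac φ ψ y u) (jac φ ψ y v) (jac φ ψ y w)

/-- A Riemannian metric on `M`, given by its components in every smooth chart. -/
structure IsMetric (g : OpenPartialHomeomorph M E3 → E3 → Matrix (Fin 3) (Fin 3) ℝ) : Prop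
    extends IsTensor2 g where
  symm : ∀ φ y i j, g φ y i j = g φ y j i
  pos : ∀ φ ∈ IsManifold.maximalAtlas (𝓡 3) ∞ M, ∀ y ∈ φ.target, (g φ y).PosDef

variable {g b : OpenPartialHomeomorph M E3 → E3 → Matrix (Fin 3) (Fin 3) ℝ}
  {ξ : OpenPartialHomeomorph M E3 → E3 → Fin 3 → ℝ}
  {D : OpenPartialHomeomorph M E3 → E3 → Fin 3 → Fin 3 → Fin 3 → ℝ}
  {φ ψ : OpenPartialHomeomorph M E3} {y : E3}

theorem IsMetric.det_pos (hg : IsMetric g) (hφ : φ ∈ IsManifold.maximalAtlas (𝓡 3) ∞ M)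
    (hy : y ∈ φ.target) : 0 < (g φ y).det := (hg.pos φ hφ y hy).det_pos

theorem IsMetric.det_ne_zero (hg : IsMetric g) (hφ : φ ∈ IsManifold.maximalAtlas (𝓡 3) ∞ M)
    (hy : y ∈ φ.target) : (g φ y).det ≠ 0 := (hg.det_pos hφ hy).ne'

theorem IsTensor2.pullsBack (hb : IsTensor2 b) (hφ : φ ∈ IsManifold.maximalAtlas (𝓡 3) ∞ M)
    (hψ : ψ ∈ IsManifold.maximalAtlas (𝓡 3) ∞ M) (hy : y ∈ overlap φ ψ) :
    PullsBack2 (coordChange φ ψ) (b φ) (b ψ) y := by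
  filter_upwards [(isOpen_overlap φ ψ).mem_nhds hy] with z hz v w using hb.law φ hφ ψ hψ z hz v w

theorem IsTensor1.pullsBack (hξ : IsTensor1 ξ) (hφ : φ ∈ IsManifold.maximalAtlas (𝓡 3) ∞ M)
    (hψ : ψ ∈ IsManifold.maximalAtlas (𝓡 3) ∞ M) (hy : y ∈ overlap φ ψ) :
    PullsBack1 (coordChange φ ψ) (ξ φ) (ξ ψ) y := by
  filter_upwards [(isOpen_overlap φ ψ).mem_nhds hy] with z hz v using hξ.law φ hφ ψ hψ z hz v

theorem IsTensor1.differentiableAt (hξ : IsTensor1 ξ)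
    (hφ : φ ∈ IsManifold.maximalAtlas (𝓡 3) ∞ M) (hy : y ∈ φ.target) (i : Fin 3) :
    DifferentiableAt ℝ (fun z => ξ φ z i) y :=
  ((hξ.smooth φ hφ i).contDiffAt (φ.open_target.mem_nhds hy)).differentiableAt (by simp)

theorem IsTensor2.differentiableAt (hb : IsTensor2 b)
    (hφ : φ ∈ IsManifold.maximalAtlas (𝓡 3) ∞ M) (hy : y ∈ φ.target) (i j : Fin 3) :
    DifferentiableAt ℝ (fun z => b φ z i j) y :=
  ((hb.smooth φ hφ i j).contDiffAt (φ.open_target.mem_nhds hy)).differentiableAt (by simp)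

theorem IsMetric.isIsometryAt (hg : IsMetric g) (hφ : φ ∈ IsManifold.maximalAtlas (𝓡 3) ∞ M)
    (hψ : ψ ∈ IsManifold.maximalAtlas (𝓡 3) ∞ M) (hy : y ∈ overlap φ ψ) :
    IsIsometryAt (coordChange φ ψ) (g φ) (g ψ) y where
  contDiffAt := contDiffAt_coordChange hφ hψ hy
  surjective := jac_surjective hφ hψ hy
  pullsBack := hg.pullsBack hφ hψ hy
  diff := hg.differentiableAt hφ (coordChange_mem_overlap hy).1
  diff' := hg.differentiableAt hψ hy.1
  symm := hg.symm φ
  symm' := hg.symm ψ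
  det := hg.det_ne_zero hφ (coordChange_mem_overlap hy).1
  det' := hg.det_ne_zero hψ hy.1

/-- The covariant derivative of a covector field is a 2-tensor field. -/
theorem IsTensor1.cov (hξ : IsTensor1 ξ) (hg : IsMetric g) :
    IsTensor2 (fun φ => cov1 (g φ) (ξ φ)) where
  smooth φ hφ := contDiffOn_cov1 φ.open_target (hg.smooth φ hφ)
    (fun _ hy => hg.det_ne_zero hφ hy) (hξ.smooth φ hφ)
  law _ hφ _ hψ _ hy := (hg.isIsometryAt hφ hψ hy).form2_cov1 (hξ.pullsBack hφ hψ hy)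
    (hξ.differentiableAt hφ (coordChange_mem_overlap hy).1) (hξ.differentiableAt hψ hy.1)

/-- The covariant derivative of a 2-tensor field is a 3-tensor field. -/
theorem IsTensor2.cov (hb : IsTensor2 b) (hg : IsMetric g) :
    IsTensor3 (fun φ => cov2 (g φ) (b φ)) where
  smooth φ hφ := contDiffOn_cov2 φ.open_target (hg.smooth φ hφ)
    (fun _ hy => hg.det_ne_zero hφ hy) (hb.smooth φ hφ)
  law _ hφ _ hψ _ hy := (hg.isIsometryAt hφ hψ hy).form3_cov2 (hb.pullsBack hφ hψ hy)
    (hb.differentiableAt hφ (coordChange_mem_overlap hy).1) (hb.differentiableAt hψ hy.1)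

/-! ### Contractions -/

theorem form1_eq_of_linear {B : E3 → ℝ} (hadd : ∀ v v', B (v + v') = B v + B v')
    (hsmul : ∀ (c : ℝ) v, B (c • v) = c * B v) (v : E3) :
    form1 (fun k => B (stdVec k)) v = B v := by
  conv_rhs => rw [← sum_smul_stdVec v]
  simp only [form1, Fin.sum_univ_three, hadd, hsmul]
  ring

theorem isBilin_form2 (a : Matrix (Fin 3) (Fin 3) ℝ) : IsBilin (form2 a) :=
  ⟨form2_add_left a, form2_smul_left a, form2_add_right a, form2_smul_right a⟩

/-- The trace of a bilinear form, `g^{ij} b_{ij}`. -/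
def trace2 (a b : Matrix (Fin 3) (Fin 3) ℝ) : ℝ := contr a (form2 b)

/-- The covector `g^{ij} D_{kij}`. -/
def traceLast (a : Matrix (Fin 3) (Fin 3) ℝ) (D : Fin 3 → Fin 3 → Fin 3 → ℝ) (k : Fin 3) : ℝ :=
  contr a (fun p q => form3 D (stdVec k) p q)

/-- The covector `g^{ij} D_{jki}`. -/
def traceFirst (a : Matrix (Fin 3) (Fin 3) ℝ) (D : Fin 3 → Fin 3 → Fin 3 → ℝ) (k : Fin 3) : ℝ :=
  contr a (fun p q => form3 D q (stdVec k) p)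

/-- The covector `b_k{}^i ξ_i`. -/
def contrRight (a b : Matrix (Fin 3) (Fin 3) ℝ) (ξ : Fin 3 → ℝ) (k : Fin 3) : ℝ :=
  contr a (fun p q => form2 b (stdVec k) p * form1 ξ q)

/-- The covector `ξ^i b_{ik}`. -/
def contrLeft (a b : Matrix (Fin 3) (Fin 3) ℝ) (ξ : Fin 3 → ℝ) (k : Fin 3) : ℝ :=
  contr a (fun p q => form2 b p (stdVec k) * form1 ξ q)

/-- The covector `b^{ij} D_{kij}`. -/
def contrLast (a b : Matrix (Fin 3) (Fin 3) ℝ) (D : Fin 3 → Fin 3 → Fin 3 → ℝ) (k : Fin 3) : ℝ :=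
  contr a (fun p q => contr a (fun r s => form2 b p r * form3 D (stdVec k) q s))

/-- The covector `b^{ij} D_{ijk}`. -/
def contrFirst (a b : Matrix (Fin 3) (Fin 3) ℝ) (D : Fin 3 → Fin 3 → Fin 3 → ℝ) (k : Fin 3) : ℝ :=
  contr a (fun p q => contr a (fun r s => form2 b p r * form3 D q s (stdVec k)))

theorem contr_add (a : Matrix (Fin 3) (Fin 3) ℝ) (B B' : E3 → E3 → ℝ) :
    contr a (fun p q => B p q + B' p q) = contr a B + contr a B' := by
  simp only [contr, mul_add, Finset.sum_add_distrib]

theorem contr_const_mul (a : Matrix (Fin 3) (Fin 3) ℝ) (c : ℝ) (B : E3 → E3 → ℝ) :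
    contr a (fun p q => c * B p q) = c * contr a B := by
  simp only [contr, Finset.mul_sum]
  exact Finset.sum_congr rfl fun i _ => Finset.sum_congr rfl fun j _ => by ring

theorem IsMetric.contr_comp (hg : IsMetric g) (hφ : φ ∈ IsManifold.maximalAtlas (𝓡 3) ∞ M)
    (hψ : ψ ∈ IsManifold.maximalAtlas (𝓡 3) ∞ M) (hy : y ∈ overlap φ ψ) {B : E3 → E3 → ℝ}
    (hB : IsBilin B) :
    contr (g ψ y) (fun v w => B (jac φ ψ y v) (jac φ ψ y w)) = contr (g φ (coordChange φ ψ y)) B :=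
  _root_.contr_comp (hg.det_ne_zero hψ hy.1) (hg.law φ hφ ψ hψ y hy) hB

theorem contDiffOn_contr {U : Set E3} {a : E3 → Matrix (Fin 3) (Fin 3) ℝ}
    (ha : ∀ i j, ContDiffOn ℝ ∞ (fun y => a y i j) U) (hdet : ∀ y ∈ U, (a y).det ≠ 0)
    {B : E3 → E3 → E3 → ℝ}
    (hB : ∀ i j, ContDiffOn ℝ ∞ (fun y => B y (stdVec i) (stdVec j)) U) :
    ContDiffOn ℝ ∞ (fun y => contr (a y) (B y)) U :=
  ContDiffOn.sum fun _ _ => ContDiffOn.sum fun _ _ => (contDiffOn_ginv ha hdet _ _).mul (hB _ _)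

theorem IsTensor2.trace2 (hb : IsTensor2 b) (hg : IsMetric g) :
    IsScalar (fun φ y => trace2 (g φ y) (b φ y)) where
  smooth φ hφ := by
    refine contDiffOn_contr (hg.smooth φ hφ) (fun y hy => hg.det_ne_zero hφ hy) fun i j => ?_
    simpa only [form2_stdVec] using hb.smooth φ hφ i j
  law φ hφ ψ hψ y hy := by
    unfold _root_.trace2
    rw [← hg.contr_comp hφ hψ hy (isBilin_form2 _)]
    congr 1
    funext v w
    exact hb.law φ hφ ψ hψ y hy v w

theorem IsTensor3.traceLast (hD : IsTensor3 D) (hg : IsMetric g) :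
    IsTensor1 (fun φ y => traceLast (g φ y) (D φ y)) where
  smooth φ hφ k := by
    refine contDiffOn_contr (hg.smooth φ hφ) (fun y hy => hg.det_ne_zero hφ hy) fun i j => ?_
    simpa only [form3_stdVec] using hD.smooth φ hφ k i j
  law φ hφ ψ hψ y hy v := by
    have e : ∀ (a : Matrix (Fin 3) (Fin 3) ℝ) D v, form1 (_root_.traceLast a D) v =
        contr a (fun p q => form3 D v p q) := fun a D v =>
      form1_eq_of_linear (B := fun v => contr a (fun p q => form3 D v p q))
        (fun _ _ => by simp only [form3_add_left, contr_add])
        (fun _ _ => by simp only [form3_smul_left, contr_const_mul]) v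
    rw [e, e, ← hg.contr_comp hφ hψ hy ⟨form3_add_mid _ _, fun _ _ _ => form3_smul_mid _ _ _ _ _,
      form3_add_right _ _, fun _ _ _ => form3_smul_right _ _ _ _ _⟩]
    simp only [hD.law φ hφ ψ hψ y hy]

theorem IsTensor3.traceFirst (hD : IsTensor3 D) (hg : IsMetric g) :
    IsTensor1 (fun φ y => traceFirst (g φ y) (D φ y)) where
  smooth φ hφ k := by
    refine contDiffOn_contr (hg.smooth φ hφ) (fun y hy => hg.det_ne_zero hφ hy) fun i j => ?_
    simpa only [form3_stdVec] using hD.smooth φ hφ j k i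
  law φ hφ ψ hψ y hy v := by
    have e : ∀ (a : Matrix (Fin 3) (Fin 3) ℝ) D v, form1 (_root_.traceFirst a D) v =
        contr a (fun p q => form3 D q v p) := fun a D v =>
      form1_eq_of_linear (B := fun v => contr a (fun p q => form3 D q v p))
        (fun _ _ => by simp only [form3_add_mid, contr_add])
        (fun _ _ => by simp only [form3_smul_mid, contr_const_mul]) v
    rw [e, e, ← hg.contr_comp hφ hψ hy (B := fun p q => form3 _ q _ p)
      ⟨fun _ _ _ => form3_add_right _ _ _ _ _, fun _ _ _ => form3_smul_right _ _ _ _ _,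
      fun _ _ _ => form3_add_left _ _ _ _ _, fun _ _ _ => form3_smul_left _ _ _ _ _⟩]
    simp only [hD.law φ hφ ψ hψ y hy]

theorem IsTensor1.contrRight (hξ : IsTensor1 ξ) (hb : IsTensor2 b) (hg : IsMetric g) :
    IsTensor1 (fun φ y => contrRight (g φ y) (b φ y) (ξ φ y)) where
  smooth φ hφ k := by
    refine contDiffOn_contr (hg.smooth φ hφ) (fun y hy => hg.det_ne_zero hφ hy) fun i j => ?_
    simpa only [form2_stdVec, form1_stdVec] using (hb.smooth φ hφ k i).mul (hξ.smooth φ hφ j)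
  law φ hφ ψ hψ y hy v := by
    have e : ∀ (a b : Matrix (Fin 3) (Fin 3) ℝ) ξ v, form1 (_root_.contrRight a b ξ) v =
        contr a (fun p q => form2 b v p * form1 ξ q) := fun a b ξ v =>
      form1_eq_of_linear (B := fun v => contr a (fun p q => form2 b v p * form1 ξ q))
        (fun _ _ => by simp only [form2_add_left, add_mul, contr_add])
        (fun _ _ => by simp only [form2_smul_left, mul_assoc, contr_const_mul]) v
    rw [e, e, ← hg.contr_comp hφ hψ hy (B := fun p q => form2 _ _ p * form1 _ q)
      ⟨fun _ _ _ => by rw [form2_add_right]; ring, fun _ _ _ => by rw [form2_smul_right]; ring,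
      fun _ _ _ => by rw [form1_add]; ring, fun _ _ _ => by rw [form1_smul]; ring⟩]
    simp only [hb.law φ hφ ψ hψ y hy, hξ.law φ hφ ψ hψ y hy]

theorem IsTensor1.contrLeft (hξ : IsTensor1 ξ) (hb : IsTensor2 b) (hg : IsMetric g) :
    IsTensor1 (fun φ y => contrLeft (g φ y) (b φ y) (ξ φ y)) where
  smooth φ hφ k := by
    refine contDiffOn_contr (hg.smooth φ hφ) (fun y hy => hg.det_ne_zero hφ hy) fun i j => ?_
    simpa only [form2_stdVec, form1_stdVec] using (hb.smooth φ hφ i k).mul (hξ.smooth φ hφ j)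
  law φ hφ ψ hψ y hy v := by
    have e : ∀ (a b : Matrix (Fin 3) (Fin 3) ℝ) ξ v, form1 (_root_.contrLeft a b ξ) v =
        contr a (fun p q => form2 b p v * form1 ξ q) := fun a b ξ v =>
      form1_eq_of_linear (B := fun v => contr a (fun p q => form2 b p v * form1 ξ q))
        (fun _ _ => by simp only [form2_add_right, add_mul, contr_add])
        (fun _ _ => by simp only [form2_smul_right, mul_assoc, contr_const_mul]) v
    rw [e, e, ← hg.contr_comp hφ hψ hy (B := fun p q => form2 _ p _ * form1 _ q)
      ⟨fun _ _ _ => by rw [form2_add_left]; ring, fun _ _ _ => by rw [form2_smul_left]; ring,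
      fun _ _ _ => by rw [form1_add]; ring, fun _ _ _ => by rw [form1_smul]; ring⟩]
    simp only [hb.law φ hφ ψ hψ y hy, hξ.law φ hφ ψ hψ y hy]

theorem IsTensor3.contrLast (hD : IsTensor3 D) (hb : IsTensor2 b) (hg : IsMetric g) :
    IsTensor1 (fun φ y => contrLast (g φ y) (b φ y) (D φ y)) where
  smooth φ hφ k := by
    refine contDiffOn_contr (hg.smooth φ hφ) (fun y hy => hg.det_ne_zero hφ hy) fun i j =>
      contDiffOn_contr (hg.smooth φ hφ) (fun y hy => hg.det_ne_zero hφ hy) fun m n => ?_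
    simpa only [form2_stdVec, form3_stdVec] using (hb.smooth φ hφ i m).mul (hD.smooth φ hφ k j n)
  law φ hφ ψ hψ y hy v := by
    have e : ∀ (a b : Matrix (Fin 3) (Fin 3) ℝ) D v, form1 (_root_.contrLast a b D) v =
        contr a (fun p q => contr a (fun r s => form2 b p r * form3 D v q s)) := fun a b D v =>
      form1_eq_of_linear
        (B := fun v => contr a (fun p q => contr a (fun r s => form2 b p r * form3 D v q s)))
        (fun _ _ => by simp only [form3_add_left, mul_add, contr_add])
        (fun _ _ => by simp only [form3_smul_left, mul_left_comm, contr_const_mul]) v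
    rw [e, e, ← hg.contr_comp hφ hψ hy
      (B := fun p q => contr _ (fun r s => form2 _ p r * form3 _ _ q s))
      ⟨fun _ _ _ => by simp only [form2_add_left, add_mul, contr_add],
      fun _ _ _ => by simp only [form2_smul_left, mul_assoc, contr_const_mul],
      fun _ _ _ => by simp only [form3_add_mid, mul_add, contr_add],
      fun _ _ _ => by simp only [form3_smul_mid, mul_left_comm, contr_const_mul]⟩]
    congr 1
    funext p q
    rw [← hg.contr_comp hφ hψ hy (B := fun r s => form2 _ _ r * form3 _ _ _ s)
      ⟨fun _ _ _ => by rw [form2_add_right]; ring, fun _ _ _ => by rw [form2_smul_right]; ring,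
      fun _ _ _ => by rw [form3_add_right]; ring, fun _ _ _ => by rw [form3_smul_right]; ring⟩]
    simp only [hb.law φ hφ ψ hψ y hy, hD.law φ hφ ψ hψ y hy]

theorem IsTensor3.contrFirst (hD : IsTensor3 D) (hb : IsTensor2 b) (hg : IsMetric g) :
    IsTensor1 (fun φ y => contrFirst (g φ y) (b φ y) (D φ y)) where
  smooth φ hφ k := by
    refine contDiffOn_contr (hg.smooth φ hφ) (fun y hy => hg.det_ne_zero hφ hy) fun i j =>
      contDiffOn_contr (hg.smooth φ hφ) (fun y hy => hg.det_ne_zero hφ hy) fun m n => ?_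
    simpa only [form2_stdVec, form3_stdVec] using (hb.smooth φ hφ i m).mul (hD.smooth φ hφ j n k)
  law φ hφ ψ hψ y hy v := by
    have e : ∀ (a b : Matrix (Fin 3) (Fin 3) ℝ) D v, form1 (_root_.contrFirst a b D) v =
        contr a (fun p q => contr a (fun r s => form2 b p r * form3 D q s v)) := fun a b D v =>
      form1_eq_of_linear
        (B := fun v => contr a (fun p q => contr a (fun r s => form2 b p r * form3 D q s v)))
        (fun _ _ => by simp only [form3_add_right, mul_add, contr_add])
        (fun _ _ => by simp only [form3_smul_right, mul_left_comm, contr_const_mul]) v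
    rw [e, e, ← hg.contr_comp hφ hψ hy
      (B := fun p q => contr _ (fun r s => form2 _ p r * form3 _ q s _))
      ⟨fun _ _ _ => by simp only [form2_add_left, add_mul, contr_add],
      fun _ _ _ => by simp only [form2_smul_left, mul_assoc, contr_const_mul],
      fun _ _ _ => by simp only [form3_add_left, mul_add, contr_add],
      fun _ _ _ => by simp only [form3_smul_left, mul_left_comm, contr_const_mul]⟩]
    congr 1
    funext p q
    rw [← hg.contr_comp hφ hψ hy (B := fun r s => form2 _ _ r * form3 _ _ s _)
      ⟨fun _ _ _ => by rw [form2_add_right]; ring, fun _ _ _ => by rw [form2_smul_right]; ring,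
      fun _ _ _ => by rw [form3_add_mid]; ring, fun _ _ _ => by rw [form3_smul_mid]; ring⟩]
    simp only [hb.law φ hφ ψ hψ y hy, hD.law φ hφ ψ hψ y hy]

theorem IsTensor1.smul {s : OpenPartialHomeomorph M E3 → E3 → ℝ} (hξ : IsTensor1 ξ)
    (hs : IsScalar s) : IsTensor1 (fun φ y k => s φ y * ξ φ y k) where
  smooth φ hφ k := (hs.smooth φ hφ).mul (hξ.smooth φ hφ k)
  law φ hφ ψ hψ y hy v := by
    have e : ∀ (c : ℝ) (a : Fin 3 → ℝ) v, form1 (fun k => c * a k) v = c * form1 a v := by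
      intro c a v
      simp only [form1, Finset.mul_sum, mul_assoc]
    rw [e, e, hs.law φ hφ ψ hψ y hy, hξ.law φ hφ ψ hψ y hy]

theorem IsTensor1.add {ζ : OpenPartialHomeomorph M E3 → E3 → Fin 3 → ℝ} (hξ : IsTensor1 ξ)
    (hζ : IsTensor1 ζ) : IsTensor1 (fun φ y k => ξ φ y k + ζ φ y k) where
  smooth φ hφ k := (hξ.smooth φ hφ k).add (hζ.smooth φ hφ k)
  law φ hφ ψ hψ y hy v := by
    have e : ∀ (a b : Fin 3 → ℝ) v, form1 (fun k => a k + b k) v = form1 a v + form1 b v := by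
      intro a b v
      simp only [form1, add_mul, Finset.sum_add_distrib]
    rw [e, e, hζ.law φ hφ ψ hψ y hy, hξ.law φ hφ ψ hψ y hy]

theorem IsTensor1.const_mul (hξ : IsTensor1 ξ) (c : ℝ) :
    IsTensor1 (fun φ y k => c * ξ φ y k) :=
  hξ.smul (s := fun _ _ => c) ⟨fun _ _ => contDiffOn_const, fun _ _ _ _ _ _ => rfl⟩

/-- The divergence of a covector field is a smooth function. -/
theorem IsTensor1.div (hξ : IsTensor1 ξ) (hg : IsMetric g) :
    IsScalar (fun φ y => _root_.trace2 (g φ y) (cov1 (g φ) (ξ φ) y)) :=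
  (hξ.cov hg).trace2 hg

end TensorFields

/-! ### Normal charts -/

section NormalChart

open Coord

open scoped MatrixOrder Matrix.Norms.L2Operator in
/-- Every inner product has an orthonormal basis, the columns of `A`. -/
theorem exists_transpose_mul_mul_eq_one {a : Matrix (Fin 3) (Fin 3) ℝ} (ha : a.PosDef) :
    ∃ A : Matrix (Fin 3) (Fin 3) ℝ, A.transpose * a * A = 1 ∧ IsUnit A := by
  obtain ⟨B, hB⟩ := CStarAlgebra.nonneg_iff_eq_star_mul_self.mp ha.posSemidef.nonneg
  have hB' : a = B.transpose * B := by
    rw [hB, Matrix.star_eq_conjTranspose, Matrix.conjTranspose_eq_transpose_of_trivial]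
  have hdet : IsUnit B.det := by
    rw [isUnit_iff_ne_zero]
    intro h0
    have := ha.det_pos
    rw [hB', Matrix.det_mul, h0, mul_zero] at this
    exact lt_irrefl _ this
  have hdet' : IsUnit B.transpose.det := by rwa [Matrix.det_transpose]
  refine ⟨B⁻¹, ?_, (Matrix.isUnit_nonsing_inv_iff).2 ((Matrix.isUnit_iff_isUnit_det B).2 hdet)⟩
  rw [hB', Matrix.transpose_nonsing_inv, ← Matrix.mul_assoc, Matrix.nonsing_inv_mul _ hdet',
    Matrix.one_mul, Matrix.mul_nonsing_inv _ hdet]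

/-- The inverse function theorem: a smooth map with invertible differential at a point restricts
to a diffeomorphism between open sets, as an element of the groupoid of smooth maps. -/
theorem exists_mem_contDiffGroupoid {F : E3 → E3} (hF : ContDiff ℝ ∞ F) {z : E3}
    {L : E3 ≃L[ℝ] E3}
    (hL : HasFDerivAt F (L : E3 →L[ℝ] E3) z) :
    ∃ e ∈ contDiffGroupoid ∞ (𝓡 3), z ∈ e.source ∧ (e : E3 → E3) = F := by
  set e₀ := hF.contDiffAt.toOpenPartialHomeomorph F hL (by simp) with he₀
  -- On the open set where the differential is invertible, the inverse is smooth as well.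
  set s : Set E3 := fderiv ℝ F ⁻¹' range ((↑) : (E3 ≃L[ℝ] E3) → E3 →L[ℝ] E3) with hs
  have hso : IsOpen s := ContinuousLinearEquiv.isOpen.preimage (hF.continuous_fderiv (by simp))
  have hcoe : (e₀ : E3 → E3) = F :=
    ContDiffAt.toOpenPartialHomeomorph_coe hF.contDiffAt hL (by simp)
  refine ⟨e₀.restrOpen s hso, ?_, ⟨?_, ?_⟩, hcoe⟩
  · rw [contDiffGroupoid, mem_groupoid_of_pregroupoid]
    constructor
    · change ContDiffOn ℝ ∞ e₀ _
      rw [hcoe]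
      exact hF.contDiffOn
    · change ContDiffOn ℝ ∞ e₀.symm _
      intro y hy
      have hy1 : y ∈ (e₀.restrOpen s hso).target := hy.1
      have hmem := (e₀.restrOpen s hso).map_target hy1
      have hy2 : y ∈ e₀.target := by
        have := e₀.map_source hmem.1
        have h3 := (e₀.restrOpen s hso).right_inv hy1
        change e₀ ((e₀.restrOpen s hso).symm y) = y at h3
        rwa [h3] at this
      obtain ⟨L', hL'⟩ := hmem.2
      refine (e₀.contDiffAt_symm hy2 (f₀' := L') ?_ ?_).contDiffWithinAt
      · rw [hcoe, hL']
        exact (hF.differentiable (by simp) _).hasFDerivAt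
      · rw [hcoe]
        exact hF.contDiffAt
  · exact ContDiffAt.mem_toOpenPartialHomeomorph_source hF.contDiffAt hL (by simp)
  · exact ⟨L, hL.fderiv.symm⟩

/-- The bilinear map `Γ` at a point, with components `c^k_{ij}`. -/
def bilinMap (c : Fin 3 → Fin 3 → Fin 3 → ℝ) : E3 →L[ℝ] E3 →L[ℝ] E3 :=
  ∑ k, ∑ i, ∑ j, c k i j • (PiLp.proj 2 (fun _ : Fin 3 => ℝ) i : E3 →L[ℝ] ℝ).smulRight
    ((PiLp.proj 2 (fun _ : Fin 3 => ℝ) j : E3 →L[ℝ] ℝ).smulRight (stdVec k))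

theorem bilinMap_apply (c : Fin 3 → Fin 3 → Fin 3 → ℝ) (u v : E3) :
    bilinMap c u v = WithLp.toLp 2 fun k => ∑ i, ∑ j, c k i j * (u i * v j) := by
  ext l
  simp only [bilinMap, _root_.sum_apply, _root_.smul_apply, ContinuousLinearMap.smulRight_apply,
    PiLp.proj_apply, WithLp.ofLp_sum, Finset.sum_apply, WithLp.ofLp_smul, Pi.smul_apply,
    smul_eq_mul]
  rw [Finset.sum_eq_single l]
  · simp
  · intro k _ hk
    simp [hk.symm]
  · simp

variable {M : Type*} [TopologicalSpace M] [ChartedSpace E3 M]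
  {g : OpenPartialHomeomorph M E3 → E3 → Matrix (Fin 3) (Fin 3) ℝ}

/-- Composing a chart with a diffeomorphism of open subsets of `ℝ³` gives a chart. -/
theorem trans_symm_mem_maximalAtlas {φ : OpenPartialHomeomorph M E3}
    (hφ : φ ∈ IsManifold.maximalAtlas (𝓡 3) ∞ M) {e : OpenPartialHomeomorph E3 E3}
    (he : e ∈ contDiffGroupoid ∞ (𝓡 3)) :
    φ.trans e.symm ∈ IsManifold.maximalAtlas (𝓡 3) ∞ M := by
  intro e' he'
  obtain ⟨h1, h2⟩ := hφ e' he'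
  constructor
  · rw [OpenPartialHomeomorph.trans_symm_eq_symm_trans_symm, OpenPartialHomeomorph.symm_symm,
      OpenPartialHomeomorph.trans_assoc]
    exact (contDiffGroupoid ∞ (𝓡 3)).trans he h1
  · rw [← OpenPartialHomeomorph.trans_assoc]
    exact (contDiffGroupoid ∞ (𝓡 3)).trans h2 ((contDiffGroupoid ∞ (𝓡 3)).symm he)

/-- `φ` is a normal chart at the point with coordinates `y`: there `g_{ij} = δ_{ij}` and
`∂_k g_{ij} = 0`. -/
structure IsNormalAt (g : E3 → Matrix (Fin 3) (Fin 3) ℝ) (y : E3) : Prop where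
  eq_one : g y = 1
  pd_eq_zero : ∀ k i j, pd k (fun z => g z i j) y = 0

variable [IsManifold (𝓡 3) ∞ M]

/-- Every point has a chart that is normal there, obtained from any chart by the substitution
`z ↦ y + A z - ½ Γ(A z, A z)`. -/
theorem IsMetric.exists_isNormalAt (hg : IsMetric g) (p : M) :
    ∃ ψ ∈ IsManifold.maximalAtlas (𝓡 3) ∞ M, p ∈ ψ.source ∧ IsNormalAt (g ψ) (ψ p) := by
  set φ := chartAt E3 p with hφdef
  have hφ : φ ∈ IsManifold.maximalAtlas (𝓡 3) ∞ M := IsManifold.chart_mem_maximalAtlas p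
  have hp : p ∈ φ.source := mem_chart_source E3 p
  set y := φ p with hy
  have hyt : y ∈ φ.target := φ.map_source hp
  obtain ⟨A, hA, hAu⟩ := exists_transpose_mul_mul_eq_one (hg.pos φ hφ y hyt)
  set L : E3 →L[ℝ] E3 := Matrix.toEuclideanCLM (𝕜 := ℝ) A with hLdef
  have hLapp : ∀ i k, L (stdVec i) k = A k i := by
    intro i k
    simp [hLdef]
  have hLinj : Function.Injective L := by
    intro v w hvw
    have h1 : A.mulVec v.ofLp = A.mulVec w.ofLp := congrArg WithLp.ofLp hvw
    exact WithLp.ofLp_injective 2 (Matrix.mulVec_injective_of_isUnit hAu h1)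
  have hLsurj : Function.Surjective L :=
    LinearMap.surjective_of_injective (f := L.toLinearMap) hLinj
  set Le : E3 ≃L[ℝ] E3 := ContinuousLinearEquiv.ofBijective L
    (LinearMap.ker_eq_bot.2 hLinj) (LinearMap.range_eq_top.2 hLsurj) with hLe
  set B := bilinMap fun k i j => christoffel (g φ) k i j y with hB
  have hBchr : ∀ u v, B u v = chr (g φ) y u v := fun u v => bilinMap_apply _ u v
  have hBsymm : ∀ u v, B u v = B v u := by
    intro u v
    rw [hB, bilinMap_apply, bilinMap_apply]
    congr 1
    funext k
    rw [Finset.sum_comm]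
    exact Finset.sum_congr rfl fun i _ => Finset.sum_congr rfl fun j _ => by
      rw [chr_symm (hg.symm φ), mul_comm (u _)]
  set F : E3 → E3 := fun z => y + L z - (1 / 2 : ℝ) • B (L z) (L z) with hF
  have hF0 : F 0 = y := by simp [hF]
  have hFderiv : ∀ z, HasFDerivAt F (L - (B (L z)).comp L) z := by
    intro z
    have h1 := (B.hasFDerivAt_of_bilinear (L.hasFDerivAt (x := z)) (L.hasFDerivAt (x := z)))
    have h2 := ((L.hasFDerivAt (x := z)).const_add y).sub (h1.const_smul (1 / 2 : ℝ))
    refine h2.congr_fderiv ?_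
    ext1 v
    simp only [_root_.sub_apply, _root_.smul_apply, _root_.add_apply,
      ContinuousLinearMap.precompR_apply, ContinuousLinearMap.precompL_apply,
      ContinuousLinearMap.comp_apply, hBsymm (L v) (L z)]
    change L v - (1 / 2 : ℝ) • (B (L z) (L v) + B (L z) (L v)) = _
    rw [← two_smul ℝ, smul_smul]
    norm_num
  have hFsmooth : ContDiff ℝ ∞ F := by
    have h1 : ContDiff ℝ ∞ fun z => B (L z) (L z) :=
      (B.contDiff.comp L.contDiff).clm_apply L.contDiff
    exact (contDiff_const.add L.contDiff).sub (h1.const_smul (1 / 2 : ℝ))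
  have hFd0 : HasFDerivAt F (Le : E3 →L[ℝ] E3) 0 := by
    refine (hFderiv 0).congr_fderiv ?_
    ext1 v
    simp [hLe]
  have hFdd : ∀ u v, fderiv ℝ (fderiv ℝ F) 0 u v = - B (L u) (L v) := by
    intro u v
    have h1 := (hasFDerivAt_fderiv_apply (hFsmooth.contDiffAt (x := 0)) v)
    have h2 : (fun z => fderiv ℝ F z v) = fun z => L v - (B.flip (L v)) (L z) := by
      funext z
      rw [(hFderiv z).fderiv]
      simp
    rw [h2] at h1
    have h3 : HasFDerivAt (fun z => L v - (B.flip (L v)) (L z)) (-((B.flip (L v)).comp L)) 0 :=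
      ((((B.flip (L v)).comp L).hasFDerivAt (x := 0)).const_sub (L v))
    have h4 := congrArg (fun T : E3 →L[ℝ] E3 => T u) (h1.unique h3)
    simpa using h4
  obtain ⟨e, he, he0, heF⟩ := exists_mem_contDiffGroupoid hFsmooth hFd0
  have hey : e 0 = y := by rw [heF, hF0]
  have hesymm : e.symm y = 0 := by rw [← hey, e.left_inv he0]
  have hyet : y ∈ e.target := hey ▸ e.map_source he0
  set ψ := φ.trans e.symm with hψdef
  have hψ : ψ ∈ IsManifold.maximalAtlas (𝓡 3) ∞ M := trans_symm_mem_maximalAtlas hφ he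
  have hpψ : p ∈ ψ.source := by
    rw [hψdef, OpenPartialHomeomorph.trans_source]
    exact ⟨hp, hyet⟩
  have hψp : ψ p = 0 := hesymm
  have h0 : (0 : E3) ∈ overlap φ ψ := by
    rw [← hψp]
    refine ⟨ψ.map_source hpψ, ?_⟩
    rw [mem_preimage, ψ.left_inv hpψ]
    exact hp
  have hcc : coordChange φ ψ =ᶠ[𝓝 0] F := by
    filter_upwards [(isOpen_overlap φ ψ).mem_nhds h0] with z hz
    have hz1 := hz.1
    rw [hψdef, OpenPartialHomeomorph.trans_target] at hz1
    have h5 : e z ∈ φ.target := hz1.2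
    change φ (φ.symm (e z)) = F z
    rw [φ.right_inv h5, heF]
  have hcc0 : coordChange φ ψ 0 = y := by rw [hcc.self_of_nhds, hF0]
  have hjac : ∀ v, jac φ ψ 0 v = L v := by
    intro v
    rw [jac, hcc.fderiv_eq, (hFderiv 0).fderiv]
    simp
  have hiso := hg.isIsometryAt hφ hψ h0
  -- The second derivative `-Γ(L u, L v)` of the substitution cancels the Christoffel symbols of `φ`
  -- in the transformation law.
  have hchr : ∀ u v, chr (g ψ) 0 u v = 0 := by
    intro u v
    have h6 := hiso.fderiv_chr u v
    rw [hcc.fderiv.fderiv_eq, hFdd, hBchr, hcc0] at h6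
    have h7 := hjac
    unfold jac at h7
    rw [h7, h7, h7, add_neg_cancel] at h6
    exact hLinj (by rw [h6, map_zero])
  refine ⟨ψ, hψ, hpψ, ?_, ?_⟩
  · rw [hψp]
    have h8 := eq_transpose_mul_mul (hg.law φ hφ ψ hψ 0 h0)
    have h9 : toMat (jac φ ψ 0) = A := by
      ext k i
      simp only [toMat, Matrix.of_apply, hjac, hLapp]
    rw [h8, h9, hcc0, hA]
  · intro k i j
    rw [hψp]
    -- As the connection is metric, vanishing Christoffel symbols give `∂g = 0`.
    have h8 := form3_pd2_metric (hg.symm ψ) hiso.det' (stdVec k) (stdVec i) (stdVec j)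
    rw [hchr, hchr, form3_stdVec] at h8
    have z1 : ∀ a : Matrix (Fin 3) (Fin 3) ℝ, ∀ w, form2 a 0 w = 0 := fun a w => by simp [form2]
    have z2 : ∀ a : Matrix (Fin 3) (Fin 3) ℝ, ∀ w, form2 a w 0 = 0 := fun a w => by simp [form2]
    rwa [z1, z2, add_zero] at h8

end NormalChart

/-! ### The divergence in coordinates -/

section LocalDivergence

open Coord

variable {U : Set E3} {g : E3 → Matrix (Fin 3) (Fin 3) ℝ} {ξ : E3 → Fin 3 → ℝ} {y : E3}

theorem pd_mul {f f' : E3 → ℝ} (hf : DifferentiableAt ℝ f y) (hf' : DifferentiableAt ℝ f' y)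
    (k : Fin 3) : pd k (fun z => f z * f' z) y = pd k f y * f' y + f y * pd k f' y := by
  simp only [pd]
  rw [fderiv_fun_mul hf hf']
  simp only [_root_.add_apply, _root_.smul_apply, smul_eq_mul]
  ring

theorem pd_sum {ι : Type*} {s : Finset ι} {f : ι → E3 → ℝ}
    (hf : ∀ i ∈ s, DifferentiableAt ℝ (f i) y) (k : Fin 3) :
    pd k (fun z => ∑ i ∈ s, f i z) y = ∑ i ∈ s, pd k (f i) y := by
  simp only [pd]
  rw [fderiv_fun_sum hf, _root_.sum_apply]

theorem pd_congr {f f' : E3 → ℝ} (h : f =ᶠ[𝓝 y] f') (k : Fin 3) : pd k f y = pd k f' y := by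
  simp only [pd, h.fderiv_eq]

theorem pd_const (c : ℝ) (k : Fin 3) : pd k (fun _ => c) y = 0 := by
  simp [pd]

/-- The derivative of the inverse metric. -/
theorem pd_inv (hg : ∀ i j, DifferentiableAt ℝ (fun z => g z i j) y)
    (hi : ∀ i j, DifferentiableAt ℝ (fun z => (g z)⁻¹ i j) y)
    (hdet : ∀ᶠ z in 𝓝 y, (g z).det ≠ 0) (k i j : Fin 3) :
    pd k (fun z => (g z)⁻¹ i j) y =
      - ∑ a, ∑ b, (g y)⁻¹ i a * pd k (fun z => g z a b) y * (g y)⁻¹ b j := by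
  have h1 : ∀ a, ∑ b, (pd k (fun z => g z a b) y * (g y)⁻¹ b j +
      g y a b * pd k (fun z => (g z)⁻¹ b j) y) = 0 := by
    intro a
    have h2 : (fun z => ∑ b, g z a b * (g z)⁻¹ b j) =ᶠ[𝓝 y]
        fun _ => (1 : Matrix (Fin 3) (Fin 3) ℝ) a j := by
      filter_upwards [hdet] with z hz
      rw [← Matrix.mul_nonsing_inv (g z) (isUnit_iff_ne_zero.2 hz), Matrix.mul_apply]
    have h3 := pd_congr h2 k
    rw [pd_const, pd_sum fun b _ => (hg a b).fun_mul (hi b j)] at h3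
    rw [← h3]
    exact Finset.sum_congr rfl fun b _ => (pd_mul (hg a b) (hi b j) k).symm
  have h4 : (g y)⁻¹ * g y = 1 :=
    Matrix.nonsing_inv_mul (g y) (isUnit_iff_ne_zero.2 hdet.self_of_nhds)
  have h5 : ∀ b, ∑ a, (g y)⁻¹ i a * g y a b = if i = b then 1 else 0 := by
    intro b
    rw [← Matrix.one_apply, ← h4, Matrix.mul_apply]
  have h6 : ∑ a, (g y)⁻¹ i a * ∑ b, (pd k (fun z => g z a b) y * (g y)⁻¹ b j +
      g y a b * pd k (fun z => (g z)⁻¹ b j) y) = 0 := by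
    simp only [h1, mul_zero, Finset.sum_const_zero]
  have h7 : ∑ a, (g y)⁻¹ i a * ∑ b, (pd k (fun z => g z a b) y * (g y)⁻¹ b j +
      g y a b * pd k (fun z => (g z)⁻¹ b j) y) =
      (∑ a, ∑ b, (g y)⁻¹ i a * pd k (fun z => g z a b) y * (g y)⁻¹ b j) +
      ∑ b, (∑ a, (g y)⁻¹ i a * g y a b) * pd k (fun z => (g z)⁻¹ b j) y := by
    simp only [Fin.sum_univ_three]
    ring
  rw [h7] at h6
  simp only [h5, ite_mul, one_mul, zero_mul, Finset.sum_ite_eq, Finset.mem_univ, if_true] at h6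
  linarith

/-- Jacobi's formula for the derivative of the determinant. -/
theorem pd_det (hg : ∀ i j, DifferentiableAt ℝ (fun z => g z i j) y) (hdet : (g y).det ≠ 0)
    (k : Fin 3) : pd k (fun z => (g z).det) y =
      (g y).det * ∑ a, ∑ b, (g y)⁻¹ b a * pd k (fun z => g z a b) y := by
  have h1 : ∀ i j, (g y).det * (g y)⁻¹ i j = (g y).adjugate i j := by
    intro i j
    rw [Matrix.inv_def, Matrix.smul_apply, Ring.inverse_eq_inv', smul_eq_mul, ← mul_assoc,
      mul_inv_cancel₀ hdet, one_mul]
  have h2 : (g y).det * ∑ a, ∑ b, (g y)⁻¹ b a * pd k (fun z => g z a b) y =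
      ∑ a, ∑ b, (g y).adjugate b a * pd k (fun z => g z a b) y := by
    simp only [← h1, Finset.mul_sum, mul_assoc]
  rw [h2]
  have hd : ∀ i j, HasFDerivAt (fun z => g z i j) (fderiv ℝ (fun z => g z i j) y) y :=
    fun i j => (hg i j).hasFDerivAt
  have h3 := ((((((((hd 0 0).mul (hd 1 1)).mul (hd 2 2)).sub (((hd 0 0).mul (hd 1 2)).mul
    (hd 2 1))).sub (((hd 0 1).mul (hd 1 0)).mul (hd 2 2))).add (((hd 0 1).mul (hd 1 2)).mul
    (hd 2 0))).add (((hd 0 2).mul (hd 1 0)).mul (hd 2 1))).sub (((hd 0 2).mul (hd 1 1)).mul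
    (hd 2 0)))
  have h4 : (fun z => (g z).det) = _ := funext fun z => Matrix.det_fin_three (g z)
  rw [h4]
  have h5 := congrArg (fun T : E3 →L[ℝ] ℝ => T (stdVec k)) h3.fderiv
  refine Eq.trans h5 ?_
  simp only [_root_.add_apply, _root_.sub_apply, _root_.smul_apply, smul_eq_mul, pd, Pi.mul_apply,
    Fin.sum_univ_three, Matrix.adjugate_fin_three]
  simp
  ring

/-- The identity `∂_k (√|g| g^{km}) = -√|g| g^{kl} Γ^m_{kl}` behind the formula for the divergence,
with `G = g⁻¹` and `P_{kij} = ∂_k g_{ij}`. -/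
theorem divergence_algebra {G : Fin 3 → Fin 3 → ℝ} {P : Fin 3 → Fin 3 → Fin 3 → ℝ}
    (hG : ∀ i j, G i j = G j i) (hP : ∀ k i j, P k i j = P k j i) (m : Fin 3) :
    ∑ k, ((1 / 2 : ℝ) * (∑ a, ∑ b, G b a * P k a b) * G k m
        - ∑ a, ∑ b, G k a * P k a b * G b m) =
      - ∑ k, ∑ l, G k l * ((1 / 2 : ℝ) * ∑ n, G m n * (P k l n + P l k n - P n k l)) := by
  simp only [Fin.sum_univ_three, hG 1 0, hG 2 0, hG 2 1, hP _ 1 0, hP _ 2 0, hP _ 2 1]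
  fin_cases m <;> simp only [Fin.zero_eta, Fin.mk_one, Fin.reduceFinMk, hG 1 0, hG 2 0, hG 2 1] <;>
  ring

/-- The divergence in coordinates: `√|g| g^{kl} ∇_k ξ_l = ∂_k (√|g| g^{kl} ξ_l)`. -/
theorem sqrt_det_mul_div (hU : IsOpen U) (hg : ∀ i j, ContDiffOn ℝ ∞ (fun y => g y i j) U)
    (hdet : ∀ y ∈ U, 0 < (g y).det) (hsym : ∀ z i j, g z i j = g z j i)
    (hξ : ∀ i, ContDiffOn ℝ ∞ (fun y => ξ y i) U) (hy : y ∈ U) :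
    ∑ k, pd k (fun z => √(g z).det * ∑ l, (g z)⁻¹ k l * ξ z l) y =
      √(g y).det * trace2 (g y) (cov1 g ξ y) := by
  have hdet' : ∀ y ∈ U, (g y).det ≠ 0 := fun y hy => (hdet y hy).ne'
  have dA : ∀ {f : E3 → ℝ}, ContDiffOn ℝ ∞ f U → DifferentiableAt ℝ f y := fun hf =>
    (hf.contDiffAt (hU.mem_nhds hy)).differentiableAt (by simp)
  have dg := fun i j => dA (hg i j)
  have di := fun i j => dA (contDiffOn_ginv hg hdet' i j)
  have dξ := fun i => dA (hξ i)
  have dd := dA (contDiffOn_det hg)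
  have dw : DifferentiableAt ℝ (fun z => √(g z).det) y := dd.sqrt (hdet' y hy)
  have ev : ∀ᶠ z in 𝓝 y, (g z).det ≠ 0 := by
    filter_upwards [hU.mem_nhds hy] with z hz using hdet' z hz
  have hw : ∀ k, pd k (fun z => √(g z).det) y =
      √(g y).det * ((1 / 2 : ℝ) * ∑ a, ∑ b, (g y)⁻¹ b a * pd k (fun z => g z a b) y) := by
    intro k
    have h1 := pd_det dg (hdet' y hy) k
    have h2 : pd k (fun z => √(g z).det) y =
        1 / (2 * √(g y).det) * pd k (fun z => (g z).det) y := by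
      simp only [pd]
      rw [fderiv_sqrt dd (hdet' y hy)]
      simp
    rw [h2, h1]
    have h3 : √(g y).det ≠ 0 := (Real.sqrt_pos.2 (hdet y hy)).ne'
    have h4 : (g y).det = √(g y).det * √(g y).det := (Real.mul_self_sqrt (hdet y hy).le).symm
    field_simp
    rw [sq, ← h4]
  have hGs : ∀ i j, (g y)⁻¹ i j = (g y)⁻¹ j i := by
    intro i j
    have : (g y).transpose = g y := by ext a b; exact hsym y b a
    conv_lhs => rw [← this, ← Matrix.transpose_nonsing_inv, Matrix.transpose_apply]
  have hPs : ∀ k i j, pd k (fun z => g z i j) y = pd k (fun z => g z j i) y := fun k i j => by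
    have : (fun z => g z i j) = fun z => g z j i := funext fun z => hsym z i j
    rw [this]
  have key : ∀ k, pd k (fun z => √(g z).det * ∑ l, (g z)⁻¹ k l * ξ z l) y =
      √(g y).det * (∑ l, (g y)⁻¹ k l * pd k (fun z => ξ z l) y +
        ∑ m, ((1 / 2 : ℝ) * (∑ a, ∑ b, (g y)⁻¹ b a * pd k (fun z => g z a b) y) * (g y)⁻¹ k m
        - ∑ a, ∑ b, (g y)⁻¹ k a * pd k (fun z => g z a b) y * (g y)⁻¹ b m) * ξ y m) := by
    intro k
    rw [pd_mul dw (DifferentiableAt.fun_sum fun l _ => (di k l).fun_mul (dξ l)), hw,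
      pd_sum fun l _ => (di k l).fun_mul (dξ l)]
    simp only [pd_mul (di _ _) (dξ _), pd_inv dg di ev, Fin.sum_univ_three]
    ring
  have alg := divergence_algebra (G := fun i j => (g y)⁻¹ i j)
    (P := fun k i j => pd k (fun z => g z i j) y) hGs hPs
  simp only [key, ← Finset.mul_sum, Finset.sum_add_distrib]
  congr 1
  rw [Finset.sum_comm (γ := Fin 3) (f := fun k m => _ * ξ y m)]
  simp only [← Finset.sum_mul, alg]
  simp only [trace2, contr, form2_stdVec, cov1, Matrix.of_apply, christoffel, ginv,
    Fin.sum_univ_three]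
  ring

end LocalDivergence

/-! ### Integration over a closed manifold by charts -/

section ExtendZero

variable {M : Type*} [TopologicalSpace M] {φ : OpenPartialHomeomorph M E3} {y : E3}

theorem isCompact_image_tsupport [CompactSpace M] {s : M → ℝ} (hsupp : tsupport s ⊆ φ.source) :
    IsCompact (φ '' tsupport s) :=
  (isClosed_tsupport s).isCompact.image_of_continuousOn (φ.continuousOn.mono hsupp)

theorem image_tsupport_subset {s : M → ℝ} (hsupp : tsupport s ⊆ φ.source) :
    φ '' tsupport s ⊆ φ.target := by
  rintro _ ⟨x, hx, rfl⟩
  exact φ.map_source (hsupp hx)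

/-- The product of `q` and of `s` read in the chart `φ`, extended by zero outside of the chart. -/
def extendZero (φ : OpenPartialHomeomorph M E3) (s : M → ℝ) (q : E3 → ℝ) : E3 → ℝ :=
  φ.target.indicator fun y => s (φ.symm y) * q y

theorem extendZero_eq_zero {s : M → ℝ} {q : E3 → ℝ} (hy : y ∉ φ '' tsupport s) :
    extendZero φ s q y = 0 := by
  unfold extendZero
  by_cases ht : y ∈ φ.target
  · rw [indicator_of_mem ht]
    by_contra h0
    exact hy ⟨φ.symm y, subset_tsupport _ (left_ne_zero_of_mul h0), φ.right_inv ht⟩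
  · exact indicator_of_notMem ht _

theorem hasCompactSupport_extendZero [CompactSpace M] {s : M → ℝ} (hsupp : tsupport s ⊆ φ.source)
    (q : E3 → ℝ) : HasCompactSupport (extendZero φ s q) :=
  HasCompactSupport.intro (isCompact_image_tsupport hsupp) fun _ hy => extendZero_eq_zero hy

/-- The Riemannian volume integral, in the chart `φ`, of a function on `M`. -/
def chartIntegral (g : OpenPartialHomeomorph M E3 → E3 → Matrix (Fin 3) (Fin 3) ℝ)
    (φ : OpenPartialHomeomorph M E3) (s : M → ℝ) : ℝ :=
  ∫ y in φ.target, s (φ.symm y) * √(g φ y).det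

theorem chartIntegral_eq_integral_extendZero
    (g : OpenPartialHomeomorph M E3 → E3 → Matrix (Fin 3) (Fin 3) ℝ) (s : M → ℝ) :
    chartIntegral g φ s = ∫ y, extendZero φ s (fun y => √(g φ y).det) y :=
  (integral_indicator φ.open_target.measurableSet).symm

end ExtendZero

/-! ### The divergence theorem on a closed manifold -/

section Divergence

open Coord

variable {M : Type*} [TopologicalSpace M] [ChartedSpace E3 M]
  {g : OpenPartialHomeomorph M E3 → E3 → Matrix (Fin 3) (Fin 3) ℝ}
  {ξ ζ : OpenPartialHomeomorph M E3 → E3 → Fin 3 → ℝ}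
  {φ ψ : OpenPartialHomeomorph M E3} {y : E3}

/-- Smoothness of a function on `M`, read in every smooth chart. -/
def IsSmoothFn (s : M → ℝ) : Prop :=
  ∀ φ ∈ IsManifold.maximalAtlas (𝓡 3) ∞ M, ContDiffOn ℝ ∞ (fun y => s (φ.symm y)) φ.target

theorem ContMDiff.isSmoothFn {s : M → ℝ} (hs : ContMDiff (𝓡 3) 𝓘(ℝ, ℝ) ∞ s) : IsSmoothFn s := by
  intro φ hφ
  rw [← contMDiffOn_iff_contDiffOn]
  exact hs.comp_contMDiffOn (contMDiffOn_symm_of_mem_maximalAtlas hφ)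

theorem IsSmoothFn.mul {s t : M → ℝ} (hs : IsSmoothFn s) (ht : IsSmoothFn t) :
    IsSmoothFn (fun x => s x * t x) := fun φ hφ => (hs φ hφ).mul (ht φ hφ)

/-- The differential of a smooth function, as a covector field. -/
theorem IsSmoothFn.isTensor1 {s : M → ℝ} (hs : IsSmoothFn s) :
    IsTensor1 (fun φ y i => pd i (fun z => s (φ.symm z)) y) where
  smooth φ hφ i := contDiffOn_pd φ.open_target (hs φ hφ) i
  law φ hφ ψ hψ y hy v := by
    unfold form1
    rw [← fderiv_eq_sum_pd, ← fderiv_eq_sum_pd]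
    have e : (fun z => s (ψ.symm z)) =ᶠ[𝓝 y] (fun z => s (φ.symm z)) ∘ coordChange φ ψ := by
      filter_upwards [(isOpen_overlap φ ψ).mem_nhds hy] with z hz
      simp only [Function.comp, symm_coordChange hz]
    have hm := (coordChange_mem_overlap hy).1
    have hd : DifferentiableAt ℝ (fun z => s (φ.symm z)) (coordChange φ ψ y) :=
      ((hs φ hφ).contDiffAt (φ.open_target.mem_nhds hm)).differentiableAt (by simp)
    rw [e.fderiv_eq, (hd.hasFDerivAt.comp y (hasFDerivAt_coordChange hφ hψ hy)).fderiv]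
    rfl

/-- The inner product of two covectors. -/
def pair1 (a : Matrix (Fin 3) (Fin 3) ℝ) (ξ ζ : Fin 3 → ℝ) : ℝ :=
  contr a (fun p q => form1 ξ p * form1 ζ q)

theorem IsTensor1.pair (hξ : IsTensor1 ξ) (hζ : IsTensor1 ζ) (hg : IsMetric g) :
    IsScalar (fun φ y => pair1 (g φ y) (ξ φ y) (ζ φ y)) where
  smooth φ hφ := by
    refine contDiffOn_contr (hg.smooth φ hφ) (fun y hy => hg.det_ne_zero hφ hy) fun i j => ?_
    simpa only [form1_stdVec] using (hξ.smooth φ hφ i).mul (hζ.smooth φ hφ j)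
  law φ hφ ψ hψ y hy := by
    unfold pair1
    rw [← hg.contr_comp hφ hψ hy (B := fun p q => form1 _ p * form1 _ q)
      ⟨fun _ _ _ => by rw [form1_add]; ring, fun _ _ _ => by rw [form1_smul]; ring,
      fun _ _ _ => by rw [form1_add]; ring, fun _ _ _ => by rw [form1_smul]; ring⟩]
    simp only [hξ.law φ hφ ψ hψ y hy, hζ.law φ hφ ψ hψ y hy]

theorem pair1_sum_left {ι : Type*} (s : Finset ι) (a : Matrix (Fin 3) (Fin 3) ℝ)
    (ξ : ι → Fin 3 → ℝ) (ζ : Fin 3 → ℝ) :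
    ∑ i ∈ s, pair1 a (ξ i) ζ = pair1 a (fun k => ∑ i ∈ s, ξ i k) ζ := by
  simp only [pair1, contr, form1_stdVec, Finset.sum_mul, Finset.mul_sum]
  rw [Finset.sum_comm]
  exact Finset.sum_congr rfl fun i _ => Finset.sum_comm

theorem IsMetric.contDiffOn_sqrt_det (hg : IsMetric g)
    (hφ : φ ∈ IsManifold.maximalAtlas (𝓡 3) ∞ M) :
    ContDiffOn ℝ ∞ (fun y => √(g φ y).det) φ.target :=
  (contDiffOn_det (hg.smooth φ hφ)).sqrt fun _ hy => hg.det_ne_zero hφ hy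

theorem det_toMat (J : E3 →L[ℝ] E3) : J.det = (toMat J).det := by
  have h := LinearMap.det_toMatrix (EuclideanSpace.basisFun (Fin 3) ℝ).toBasis (J : E3 →ₗ[ℝ] E3)
  rw [ContinuousLinearMap.det, ← h]
  congr 1

/-- The Riemannian volume integral does not depend on the chart. -/
theorem IsMetric.chartIntegral_eq (hg : IsMetric g) (hφ : φ ∈ IsManifold.maximalAtlas (𝓡 3) ∞ M)
    (hψ : ψ ∈ IsManifold.maximalAtlas (𝓡 3) ∞ M) {s : M → ℝ}
    (hs : ∀ x, s x ≠ 0 → x ∈ φ.source ∧ x ∈ ψ.source) :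
    chartIntegral g φ s = chartIntegral g ψ s := by
  have red : ∀ φ ψ : OpenPartialHomeomorph M E3, (∀ x, s x ≠ 0 → x ∈ φ.source) →
      chartIntegral g ψ s = ∫ y in overlap φ ψ, s (ψ.symm y) * √(g ψ y).det := by
    intro φ ψ h
    refine setIntegral_eq_of_subset_of_forall_sdiff_eq_zero (s := overlap φ ψ) (t := ψ.target)
      ψ.open_target.measurableSet inter_subset_left fun y hy => ?_
    by_contra h0
    exact hy.2 ⟨hy.1, h _ (left_ne_zero_of_mul h0)⟩
  rw [red ψ φ fun x hx => (hs x hx).2, red φ ψ fun x hx => (hs x hx).1]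
  have himg : coordChange φ ψ '' overlap φ ψ = overlap ψ φ := by
    ext z
    constructor
    · rintro ⟨y, hy, rfl⟩
      exact coordChange_mem_overlap hy
    · exact fun hz => ⟨coordChange ψ φ z, coordChange_mem_overlap hz, coordChange_coordChange hz⟩
  have hinj : InjOn (coordChange φ ψ) (overlap φ ψ) := by
    intro y hy z hz h
    rw [← coordChange_coordChange hy, h, coordChange_coordChange hz]
  rw [← himg, integral_image_eq_integral_abs_det_fderiv_smul volume
    (isOpen_overlap φ ψ).measurableSet
    (fun y hy => (hasFDerivAt_coordChange hφ hψ hy).hasFDerivWithinAt) hinj]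
  refine setIntegral_congr_fun (isOpen_overlap φ ψ).measurableSet fun y hy => ?_
  have h1 := eq_transpose_mul_mul (hg.law φ hφ ψ hψ y hy)
  simp only [smul_eq_mul, symm_coordChange hy]
  rw [h1, Matrix.det_mul, Matrix.det_mul, Matrix.det_transpose, ← det_toMat,
    show (jac φ ψ y).det * (g φ (coordChange φ ψ y)).det * (jac φ ψ y).det =
      (jac φ ψ y).det ^ 2 * (g φ (coordChange φ ψ y)).det by ring,
    Real.sqrt_mul (sq_nonneg _), Real.sqrt_sq_eq_abs]
  ring

theorem contDiff_extendZero [CompactSpace M] {s : M → ℝ} (hs : IsSmoothFn s)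
    (hsupp : tsupport s ⊆ φ.source)
    (hφ : φ ∈ IsManifold.maximalAtlas (𝓡 3) ∞ M) {q : E3 → ℝ} (hq : ContDiffOn ℝ ∞ q φ.target) :
    ContDiff ℝ ∞ (extendZero φ s q) := by
  rw [contDiff_iff_contDiffAt]
  intro y
  by_cases ht : y ∈ φ.target
  · refine (((hs φ hφ).mul hq).contDiffAt (φ.open_target.mem_nhds ht)).congr_of_eventuallyEq ?_
    filter_upwards [φ.open_target.mem_nhds ht] with z hz
    exact indicator_of_mem hz _
  · have hK : (φ '' tsupport s)ᶜ ∈ 𝓝 y :=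
      (isCompact_image_tsupport hsupp).isClosed.isOpen_compl.mem_nhds
        fun h => ht (image_tsupport_subset hsupp h)
    refine (contDiffAt_const (c := (0 : ℝ))).congr_of_eventuallyEq ?_
    filter_upwards [hK] with z hz
    exact extendZero_eq_zero hz

theorem integrable_extendZero [CompactSpace M] {s : M → ℝ} (hs : IsSmoothFn s)
    (hsupp : tsupport s ⊆ φ.source)
    (hφ : φ ∈ IsManifold.maximalAtlas (𝓡 3) ∞ M) {q : E3 → ℝ} (hq : ContDiffOn ℝ ∞ q φ.target) :
    Integrable (extendZero φ s q) :=
  (contDiff_extendZero hs hsupp hφ hq).continuous.integrable_of_hasCompactSupport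
    (hasCompactSupport_extendZero hsupp q)

theorem integral_pd_eq_zero {f : E3 → ℝ} (hf : ContDiff ℝ ∞ f) (hc : HasCompactSupport f)
    (k : Fin 3) : ∫ y, pd k f y = 0 := by
  have hi : Integrable (fun y => fderiv ℝ f y (stdVec k)) :=
    ((hf.continuous_fderiv (by simp)).clm_apply continuous_const).integrable_of_hasCompactSupport
      ((hc.fderiv ℝ).comp_left (g := fun L : E3 →L[ℝ] ℝ => L (stdVec k)) (by simp))
  have h := integral_mul_fderiv_eq_neg_fderiv_mul_of_integrable (𝕜 := ℝ) (μ := volume)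
    (f := fun _ : E3 => (1 : ℝ)) (g := f) (v := stdVec k) (by simp) (by simpa using hi)
    (by simpa using hf.continuous.integrable_of_hasCompactSupport hc)
    (fun _ _ => differentiableAt_const _) (fun _ _ => hf.differentiable (by simp) _)
  have h' : ∫ y, fderiv ℝ f y (stdVec k) = 0 := by simpa using h
  exact h'

/-- The divergence of a covector field in coordinates. -/
def diver (g : E3 → Matrix (Fin 3) (Fin 3) ℝ) (ξ : E3 → Fin 3 → ℝ) (y : E3) : ℝ :=
  trace2 (g y) (cov1 g ξ y)

/-- The product rule `∂_k (s √|g| ξ^k) = √|g| (s div ξ + ⟨ds, ξ⟩)`, integrated. -/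
theorem integral_diver_add_pair [CompactSpace M] (hg : IsMetric g) (hξ : IsTensor1 ξ)
    (hφ : φ ∈ IsManifold.maximalAtlas (𝓡 3) ∞ M) {s : M → ℝ} (hs : IsSmoothFn s)
    (hsupp : tsupport s ⊆ φ.source) :
    ∫ y in φ.target, (s (φ.symm y) * diver (g φ) (ξ φ) y +
      pair1 (g φ y) (fun i => pd i (fun z => s (φ.symm z)) y) (ξ φ y)) * √(g φ y).det = 0 := by
  set X : Fin 3 → E3 → ℝ := fun k y => √(g φ y).det * ∑ l, (g φ y)⁻¹ k l * ξ φ y l with hX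
  have hXs : ∀ k, ContDiffOn ℝ ∞ (X k) φ.target := fun k =>
    (hg.contDiffOn_sqrt_det hφ).mul (ContDiffOn.sum fun l _ =>
      (contDiffOn_ginv (hg.smooth φ hφ) (fun y hy => hg.det_ne_zero hφ hy) k l).mul
        (hξ.smooth φ hφ l))
  have hV := fun k => contDiff_extendZero hs hsupp hφ (hXs k)
  have hVc := fun k => hasCompactSupport_extendZero hsupp (X k)
  have hint : ∀ k, Integrable (fun y => pd k (extendZero φ s (X k)) y) := fun k =>
    (((hV k).continuous_fderiv (by simp)).clm_apply
      continuous_const).integrable_of_hasCompactSupport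
      (((hVc k).fderiv ℝ).comp_left (g := fun L : E3 →L[ℝ] ℝ => L (stdVec k)) (by simp))
  have h0 : ∫ y, ∑ k, pd k (extendZero φ s (X k)) y = 0 := by
    rw [integral_finsetSum _ fun k _ => hint k]
    exact Finset.sum_eq_zero fun k _ => integral_pd_eq_zero (hV k) (hVc k) k
  rw [← h0, ← integral_indicator φ.open_target.measurableSet]
  congr 1
  funext y
  by_cases ht : y ∈ φ.target
  · rw [indicator_of_mem ht]
    have hn := φ.open_target.mem_nhds ht
    have e : ∀ k, pd k (extendZero φ s (X k)) y =
        pd k (fun z => s (φ.symm z)) y * X k y + s (φ.symm y) * pd k (X k) y := by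
      intro k
      rw [← pd_mul (((hs φ hφ).contDiffAt hn).differentiableAt (by simp))
        (((hXs k).contDiffAt hn).differentiableAt (by simp))]
      refine pd_congr ?_ k
      filter_upwards [hn] with z hz
      exact indicator_of_mem hz _
    simp only [e, Finset.sum_add_distrib, ← Finset.mul_sum]
    rw [sqrt_det_mul_div φ.open_target (hg.smooth φ hφ) (fun y hy => hg.det_pos hφ hy)
      (hg.symm φ) (hξ.smooth φ hφ) ht]
    simp only [hX, diver, pair1, contr, form1_stdVec, Fin.sum_univ_three]
    ring
  · rw [indicator_of_notMem ht]
    symm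
    refine Finset.sum_eq_zero fun k _ => ?_
    have hK : (φ '' tsupport s)ᶜ ∈ 𝓝 y :=
      (isCompact_image_tsupport hsupp).isClosed.isOpen_compl.mem_nhds
        fun h => ht (image_tsupport_subset hsupp h)
    have e : extendZero φ s (X k) =ᶠ[𝓝 y] fun _ => 0 := by
      filter_upwards [hK] with z hz
      exact extendZero_eq_zero hz
    rw [pd_congr e, pd_const]

/-- A scalar given in all charts is a function on `M`. -/
theorem IsScalar.exists_eq [IsManifold (𝓡 3) ∞ M]
    {σ : OpenPartialHomeomorph M E3 → E3 → ℝ} (hσ : IsScalar σ) :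
    ∃ s : M → ℝ, IsSmoothFn s ∧
      ∀ φ ∈ IsManifold.maximalAtlas (𝓡 3) ∞ M, ∀ y ∈ φ.target, σ φ y = s (φ.symm y) := by
  have key : ∀ φ ∈ IsManifold.maximalAtlas (𝓡 3) ∞ M, ∀ y ∈ φ.target,
      σ φ y = σ (chartAt E3 (φ.symm y)) (chartAt E3 (φ.symm y) (φ.symm y)) := fun φ hφ y hy =>
    hσ.law _ (IsManifold.chart_mem_maximalAtlas (φ.symm y)) φ hφ y ⟨hy, mem_chart_source E3 _⟩
  exact ⟨fun x => σ (chartAt E3 x) (chartAt E3 x x),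
    fun φ hφ => (hσ.smooth φ hφ).congr fun y hy => (key φ hφ y hy).symm, key⟩

/-- A finite smooth partition of unity subordinate to charts. -/
theorem exists_finite_partition [CompactSpace M] [T2Space M] [IsManifold (𝓡 3) ∞ M] :
    ∃ (S : Finset M) (ρ : S → M → ℝ), (∀ a, IsSmoothFn (ρ a)) ∧
    (∀ a, tsupport (ρ a) ⊆ (chartAt E3 (a : M)).source) ∧ (∀ a x, 0 ≤ ρ a x) ∧
    ∀ x, ∑ a, ρ a x = 1 := by
  obtain ⟨S, hS⟩ := isCompact_univ.elim_finite_subcover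
    (fun x : M => (chartAt E3 x).source) (fun x => (chartAt E3 x).open_source)
    (fun x _ => mem_iUnion.2 ⟨x, mem_chart_source E3 x⟩)
  obtain ⟨f, hf⟩ := SmoothPartitionOfUnity.exists_isSubordinate (𝓡 3) (s := (univ : Set M))
    isClosed_univ (fun a : S => (chartAt E3 (a : M)).source) (fun a => (chartAt E3 _).open_source)
    (fun x hx => by
      obtain ⟨a, ha, hxa⟩ := mem_iUnion₂.1 (hS hx)
      exact mem_iUnion.2 ⟨⟨a, ha⟩, hxa⟩)
  refine ⟨S, fun a => f a, fun a => ContMDiff.isSmoothFn (f a).contMDiff, hf,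
    fun a x => f.nonneg a x, fun x => ?_⟩
  rw [← finsum_eq_sum_of_fintype]
  exact f.sum_eq_one (mem_univ x)

/-- A consequence of the divergence theorem on a closed manifold: a nonnegative divergence
vanishes identically. With a partition of unity, `∫ div ξ = ∑ ∫ ρ_a div ξ = -∑ ∫ ⟨dρ_a, ξ⟩`, which
is zero as `∑ ρ_a = 1`; the integrals are taken in charts. -/
theorem diver_eq_zero_of_nonneg [CompactSpace M] [T2Space M] [IsManifold (𝓡 3) ∞ M]
    (hg : IsMetric g) (hξ : IsTensor1 ξ)
    (hpos : ∀ φ ∈ IsManifold.maximalAtlas (𝓡 3) ∞ M, ∀ y ∈ φ.target, 0 ≤ diver (g φ) (ξ φ) y) :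
    ∀ φ ∈ IsManifold.maximalAtlas (𝓡 3) ∞ M, ∀ y ∈ φ.target, diver (g φ) (ξ φ) y = 0 := by
  obtain ⟨S, ρ, hρ, hsupp, hρ0, hρ1⟩ := exists_finite_partition (M := M)
  obtain ⟨F, hF, hFeq⟩ := (hξ.div hg).exists_eq
  have hFpos : ∀ x, 0 ≤ F x := by
    intro x
    have h1 := hpos _ (IsManifold.chart_mem_maximalAtlas x) _
      ((chartAt E3 x).map_source (mem_chart_source E3 x))
    unfold diver at h1
    rwa [hFeq _ (IsManifold.chart_mem_maximalAtlas x) _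
      ((chartAt E3 x).map_source (mem_chart_source E3 x)),
      (chartAt E3 x).left_inv (mem_chart_source E3 x)] at h1
  choose T hT hTeq using fun a => ((hρ a).isTensor1.pair hξ hg).exists_eq
  set c : S → OpenPartialHomeomorph M E3 := fun a => chartAt E3 (a : M) with hc
  have hcA : ∀ a, c a ∈ IsManifold.maximalAtlas (𝓡 3) ∞ M := fun a =>
    IsManifold.chart_mem_maximalAtlas (a : M)
  have hw := fun a => hg.contDiffOn_sqrt_det (hcA a)
  have chart : ∀ x : M, ∃ φ ∈ IsManifold.maximalAtlas (𝓡 3) ∞ M, ∃ y ∈ φ.target, φ.symm y = x :=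
    fun x => ⟨chartAt E3 x, IsManifold.chart_mem_maximalAtlas x, chartAt E3 x x,
      mem_chart_target E3 x, (chartAt E3 x).left_inv (mem_chart_source E3 x)⟩
  have hTsupp : ∀ a, tsupport (T a) ⊆ tsupport (ρ a) := by
    intro a
    refine closure_minimal (fun x hx => ?_) (isClosed_tsupport _)
    by_contra hxn
    apply hx
    obtain ⟨φ, hφ, y, hy, rfl⟩ := chart x
    rw [← hTeq a φ hφ y hy]
    have e : (fun z => ρ a (φ.symm z)) =ᶠ[𝓝 y] fun _ => 0 := by
      have h2 : (φ.symm ⁻¹' (tsupport (ρ a))ᶜ) ∈ 𝓝 y :=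
        (φ.continuousAt_symm hy).preimage_mem_nhds ((isClosed_tsupport _).isOpen_compl.mem_nhds hxn)
      filter_upwards [h2] with z hz
      exact image_eq_zero_of_notMem_tsupport hz
    have e2 : ∀ i, pd i (fun z => ρ a (φ.symm z)) y = 0 := fun i => by rw [pd_congr e, pd_const]
    simp [pair1, contr, e2]
  have hTsum : ∀ x, ∑ a, T a x = 0 := by
    intro x
    obtain ⟨φ, hφ, y, hy, rfl⟩ := chart x
    have e : ∀ i, ∑ a, pd i (fun z => ρ a (φ.symm z)) y = 0 := by
      intro i
      rw [← pd_sum fun a _ => ((hρ a φ hφ).contDiffAt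
        (φ.open_target.mem_nhds hy)).differentiableAt (by simp)]
      simp only [hρ1, pd_const]
    simp only [← hTeq _ φ hφ y hy]
    rw [pair1_sum_left]
    simp only [pair1, contr, form1_stdVec, e, zero_mul, mul_zero, Finset.sum_const_zero]
  have hprod : ∀ (a : S) (t : M → ℝ), tsupport (fun x => ρ a x * t x) ⊆ (c a).source := fun a t =>
    (closure_mono (Function.support_mul_subset_left _ _)).trans (hsupp a)
  -- The integral of `ρ_a div ξ` is minus that of `⟨dρ_a, ξ⟩`.
  have integral_div : ∀ a, chartIntegral g (c a) (fun x => ρ a x * F x) =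
      - chartIntegral g (c a) (T a) := by
    intro a
    have h1 := integral_diver_add_pair hg hξ (hcA a) (hρ a) (hsupp a)
    have h2 : ∫ y in (c a).target, ((ρ a ((c a).symm y) * F ((c a).symm y)) * √(g (c a) y).det +
        T a ((c a).symm y) * √(g (c a) y).det) = 0 := by
      rw [← h1]
      refine setIntegral_congr_fun (c a).open_target.measurableSet fun y hy => ?_
      simp only [diver]
      rw [hFeq _ (hcA a) y hy, hTeq a _ (hcA a) y hy]
      ring
    rw [integral_add] at h2
    · exact eq_neg_of_add_eq_zero_left h2
    · exact (integrable_indicator_iff (c a).open_target.measurableSet).1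
        (integrable_extendZero ((hρ a).mul hF) (hprod a F) (hcA a) (hw a))
    · exact (integrable_indicator_iff (c a).open_target.measurableSet).1
        (integrable_extendZero (hT a) ((hTsupp a).trans (hsupp a)) (hcA a) (hw a))
  have hsum : ∀ (a : S) (t : S → M → ℝ), (∀ b, IsSmoothFn (t b)) →
      (∀ b, tsupport (t b) ⊆ (c a).source) →
      chartIntegral g (c a) (fun x => ∑ b, t b x) = ∑ b, chartIntegral g (c a) (t b) := by
    intro a t ht hts
    unfold chartIntegral
    rw [← integral_finsetSum]
    · simp only [Finset.sum_mul]
    · intro b _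
      exact (integrable_indicator_iff (c a).open_target.measurableSet).1
        (integrable_extendZero (ht b) (hts b) (hcA a) (hw a))
  have hts1 : ∀ a b, tsupport (fun x => ρ b x * T a x) ⊆ (c a).source := fun a b =>
    ((closure_mono (Function.support_mul_subset_right _ _)).trans (hTsupp a)).trans (hsupp a)
  -- Insert `1 = ∑ ρ_b` and move the integral of `ρ_b ⟨dρ_a, ξ⟩` to the chart `b`.
  have sum_integral_pair : ∑ a, chartIntegral g (c a) (T a) = 0 := by
    have h1 : ∀ a, chartIntegral g (c a) (T a) =
        ∑ b, chartIntegral g (c b) (fun x => ρ b x * T a x) := by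
      intro a
      have h2 : T a = fun x => ∑ b, ρ b x * T a x := by
        funext x
        rw [← Finset.sum_mul, hρ1, one_mul]
      conv_lhs => rw [h2]
      rw [hsum a _ (fun b => (hρ b).mul (hT a)) (hts1 a)]
      refine Finset.sum_congr rfl fun b _ => hg.chartIntegral_eq (hcA a) (hcA b) fun x hx => ?_
      exact ⟨hts1 a b (subset_tsupport _ hx), hprod b (T a) (subset_tsupport _ hx)⟩
    simp only [h1]
    rw [Finset.sum_comm]
    refine Finset.sum_eq_zero fun b _ => ?_
    rw [← hsum b _ (fun a => (hρ b).mul (hT a)) (fun a => hprod b (T a))]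
    simp only [← Finset.mul_sum, hTsum, chartIntegral, mul_zero, zero_mul, integral_zero]
  have hnn : ∀ a y, 0 ≤ extendZero (c a) (fun x => ρ a x * F x) (fun y => √(g (c a) y).det) y :=
    fun a y => indicator_nonneg (fun y _ => mul_nonneg (mul_nonneg (hρ0 a _) (hFpos _))
      (Real.sqrt_nonneg _)) y
  have integral_eq_zero_of_chart : ∀ a, chartIntegral g (c a) (fun x => ρ a x * F x) = 0 := by
    have h1 : ∑ a, chartIntegral g (c a) (fun x => ρ a x * F x) = 0 := by
      simp only [integral_div, Finset.sum_neg_distrib, sum_integral_pair, neg_zero]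
    have h2 : ∀ a ∈ Finset.univ, 0 ≤ chartIntegral g (c a) (fun x => ρ a x * F x) := by
      intro a _
      rw [chartIntegral_eq_integral_extendZero]
      exact integral_nonneg (hnn a)
    exact fun a => (Finset.sum_eq_zero_iff_of_nonneg h2).1 h1 a (Finset.mem_univ a)
  have mul_div_eq_zero : ∀ a x, ρ a x * F x = 0 := by
    intro a x
    by_contra hne
    have hx : x ∈ (c a).source := hprod a F (subset_tsupport _ hne)
    have h1 := integral_eq_zero_of_chart a
    have hsm := contDiff_extendZero ((hρ a).mul hF) (hprod a F) (hcA a) (hw a)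
    rw [chartIntegral_eq_integral_extendZero, integral_eq_zero_iff_of_nonneg (hnn a)
      (integrable_extendZero ((hρ a).mul hF) (hprod a F) (hcA a) (hw a)),
      hsm.continuous.ae_eq_iff_eq volume continuous_zero] at h1
    have h2 := congrFun h1 (c a x)
    have ht := (c a).map_source hx
    simp only [extendZero, indicator_of_mem ht, (c a).left_inv hx, Pi.zero_apply] at h2
    rcases mul_eq_zero.1 h2 with h3 | h3
    · exact hne h3
    · exact (Real.sqrt_pos.2 (hg.det_pos (hcA a) ht)).ne' h3
  intro φ hφ y hy
  have h1 : F (φ.symm y) = ∑ a, ρ a (φ.symm y) * F (φ.symm y) := by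
    rw [← Finset.sum_mul, hρ1, one_mul]
  unfold diver
  rw [hFeq φ hφ y hy, h1]
  exact Finset.sum_eq_zero fun a _ => mul_div_eq_zero a _

end Divergence

/-! ### Evaluation at a normal point -/

section NormalPoint

open Coord

/-- A point `y` at which the coordinates are normal, in a domain `U` on which the metric `g` is
smooth and nondegenerate. -/
structure NormalPoint (U : Set E3) (g : E3 → Matrix (Fin 3) (Fin 3) ℝ) (y : E3) : Prop where
  isOpen : IsOpen U
  mem : y ∈ U
  smooth : ∀ i j, ContDiffOn ℝ ∞ (fun z => g z i j) U
  det : ∀ z ∈ U, (g z).det ≠ 0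
  symm : ∀ z i j, g z i j = g z j i
  normal : IsNormalAt g y

variable {U : Set E3} {g h b : E3 → Matrix (Fin 3) (Fin 3) ℝ} {ξ : E3 → Fin 3 → ℝ}
  {D : E3 → Fin 3 → Fin 3 → Fin 3 → ℝ} {y : E3}

namespace NormalPoint

theorem diff (hn : NormalPoint U g y) {f : E3 → ℝ} (hf : ContDiffOn ℝ ∞ f U) :
    DifferentiableAt ℝ f y :=
  (hf.contDiffAt (hn.isOpen.mem_nhds hn.mem)).differentiableAt (by simp)

theorem inv_eq (hn : NormalPoint U g y) : (g y)⁻¹ = 1 := by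
  rw [hn.normal.eq_one, inv_one]

theorem contr_eq (hn : NormalPoint U g y) (B : E3 → E3 → ℝ) :
    contr (g y) B = ∑ i, B (stdVec i) (stdVec i) := by
  simp [contr, hn.inv_eq, Matrix.one_apply]

theorem pd_ginv_eq_zero (hn : NormalPoint U g y) (k i j : Fin 3) :
    pd k (fun z => (g z)⁻¹ i j) y = 0 := by
  rw [pd_inv (fun i j => hn.diff (hn.smooth i j))
    (fun i j => hn.diff (contDiffOn_ginv hn.smooth hn.det i j))
    (by filter_upwards [hn.isOpen.mem_nhds hn.mem] with z hz using hn.det z hz)]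
  simp [hn.normal.pd_eq_zero]

/-- At a normal point, contractions commute with partial derivatives. -/
theorem pd_contr (hn : NormalPoint U g y) {B : E3 → E3 → E3 → ℝ}
    (hB : ∀ i j, ContDiffOn ℝ ∞ (fun z => B z (stdVec i) (stdVec j)) U) (k : Fin 3) :
    pd k (fun z => contr (g z) (B z)) y = ∑ i, pd k (fun z => B z (stdVec i) (stdVec i)) y := by
  have di := fun i j => hn.diff (contDiffOn_ginv hn.smooth hn.det i j)
  have dB := fun i j => hn.diff (hB i j)
  unfold contr
  rw [pd_sum fun i _ => DifferentiableAt.fun_sum fun j _ => (di i j).fun_mul (dB i j)]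
  refine Finset.sum_congr rfl fun i _ => ?_
  rw [pd_sum fun j _ => (di i j).fun_mul (dB i j)]
  simp [pd_mul (di _ _) (dB _ _), hn.pd_ginv_eq_zero, hn.inv_eq, Matrix.one_apply]

theorem christoffel_eq_zero (hn : NormalPoint U g y) (k i j : Fin 3) :
    christoffel g k i j y = 0 := by
  simp [christoffel, hn.normal.pd_eq_zero]

theorem cov1_eq (hn : NormalPoint U g y) (k i : Fin 3) :
    cov1 g ξ y k i = pd k (fun z => ξ z i) y := by
  simp [cov1, hn.christoffel_eq_zero]

theorem nabla_eq (hn : NormalPoint U g y) (k i j : Fin 3) :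
    nabla g h k i j y = pd k (fun z => h z i j) y := by
  simp [nabla, hn.christoffel_eq_zero]

theorem nabla2_eq (hn : NormalPoint U g y) (l k i j : Fin 3) :
    nabla2 g h l k i j y = pd l (nabla g h k i j) y := by
  simp [nabla2, hn.christoffel_eq_zero]

theorem trace2_eq (hn : NormalPoint U g y) (b : Matrix (Fin 3) (Fin 3) ℝ) :
    trace2 (g y) b = ∑ i, b i i := by
  simp [trace2, hn.contr_eq]

theorem diver_eq (hn : NormalPoint U g y) : diver g ξ y = ∑ k, pd k (fun z => ξ z k) y := by
  simp [diver, hn.trace2_eq, hn.cov1_eq]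

theorem pd_trace2 (hn : NormalPoint U g y) (hb : ∀ i j, ContDiffOn ℝ ∞ (fun z => b z i j) U)
    (k : Fin 3) : pd k (fun z => trace2 (g z) (b z)) y = ∑ i, pd k (fun z => b z i i) y := by
  unfold trace2
  rw [hn.pd_contr fun i j => by simpa only [form2_stdVec] using hb i j]
  simp only [form2_stdVec]

theorem traceFirst_eq (hn : NormalPoint U g y) (D : Fin 3 → Fin 3 → Fin 3 → ℝ) (k : Fin 3) :
    traceFirst (g y) D k = ∑ i, D i k i := by
  simp [traceFirst, hn.contr_eq]

theorem traceLast_eq (hn : NormalPoint U g y) (D : Fin 3 → Fin 3 → Fin 3 → ℝ) (k : Fin 3) :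
    traceLast (g y) D k = ∑ i, D k i i := by
  simp [traceLast, hn.contr_eq]

theorem pd_traceFirst (hn : NormalPoint U g y)
    (hD : ∀ k i j, ContDiffOn ℝ ∞ (fun z => D z k i j) U) (l k : Fin 3) :
    pd l (fun z => traceFirst (g z) (D z) k) y = ∑ i, pd l (fun z => D z i k i) y := by
  unfold traceFirst
  rw [hn.pd_contr fun i j => by simpa only [form3_stdVec] using hD j k i]
  simp only [form3_stdVec]

theorem pd_traceLast (hn : NormalPoint U g y)
    (hD : ∀ k i j, ContDiffOn ℝ ∞ (fun z => D z k i j) U) (l k : Fin 3) :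
    pd l (fun z => traceLast (g z) (D z) k) y = ∑ i, pd l (fun z => D z k i i) y := by
  unfold traceLast
  rw [hn.pd_contr fun i j => by simpa only [form3_stdVec] using hD k i j]
  simp only [form3_stdVec]

theorem pd_contrRight (hn : NormalPoint U g y)
    (hb : ∀ i j, ContDiffOn ℝ ∞ (fun z => b z i j) U) (hξ : ∀ i, ContDiffOn ℝ ∞ (fun z => ξ z i) U)
    (l k : Fin 3) : pd l (fun z => contrRight (g z) (b z) (ξ z) k) y =
      ∑ i, (pd l (fun z => b z k i) y * ξ y i + b y k i * pd l (fun z => ξ z i) y) := by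
  unfold contrRight
  rw [hn.pd_contr fun i j => by
    simpa only [form2_stdVec, form1_stdVec] using (hb k i).mul (hξ j)]
  simp only [form2_stdVec, form1_stdVec, pd_mul (hn.diff (hb _ _)) (hn.diff (hξ _))]

theorem pd_contrLeft (hn : NormalPoint U g y)
    (hb : ∀ i j, ContDiffOn ℝ ∞ (fun z => b z i j) U) (hξ : ∀ i, ContDiffOn ℝ ∞ (fun z => ξ z i) U)
    (l k : Fin 3) : pd l (fun z => contrLeft (g z) (b z) (ξ z) k) y =
      ∑ i, (pd l (fun z => b z i k) y * ξ y i + b y i k * pd l (fun z => ξ z i) y) := by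
  unfold contrLeft
  rw [hn.pd_contr fun i j => by
    simpa only [form2_stdVec, form1_stdVec] using (hb i k).mul (hξ j)]
  simp only [form2_stdVec, form1_stdVec, pd_mul (hn.diff (hb _ _)) (hn.diff (hξ _))]

theorem pd_contrLast (hn : NormalPoint U g y)
    (hb : ∀ i j, ContDiffOn ℝ ∞ (fun z => b z i j) U)
    (hD : ∀ k i j, ContDiffOn ℝ ∞ (fun z => D z k i j) U) (l k : Fin 3) :
    pd l (fun z => contrLast (g z) (b z) (D z) k) y =
      ∑ i, ∑ j, (pd l (fun z => b z i j) y * D y k i j +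
        b y i j * pd l (fun z => D z k i j) y) := by
  have h1 : ∀ i j m n, ContDiffOn ℝ ∞ (fun z => form2 (b z) (stdVec i) (stdVec m) *
      form3 (D z) (stdVec k) (stdVec j) (stdVec n)) U := fun i j m n => by
    simpa only [form2_stdVec, form3_stdVec] using (hb i m).mul (hD k j n)
  unfold contrLast
  rw [hn.pd_contr fun i j => contDiffOn_contr hn.smooth hn.det fun m n => h1 i j m n]
  refine Finset.sum_congr rfl fun i _ => ?_
  rw [hn.pd_contr fun m n => h1 i i m n]
  simp only [form2_stdVec, form3_stdVec, pd_mul (hn.diff (hb _ _)) (hn.diff (hD _ _ _))]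

theorem pd_contrFirst (hn : NormalPoint U g y)
    (hb : ∀ i j, ContDiffOn ℝ ∞ (fun z => b z i j) U)
    (hD : ∀ k i j, ContDiffOn ℝ ∞ (fun z => D z k i j) U) (l k : Fin 3) :
    pd l (fun z => contrFirst (g z) (b z) (D z) k) y =
      ∑ i, ∑ j, (pd l (fun z => b z i j) y * D y i j k +
        b y i j * pd l (fun z => D z i j k) y) := by
  have h1 : ∀ i j m n, ContDiffOn ℝ ∞ (fun z => form2 (b z) (stdVec i) (stdVec m) *
      form3 (D z) (stdVec j) (stdVec n) (stdVec k)) U := fun i j m n => by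
    simpa only [form2_stdVec, form3_stdVec] using (hb i m).mul (hD j n k)
  unfold contrFirst
  rw [hn.pd_contr fun i j => contDiffOn_contr hn.smooth hn.det fun m n => h1 i j m n]
  refine Finset.sum_congr rfl fun i _ => ?_
  rw [hn.pd_contr fun m n => h1 i i m n]
  simp only [form2_stdVec, form3_stdVec, pd_mul (hn.diff (hb _ _)) (hn.diff (hD _ _ _))]

/-! ### Curvature at a normal point -/

theorem pd_pd_comm {f : E3 → ℝ} (hf : ContDiffAt ℝ ∞ f y) (i j : Fin 3) :
    pd i (pd j f) y = pd j (pd i f) y := by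
  have h1 : ContDiffAt ℝ 1 (fderiv ℝ f) y := hf.fderiv_right (by norm_cast)
  have h2 := (h1.differentiableAt (by simp)).hasFDerivAt
  have h3 : ∀ a b, pd a (pd b f) y = fderiv ℝ (fderiv ℝ f) y (stdVec a) (stdVec b) := by
    intro a b
    have h4 : HasFDerivAt (pd b f) _ y := h2.clm_apply (hasFDerivAt_const (stdVec b) y)
    change fderiv ℝ (pd b f) y (stdVec a) = _
    rw [h4.fderiv]
    simp
  rw [h3, h3, (hf.isSymmSndFDerivAt (by
    simp only [minSmoothness_of_isRCLikeNormedField]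
    exact WithTop.coe_le_coe.2 (le_top : (2 : ℕ∞) ≤ ⊤))).eq]

theorem pd_christoffel (hn : NormalPoint U g y) (a k i j : Fin 3) :
    pd a (christoffel g k i j) y = (1 / 2 : ℝ) *
      (pd a (pd i (fun z => g z j k)) y + pd a (pd j (fun z => g z i k)) y
        - pd a (pd k (fun z => g z i j)) y) := by
  have d1 : ∀ m i j, DifferentiableAt ℝ (pd m (fun z => g z i j)) y := fun m i j =>
    hn.diff (contDiffOn_pd hn.isOpen (hn.smooth i j) m)
  have d2 := fun i j => hn.diff (contDiffOn_ginv hn.smooth hn.det i j)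
  have d3 : ∀ l, DifferentiableAt ℝ (fun z => pd i (fun w => g w j l) z +
      pd j (fun w => g w i l) z - pd l (fun w => g w i j) z) y := fun l =>
    ((d1 i j l).add (d1 j i l)).sub (d1 l i j)
  have d4 : ∀ l, DifferentiableAt ℝ (fun z => (g z)⁻¹ k l * (pd i (fun w => g w j l) z +
      pd j (fun w => g w i l) z - pd l (fun w => g w i j) z)) y := fun l =>
    (d2 k l).fun_mul (d3 l)
  change pd a (fun z => (1 / 2 : ℝ) * ∑ l, (g z)⁻¹ k l * (pd i (fun w => g w j l) z +
      pd j (fun w => g w i l) z - pd l (fun w => g w i j) z)) y = _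
  rw [pd_mul (differentiableAt_const _) (DifferentiableAt.fun_sum fun l _ => d4 l), pd_const,
    pd_sum fun l _ => d4 l]
  have e : ∀ l, pd a (fun z => pd i (fun w => g w j l) z + pd j (fun w => g w i l) z
      - pd l (fun w => g w i j) z) y = pd a (pd i (fun z => g z j l)) y
        + pd a (pd j (fun z => g z i l)) y - pd a (pd l (fun z => g z i j)) y := by
    intro l
    have := (((d1 i j l).hasFDerivAt.add (d1 j i l).hasFDerivAt).sub (d1 l i j).hasFDerivAt).fderiv
    exact congrArg (fun T : E3 →L[ℝ] ℝ => T (stdVec a)) this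
  simp [pd_mul (d2 _ _) (d3 _), hn.pd_ginv_eq_zero, hn.inv_eq, Matrix.one_apply, e]

theorem curv_eq (hn : NormalPoint U g y) (l i j k : Fin 3) :
    curv g l i j k y = pd i (christoffel g l j k) y - pd j (christoffel g l i k) y := by
  simp [curv, hn.christoffel_eq_zero]

end NormalPoint

/-- In dimension three the curvature is determined by the Ricci curvature: by its symmetries it has
six components, on which the six components of the Ricci curvature depend invertibly. Here the
curvature is written in normal coordinates, with `S i j k l = ∂_i ∂_j g_{kl}`. -/
theorem curvature_algebra {S : Fin 3 → Fin 3 → Fin 3 → Fin 3 → ℝ}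
    (h1 : ∀ i j k l, S i j k l = S j i k l) (h2 : ∀ i j k l, S i j k l = S i j l k)
    {R : Fin 3 → Fin 3 → Fin 3 → Fin 3 → ℝ}
    (hR : ∀ l i j k, R l i j k =
      (1 / 2 : ℝ) * (S i k j l - S i l j k - S j k i l + S j l i k)) {κ : ℝ}
    (hric : ∀ j k, ∑ i, R i i j k = if j = k then 2 * κ else 0) (l i j k : Fin 3) :
    R l i j k = κ * ((if l = i then 1 else 0) * (if j = k then 1 else 0)
      - (if i = k then 1 else 0) * (if l = j then 1 else 0)) := by
  -- The antisymmetry in each pair of indices and the symmetry under exchange of the pairs.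
  have a1 : ∀ l i j k, R l i j k = - R l j i k := fun l i j k => by rw [hR, hR]; ring
  have a2 : ∀ l i j k, R l i j k = - R k i j l := fun l i j k => by rw [hR, hR]; ring
  have a3 : ∀ l i j k, R l i j k = R i l k j := fun l i j k => by
    rw [hR, hR, h1 l j, h1 l i, h1 k j, h1 k i, h2 j l k i, h2 i l k j, h2 j k l i, h2 i k l j]
    ring
  have z1 : ∀ l i k, R l i i k = 0 := fun l i k => by linarith [a1 l i i k]
  have z2 : ∀ l i j, R l i j l = 0 := fun l i j => by linarith [a2 l i j l]
  have s1 := fun l k => a1 l 1 0 k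
  have s2 := fun l k => a1 l 2 0 k
  have s3 := fun l k => a1 l 2 1 k
  have t1 := fun i j => a2 1 i j 0
  have t2 := fun i j => a2 2 i j 0
  have t3 := fun i j => a2 2 i j 1
  have p1 := a3 0 0 2 1
  have p2 := a3 0 1 2 1
  have p3 := a3 0 1 2 2
  have e00 := hric 0 0
  have e11 := hric 1 1
  have e22 := hric 2 2
  have e01 := hric 0 1
  have e02 := hric 0 2
  have e12 := hric 1 2
  simp only [Fin.sum_univ_three, z1, z2, s1, s2, s3, t1, t2, t3, if_true, Fin.isValue,
    Fin.reduceEq, if_false] at e00 e11 e22 e01 e02 e12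
  fin_cases l <;> fin_cases i <;> fin_cases j <;> fin_cases k <;>
  simp only [Fin.zero_eta, Fin.mk_one, Fin.reduceFinMk, z1, z2, s1, s2, s3, t1, t2, t3, p1, p2, p3,
    if_true, Fin.isValue, Fin.reduceEq, if_false] <;>
  linarith

end NormalPoint

/-! ### The pointwise identities -/

section Algebra

variable {H W : Fin 3 → Fin 3 → ℝ} {N P : Fin 3 → Fin 3 → Fin 3 → ℝ}
  {Q : Fin 3 → Fin 3 → Fin 3 → Fin 3 → ℝ} {η : Fin 3 → ℝ} {lam : ℝ}

/-- The commutation rule for the second covariant derivatives `Q_{lkij} = ∇_l ∇_k h_{ij}` of a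
symmetric 2-tensor on a space of curvature `-1/9`, in an orthonormal frame. -/
def RicciIdentity2 (H : Fin 3 → Fin 3 → ℝ) (Q : Fin 3 → Fin 3 → Fin 3 → Fin 3 → ℝ) : Prop :=
  ∀ l k i j, Q l k i j - Q k l i j = (1 / 9 : ℝ) *
    ((if k = i then 1 else 0) * H l j - (if l = i then 1 else 0) * H k j
      + (if k = j then 1 else 0) * H i l - (if l = j then 1 else 0) * H i k)

/-- The commutation rule for the second covariant derivatives `P_{lki} = ∇_l ∇_k η_i` of a
covector field on a space of curvature `-1/9`, in an orthonormal frame. -/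
def RicciIdentity1 (η : Fin 3 → ℝ) (P : Fin 3 → Fin 3 → Fin 3 → ℝ) : Prop :=
  ∀ l k i, P l k i - P k l i = (1 / 9 : ℝ) *
    ((if k = i then 1 else 0) * η l - (if l = i then 1 else 0) * η k)

/-- `∇^k ∇_i h_{jk} = ∇_i ∇^k h_{jk} - (1/3) h_{ij}` for a trace-free `h`. -/
theorem RicciIdentity2.contract (hQ : RicciIdentity2 H Q) (hH : ∀ i j, H i j = H j i)
    (htr : ∑ i, H i i = 0) (i j : Fin 3) :
    ∑ k, Q k i j k = ∑ k, Q i k j k - (1 / 3 : ℝ) * H i j := by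
  rw [← sub_eq_zero]
  have h1 : ∑ k, (Q k i j k - Q i k j k) = - (1 / 3 : ℝ) * H i j := by
    simp only [hQ _ _ _ _]
    rw [Fin.sum_univ_three] at htr ⊢
    fin_cases i <;> fin_cases j <;> simp [hH 1 0, hH 2 0, hH 2 1] <;> linarith
  rw [Finset.sum_sub_distrib] at h1
  linarith

/-- The divergence of `u ∇u`, where `u` is the trace of an eigentensor `h`. Here and below, `H`, `N`
and `Q` are the components of `h`, `∇h` and `∇∇h` in an orthonormal frame. -/
theorem trace_algebra (heig : ∀ i j, ∑ k, Q k k i j =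
      (2 / 9 : ℝ) * (if i = j then ∑ m, H m m else 0) - (2 / 9 + lam) * H i j) :
    ∑ k, ((∑ i, N k i i) * (∑ i, N k i i) + (∑ i, H i i) * ∑ i, Q k k i i) =
      ∑ k, (∑ i, N k i i) ^ 2 + (4 / 9 - lam) * (∑ i, H i i) ^ 2 := by
  have h1 : ∑ k, ∑ i, Q k k i i = (4 / 9 - lam) * ∑ i, H i i := by
    rw [Finset.sum_comm]
    simp only [heig, if_true, Fin.sum_univ_three]
    ring
  rw [Finset.sum_add_distrib, ← Finset.mul_sum, h1]
  simp only [sq]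
  ring

/-- The divergence of the covector `h^{ij} ∇_k h_{ij} - h^{ij} ∇_i h_{jk} + h_k^i η_i` for a
trace-free eigentensor `h`, where `η` is the divergence of `h` and `W = ∇η`. -/
theorem bound_algebra (hH : ∀ i j, H i j = H j i) (hN : ∀ k i j, N k i j = N k j i)
    (htr : ∑ i, H i i = 0) (hQ : RicciIdentity2 H Q)
    (heig : ∀ i j, ∑ k, Q k k i j = - (2 / 9 + lam) * H i j)
    (hη : ∀ i, η i = ∑ j, N j i j) (hW : ∀ k i, W k i = ∑ j, Q k j i j) :
    ∑ k, (∑ i, ∑ j, (N k i j * N k i j + H i j * Q k k i j)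
        - ∑ i, ∑ j, (N k i j * N i j k + H i j * Q k i j k)
        + ∑ i, (N k k i * η i + H k i * W k i)) =
      (1 / 2 : ℝ) * ∑ k, ∑ i, ∑ j, (N k i j - N i k j) ^ 2 + ∑ i, η i ^ 2
        + (1 / 9 - lam) * ∑ i, ∑ j, H i j ^ 2 := by
  have h1 : ∑ k, ∑ i, ∑ j, H i j * Q k k i j = - (2 / 9 + lam) * ∑ i, ∑ j, H i j ^ 2 := by
    rw [Finset.sum_comm, Finset.mul_sum]
    refine Finset.sum_congr rfl fun i _ => ?_
    rw [Finset.sum_comm, Finset.mul_sum]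
    refine Finset.sum_congr rfl fun j _ => ?_
    rw [← Finset.mul_sum, heig]
    ring
  have h2 : ∑ k, ∑ i, ∑ j, H i j * Q k i j k =
      ∑ i, ∑ j, H i j * W i j - (1 / 3 : ℝ) * ∑ i, ∑ j, H i j ^ 2 := by
    rw [Finset.sum_comm, Finset.mul_sum, ← Finset.sum_sub_distrib]
    refine Finset.sum_congr rfl fun i _ => ?_
    rw [Finset.sum_comm, Finset.mul_sum, ← Finset.sum_sub_distrib]
    refine Finset.sum_congr rfl fun j _ => ?_
    rw [← Finset.mul_sum, hQ.contract hH htr, hW]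
    ring
  have h3 : ∑ k, ∑ i, N k k i * η i = ∑ i, η i ^ 2 := by
    simp only [hη, Fin.sum_univ_three, hN _ 1 0, hN _ 2 0, hN _ 2 1]
    ring
  have h4 : ∑ k, ∑ i, ∑ j, (N k i j * N k i j) - ∑ k, ∑ i, ∑ j, (N k i j * N i j k) =
      (1 / 2 : ℝ) * ∑ k, ∑ i, ∑ j, (N k i j - N i k j) ^ 2 := by
    simp only [Fin.sum_univ_three, hN _ 1 0, hN _ 2 0, hN _ 2 1]
    ring
  simp only [Finset.sum_add_distrib, Finset.sum_sub_distrib]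
  linarith

/-- The divergence of the covector
`W^{ij} ∇_i h_{jk} - W^{ij} ∇_k h_{ij} - (λ - 1/9) h_k^i η_i - η^i W_{ik} + (tr W) η_k` for a
trace-free eigentensor `h`, where `η` is the divergence of `h`, `W = ∇η` and `P = ∇∇η`. -/
theorem divergence_free_algebra (hH : ∀ i j, H i j = H j i) (hN : ∀ k i j, N k i j = N k j i)
    (htr : ∑ i, H i i = 0) (htrN : ∀ k, ∑ i, N k i i = 0) (hQ : RicciIdentity2 H Q)
    (hP : RicciIdentity1 η P) (heig : ∀ i j, ∑ k, Q k k i j = - (2 / 9 + lam) * H i j)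
    (hη : ∀ i, η i = ∑ j, N j i j) (hW : ∀ k i, W k i = ∑ j, Q k j i j) :
    ∑ k, (∑ i, ∑ j, (P k i j * N i j k + W i j * Q k i j k)
        - ∑ i, ∑ j, (P k i j * N k i j + W i j * Q k k i j)
        - (lam - 1 / 9) * ∑ i, (N k k i * η i + H k i * W k i)
        - ∑ i, (P k i k * η i + W i k * W k i)
        + ((∑ i, P k i i) * η k + (∑ i, W i i) * W k k)) =
      (1 / 2 : ℝ) * ∑ i, ∑ j, (W i j - W j i) ^ 2 + (∑ i, W i i) ^ 2
        + (4 / 9 - lam) * ∑ i, η i ^ 2 := by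
  have h1 : ∑ k, ∑ i, ∑ j, W i j * Q k k i j = - (2 / 9 + lam) * ∑ i, ∑ j, H i j * W i j := by
    rw [Finset.sum_comm, Finset.mul_sum]
    refine Finset.sum_congr rfl fun i _ => ?_
    rw [Finset.sum_comm, Finset.mul_sum]
    refine Finset.sum_congr rfl fun j _ => ?_
    rw [← Finset.mul_sum, heig]
    ring
  have h2 : ∑ k, ∑ i, ∑ j, W i j * Q k i j k =
      ∑ i, ∑ j, W i j ^ 2 - (1 / 3 : ℝ) * ∑ i, ∑ j, H i j * W i j := by
    rw [Finset.sum_comm, Finset.mul_sum, ← Finset.sum_sub_distrib]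
    refine Finset.sum_congr rfl fun i _ => ?_
    rw [Finset.sum_comm, Finset.mul_sum, ← Finset.sum_sub_distrib]
    refine Finset.sum_congr rfl fun j _ => ?_
    rw [← Finset.mul_sum, hQ.contract hH htr, hW]
    ring
  have h3 : ∑ k, ∑ i, N k k i * η i = ∑ i, η i ^ 2 := by
    simp only [hη, Fin.sum_univ_three, hN _ 1 0, hN _ 2 0, hN _ 2 1]
    ring
  have h4 : ∑ k, ∑ i, ∑ j, (P k i j * N i j k) =
      ∑ k, ∑ i, ∑ j, (P k i j * N k i j) + (1 / 9 : ℝ) * ∑ i, η i ^ 2 := by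
    have e1 : ∑ k, ∑ i, ∑ j, (P k i j * N i j k) = ∑ k, ∑ i, ∑ j, (P i k j * N k i j) := by
      rw [Finset.sum_comm]
      exact Finset.sum_congr rfl fun i _ => Finset.sum_congr rfl fun k _ =>
        Finset.sum_congr rfl fun j _ => by rw [hN i j k]
    have e2 : ∑ k, ∑ i, ∑ j, (P i k j - P k i j) * N k i j = (1 / 9 : ℝ) * ∑ i, η i ^ 2 := by
      have e3 : ∀ k, N k 0 0 + N k 1 1 + N k 2 2 = 0 := fun k => by
        rw [← htrN k, Fin.sum_univ_three]
      have e4 : ∀ i, η i = N 0 i 0 + N 1 i 1 + N 2 i 2 := fun i => by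
        rw [hη, Fin.sum_univ_three]
      have e5 : ∀ i k j, P i k j - P k i j = _ := hP
      simp only [e5, Fin.sum_univ_three, Fin.isValue, Fin.reduceEq, if_true, if_false]
      linear_combination (- 1 / 9 : ℝ) * (η 0 * e3 0 + η 1 * e3 1 + η 2 * e3 2)
        - (1 / 9 : ℝ) * (η 0 * e4 0 + η 1 * e4 1 + η 2 * e4 2)
    simp only [sub_mul, Finset.sum_sub_distrib] at e2
    linarith
  have h5 : ∑ k, ∑ i, P k i k * η i = ∑ k, (∑ i, P k i i) * η k - (2 / 9 : ℝ) * ∑ i, η i ^ 2 := by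
    have e1 : ∑ k, ∑ i, P k i k * η i = ∑ k, ∑ i, P i k i * η k := Finset.sum_comm
    have e2 : ∑ k, ∑ i, (P i k i - P k i i) * η k = - (2 / 9 : ℝ) * ∑ i, η i ^ 2 := by
      have e5 : ∀ i k j, P i k j - P k i j = _ := hP
      simp only [e5, Fin.sum_univ_three, Fin.isValue, Fin.reduceEq, if_true, if_false]
      ring
    simp only [sub_mul, Finset.sum_sub_distrib] at e2
    simp only [Finset.sum_mul]
    linarith
  have h6 : ∑ i, ∑ j, W i j ^ 2 - ∑ k, ∑ i, W i k * W k i =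
      (1 / 2 : ℝ) * ∑ i, ∑ j, (W i j - W j i) ^ 2 := by
    simp only [Fin.sum_univ_three]
    ring
  have h7 : ∑ k, (∑ i, W i i) * W k k = (∑ i, W i i) ^ 2 := by
    rw [← Finset.mul_sum, sq]
  simp only [Finset.sum_add_distrib, Finset.sum_sub_distrib, ← Finset.mul_sum]
    at h1 h2 h3 h4 h5 h6 h7 ⊢
  rw [h1, h2, h3, h4, h5, ← h6]
  ring

end Algebra

/-! ### Spaces of constant curvature at a normal point -/

section Pointwise

open Coord

variable {U : Set E3} {g h b : E3 → Matrix (Fin 3) (Fin 3) ℝ} {ξ ζ η : E3 → Fin 3 → ℝ}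
  {D : E3 → Fin 3 → Fin 3 → Fin 3 → ℝ} {y : E3} {lam : ℝ}

theorem pd_add {f f' : E3 → ℝ} (hf : DifferentiableAt ℝ f y) (hf' : DifferentiableAt ℝ f' y)
    (k : Fin 3) : pd k (fun z => f z + f' z) y = pd k f y + pd k f' y := by
  simp only [pd, fderiv_fun_add hf hf', _root_.add_apply]

theorem pd_sub {f f' : E3 → ℝ} (hf : DifferentiableAt ℝ f y) (hf' : DifferentiableAt ℝ f' y)
    (k : Fin 3) : pd k (fun z => f z - f' z) y = pd k f y - pd k f' y := by
  simp only [pd, fderiv_fun_sub hf hf', _root_.sub_apply]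

namespace NormalPoint

theorem diver_add (hn : NormalPoint U g y) (hξ : ∀ i, ContDiffOn ℝ ∞ (fun z => ξ z i) U)
    (hζ : ∀ i, ContDiffOn ℝ ∞ (fun z => ζ z i) U) :
    diver g (fun z k => ξ z k + ζ z k) y = diver g ξ y + diver g ζ y := by
  simp only [hn.diver_eq, pd_add (hn.diff (hξ _)) (hn.diff (hζ _)), Finset.sum_add_distrib]

theorem diver_const_mul (hn : NormalPoint U g y) (hξ : ∀ i, ContDiffOn ℝ ∞ (fun z => ξ z i) U)
    (c : ℝ) : diver g (fun z k => c * ξ z k) y = c * diver g ξ y := by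
  simp only [hn.diver_eq, pd_mul (differentiableAt_const c) (hn.diff (hξ _)), pd_const,
    zero_mul, zero_add, Finset.mul_sum]

/-- In dimension three an Einstein metric has constant curvature. -/
theorem curv_of_ricci (hn : NormalPoint U g y) {κ : ℝ}
    (hric : ∀ j k, ricci g j k y = 2 * κ * g y j k) (l i j k : Fin 3) :
    curv g l i j k y = κ * ((if l = i then 1 else 0) * (if j = k then 1 else 0)
      - (if i = k then 1 else 0) * (if l = j then 1 else 0)) := by
  have hs : ∀ i j, (fun z => g z i j) = fun z => g z j i := fun i j =>
    funext fun z => hn.symm z i j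
  have h1 : ∀ i j k l, pd i (pd j (fun z => g z k l)) y = pd j (pd i (fun z => g z k l)) y :=
    fun i j k l => pd_pd_comm ((hn.smooth k l).contDiffAt (hn.isOpen.mem_nhds hn.mem)) i j
  refine curvature_algebra (S := fun i j k l => pd i (pd j (fun z => g z k l)) y)
    (R := fun l i j k => curv g l i j k y) h1 (fun i j k l => by rw [hs]) (fun l i j k => ?_)
    (fun j k => ?_) l i j k
  · rw [hn.curv_eq, hn.pd_christoffel, hn.pd_christoffel, h1 j i k l]
    ring
  · change ricci g j k y = _
    rw [hric, hn.normal.eq_one, Matrix.one_apply]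
    split_ifs <;> simp

/-- In dimension three an Einstein metric has constant curvature; here the curvature operator
applied to a covector. -/
theorem sum_curv_mul (hn : NormalPoint U g y) {κ : ℝ}
    (hric : ∀ j k, ricci g j k y = 2 * κ * g y j k) (v : Fin 3 → ℝ) (l k i : Fin 3) :
    ∑ m, curv g m l k i y * v m =
      κ * ((if k = i then 1 else 0) * v l - (if l = i then 1 else 0) * v k) := by
  simp only [hn.curv_of_ricci hric, Fin.sum_univ_three]
  fin_cases l <;> fin_cases k <;> fin_cases i <;> simp

theorem differentiableAt_christoffel (hn : NormalPoint U g y) (k i j : Fin 3) :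
    DifferentiableAt ℝ (christoffel g k i j) y :=
  hn.diff (contDiffOn_christoffel hn.isOpen hn.smooth hn.det k i j)

/-- At a normal point `∇_l ∇_k h = ∂_l ∂_k h - ∂_l Γ * h`, and the second partial derivatives
commute. -/
theorem ricciIdentity2 (hn : NormalPoint U g y)
    (hric : ∀ j k, ricci g j k y = (-2 / 9 : ℝ) * g y j k)
    (hh : ∀ i j, ContDiffOn ℝ ∞ (fun z => h z i j) U) :
    RicciIdentity2 (h y) (fun l k i j => pd l (nabla g h k i j) y) := by
  have hcurv := hn.sum_curv_mul (κ := -1 / 9) (fun j k => by rw [hric]; ring)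
  have dh := fun i j => hn.diff (hh i j)
  have dΓ := hn.differentiableAt_christoffel
  have hpd : ∀ l k i j, pd l (nabla g h k i j) y = pd l (pd k (fun z => h z i j)) y
      - ∑ m, (pd l (christoffel g m k i) y * h y m j + pd l (christoffel g m k j) y * h y i m) := by
    intro l k i j
    have d1 : ∀ m, DifferentiableAt ℝ (fun z => christoffel g m k i z * h z m j) y := fun m =>
      (dΓ m k i).fun_mul (dh m j)
    have d2 : ∀ m, DifferentiableAt ℝ (fun z => christoffel g m k j z * h z i m) y := fun m =>
      (dΓ m k j).fun_mul (dh i m)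
    unfold nabla
    rw [pd_sub (hn.diff (contDiffOn_pd hn.isOpen (hh i j) k))
      (DifferentiableAt.fun_sum fun m _ => (d1 m).fun_add (d2 m)),
      pd_sum fun m _ => (d1 m).fun_add (d2 m)]
    simp only [pd_add (d1 _) (d2 _), pd_mul (dΓ _ _ _) (dh _ _), hn.christoffel_eq_zero,
      zero_mul, add_zero]
  intro l k i j
  have h1 := pd_pd_comm ((hh i j).contDiffAt (hn.isOpen.mem_nhds hn.mem)) l k
  have h2 : pd l (nabla g h k i j) y - pd k (nabla g h l i j) y =
      - ∑ m, (curv g m l k i y * h y m j + curv g m l k j y * h y i m) := by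
    simp only [hpd, h1, hn.curv_eq, Fin.sum_univ_three]
    ring
  change pd l (nabla g h k i j) y - pd k (nabla g h l i j) y = _
  rw [h2]
  rw [Finset.sum_add_distrib, hcurv (fun m => h y m j) l k i, hcurv (fun m => h y i m) l k j]
  ring

theorem ricciIdentity1 (hn : NormalPoint U g y)
    (hric : ∀ j k, ricci g j k y = (-2 / 9 : ℝ) * g y j k)
    (hη : ∀ i, ContDiffOn ℝ ∞ (fun z => η z i) U) :
    RicciIdentity1 (η y) (fun l k i => pd l (fun z => cov1 g η z k i) y) := by
  have hcurv := hn.sum_curv_mul (κ := -1 / 9) (fun j k => by rw [hric]; ring)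
  have dη := fun i => hn.diff (hη i)
  have dΓ := hn.differentiableAt_christoffel
  have hpd : ∀ l k i, pd l (fun z => cov1 g η z k i) y = pd l (pd k (fun z => η z i)) y
      - ∑ m, pd l (christoffel g m k i) y * η y m := by
    intro l k i
    have d1 : ∀ m, DifferentiableAt ℝ (fun z => christoffel g m k i z * η z m) y := fun m =>
      (dΓ m k i).fun_mul (dη m)
    unfold cov1
    simp only [Matrix.of_apply]
    rw [pd_sub (hn.diff (contDiffOn_pd hn.isOpen (hη i) k))
      (DifferentiableAt.fun_sum fun m _ => d1 m), pd_sum fun m _ => d1 m]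
    simp only [pd_mul (dΓ _ _ _) (dη _), hn.christoffel_eq_zero, zero_mul, add_zero]
  intro l k i
  have h1 := pd_pd_comm ((hη i).contDiffAt (hn.isOpen.mem_nhds hn.mem)) l k
  have h2 : pd l (fun z => cov1 g η z k i) y - pd k (fun z => cov1 g η z l i) y =
      - ∑ m, curv g m l k i y * η y m := by
    simp only [hpd, h1, hn.curv_eq, Fin.sum_univ_three]
    ring
  change pd l (fun z => cov1 g η z k i) y - pd k (fun z => cov1 g η z l i) y = _
  rw [h2]
  rw [hcurv]
  ring

/-- The Einstein operator on a space of curvature `-1/9`. -/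
theorem einsteinOp_eq (hn : NormalPoint U g y)
    (hric : ∀ j k, ricci g j k y = (-2 / 9 : ℝ) * g y j k) (hh : ∀ i j, h y i j = h y j i)
    (i j : Fin 3) : einsteinOp g h i j y = - ∑ k, pd k (nabla g h k i j) y
      + (2 / 9 : ℝ) * (if i = j then ∑ m, h y m m else 0) - (2 / 9 : ℝ) * h y i j := by
  have hcurv := hn.curv_of_ricci (κ := -1 / 9) (fun j k => by rw [hric]; ring)
  have h1 : roughLaplacian g h i j y = - ∑ k, pd k (nabla g h k i j) y := by
    simp [roughLaplacian, ginv, hn.inv_eq, Matrix.one_apply, hn.nabla2_eq]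
  have h2 : curvAction g h i j y = - (1 / 9 : ℝ) * (if i = j then ∑ m, h y m m else 0)
      + (1 / 9 : ℝ) * h y i j := by
    have e : ∀ a b c d, riem g a b c d y = curv g c a b d y := by
      simp [riem, hn.normal.eq_one, Matrix.one_apply]
    have e2 : curvAction g h i j y = ∑ k, ∑ l, curv g j i k l y * h y k l := by
      simp [curvAction, e, ginv, hn.inv_eq, Matrix.one_apply]
    rw [e2]
    simp only [hcurv, Fin.sum_univ_three]
    fin_cases i <;> fin_cases j <;> simp [hh 1 0, hh 2 0, hh 2 1] <;> ring
  rw [einsteinOp, h1, h2]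
  ring

end NormalPoint
end Pointwise

/-! ### Eigentensors -/

section Global

open Coord

variable {M : Type*} [TopologicalSpace M] [ChartedSpace E3 M]
  {g b : OpenPartialHomeomorph M E3 → E3 → Matrix (Fin 3) (Fin 3) ℝ}
  {ξ : OpenPartialHomeomorph M E3 → E3 → Fin 3 → ℝ} {s : OpenPartialHomeomorph M E3 → E3 → ℝ}
  {φ : OpenPartialHomeomorph M E3} {y : E3} {lam : ℝ}

theorem IsMetric.normalPoint (hg : IsMetric g) (hφ : φ ∈ IsManifold.maximalAtlas (𝓡 3) ∞ M)
    (hy : y ∈ φ.target) (hn : IsNormalAt (g φ) y) : NormalPoint φ.target (g φ) y :=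
  ⟨φ.open_target, hy, hg.smooth φ hφ, fun _ hz => hg.det_ne_zero hφ hz, hg.symm φ, hn⟩

/-- `g` is a metric with Ricci curvature `-(2/9) g` and `b` a symmetric 2-tensor with
`Δ_E b = lam b`, both given by their components in every smooth chart. -/
structure IsEigenData (g b : OpenPartialHomeomorph M E3 → E3 → Matrix (Fin 3) (Fin 3) ℝ)
    (lam : ℝ) : Prop where
  metric : IsMetric g
  tensor : IsTensor2 b
  symm : ∀ φ y i j, b φ y i j = b φ y j i
  ricci : ∀ φ ∈ IsManifold.maximalAtlas (𝓡 3) ∞ M, ∀ y ∈ φ.target, ∀ i j,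
    Coord.ricci (g φ) i j y = (-2 / 9 : ℝ) * g φ y i j
  eigen : ∀ φ ∈ IsManifold.maximalAtlas (𝓡 3) ∞ M, ∀ y ∈ φ.target, ∀ i j,
    einsteinOp (g φ) (b φ) i j y = lam * b φ y i j

/-- The eigenvalue equation at a normal point, solved for the Laplacian. -/
theorem IsEigenData.sum_nabla_nabla (hd : IsEigenData g b lam)
    (hφ : φ ∈ IsManifold.maximalAtlas (𝓡 3) ∞ M) (hn : NormalPoint φ.target (g φ) y)
    (i j : Fin 3) : ∑ k, pd k (fun z => cov2 (g φ) (b φ) z k i j) y =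
      (2 / 9 : ℝ) * (if i = j then ∑ m, b φ y m m else 0) - (2 / 9 + lam) * b φ y i j := by
  have h1 := hd.eigen φ hφ y hn.mem i j
  rw [hn.einsteinOp_eq (hd.ricci φ hφ y hn.mem) (hd.symm φ y)] at h1
  change ∑ k, pd k (nabla (g φ) (b φ) k i j) y = _
  linarith

theorem IsEigenData.nabla_symm (hd : IsEigenData g b lam) (hn : NormalPoint φ.target (g φ) y)
    (k i j : Fin 3) : cov2 (g φ) (b φ) y k i j = cov2 (g φ) (b φ) y k j i := by
  simp only [cov2, hn.nabla_eq, hd.symm φ _ i j]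

/-- The divergence `g^{jk} ∇_k b_{ij}`. -/
abbrev divTensor (g b : OpenPartialHomeomorph M E3 → E3 → Matrix (Fin 3) (Fin 3) ℝ)
    (φ : OpenPartialHomeomorph M E3) (y : E3) : Fin 3 → ℝ :=
  traceFirst (g φ y) (cov2 (g φ) (b φ) y)

theorem IsEigenData.isTensor1_div (hd : IsEigenData g b lam) : IsTensor1 (divTensor g b) :=
  (hd.tensor.cov hd.metric).traceFirst hd.metric

variable [IsManifold (𝓡 3) ∞ M]

theorem IsMetric.exists_normalPoint (hg : IsMetric g) (hy : y ∈ φ.target) :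
    ∃ ψ ∈ IsManifold.maximalAtlas (𝓡 3) ∞ M, y ∈ overlap ψ φ ∧
      NormalPoint ψ.target (g ψ) (coordChange ψ φ y) := by
  obtain ⟨ψ, hψ, hp, hn⟩ := hg.exists_isNormalAt (φ.symm y)
  exact ⟨ψ, hψ, ⟨hy, hp⟩, hg.normalPoint hψ (ψ.map_source hp) hn⟩

theorem IsScalar.eq_zero_of_normal (hs : IsScalar s) (hg : IsMetric g)
    (h0 : ∀ ψ ∈ IsManifold.maximalAtlas (𝓡 3) ∞ M, ∀ z, NormalPoint ψ.target (g ψ) z → s ψ z = 0)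
    (hφ : φ ∈ IsManifold.maximalAtlas (𝓡 3) ∞ M) (hy : y ∈ φ.target) : s φ y = 0 := by
  obtain ⟨ψ, hψ, ho, hn⟩ := hg.exists_normalPoint hy
  rw [hs.law ψ hψ φ hφ y ho, h0 ψ hψ _ hn]

theorem IsTensor1.eq_zero_of_normal (hξ : IsTensor1 ξ) (hg : IsMetric g)
    (h0 : ∀ ψ ∈ IsManifold.maximalAtlas (𝓡 3) ∞ M, ∀ z, NormalPoint ψ.target (g ψ) z →
      ∀ i, ξ ψ z i = 0)
    (hφ : φ ∈ IsManifold.maximalAtlas (𝓡 3) ∞ M) (hy : y ∈ φ.target) (i : Fin 3) :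
    ξ φ y i = 0 := by
  obtain ⟨ψ, hψ, ho, hn⟩ := hg.exists_normalPoint hy
  rw [← form1_stdVec (ξ φ y), hξ.law ψ hψ φ hφ y ho]
  simp [form1, h0 ψ hψ _ hn]

theorem IsTensor2.eq_zero_of_normal (hb : IsTensor2 b) (hg : IsMetric g)
    (h0 : ∀ ψ ∈ IsManifold.maximalAtlas (𝓡 3) ∞ M, ∀ z, NormalPoint ψ.target (g ψ) z →
      ∀ i j, b ψ z i j = 0)
    (hφ : φ ∈ IsManifold.maximalAtlas (𝓡 3) ∞ M) (hy : y ∈ φ.target) (i j : Fin 3) :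
    b φ y i j = 0 := by
  obtain ⟨ψ, hψ, ho, hn⟩ := hg.exists_normalPoint hy
  rw [← form2_stdVec (b φ y), hb.law ψ hψ φ hφ y ho]
  simp [form2, h0 ψ hψ _ hn]

variable [CompactSpace M] [T2Space M]

/-- On a closed manifold a divergence that is nonnegative at normal points vanishes there. -/
theorem IsTensor1.diver_eq_zero_of_normal (hξ : IsTensor1 ξ) (hg : IsMetric g)
    (h0 : ∀ ψ ∈ IsManifold.maximalAtlas (𝓡 3) ∞ M, ∀ z, NormalPoint ψ.target (g ψ) z →
      0 ≤ diver (g ψ) (ξ ψ) z)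
    (hφ : φ ∈ IsManifold.maximalAtlas (𝓡 3) ∞ M) (hy : y ∈ φ.target) :
    diver (g φ) (ξ φ) y = 0 := by
  refine diver_eq_zero_of_nonneg hg hξ (fun φ hφ y hy => ?_) φ hφ y hy
  obtain ⟨ψ, hψ, ho, hn⟩ := hg.exists_normalPoint hy
  have h1 := (hξ.div hg).law ψ hψ φ hφ y ho
  exact (h0 ψ hψ _ hn).trans_eq h1.symm

/-- Eigentensors with eigenvalue below `4/9` are trace-free: the divergence of `u ∇u` is
`|∇u|² + (4/9 - λ) u²`, where `u` is the trace. -/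
theorem IsEigenData.trace_eq_zero (hd : IsEigenData g b lam) (hlam : lam < 4 / 9)
    (hφ : φ ∈ IsManifold.maximalAtlas (𝓡 3) ∞ M) (hy : y ∈ φ.target) :
    trace2 (g φ y) (b φ y) = 0 := by
  have hg := hd.metric
  have hN := hd.tensor.cov hg
  have hu := hd.tensor.trace2 hg
  have hω := hN.traceLast hg
  have hξ := hω.smul hu
  have hval : ∀ ψ ∈ IsManifold.maximalAtlas (𝓡 3) ∞ M, ∀ z, NormalPoint ψ.target (g ψ) z →
      diver (g ψ) (fun y k => trace2 (g ψ y) (b ψ y) *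
        traceLast (g ψ y) (cov2 (g ψ) (b ψ) y) k) z =
      ∑ k, (∑ i, cov2 (g ψ) (b ψ) z k i i) ^ 2 + (4 / 9 - lam) * (∑ i, b ψ z i i) ^ 2 := by
    intro ψ hψ z hn
    rw [← trace_algebra (H := b ψ z)
      (Q := fun l k i j => pd l (fun y => cov2 (g ψ) (b ψ) y k i j) z) (hd.sum_nabla_nabla hψ hn)]
    have e : ∀ k i j, pd k (fun w => b ψ w i j) z = cov2 (g ψ) (b ψ) z k i j := fun k i j =>
      (hn.nabla_eq k i j).symm
    simp only [hn.diver_eq, pd_mul (hn.diff (hu.smooth ψ hψ)) (hn.diff (hω.smooth ψ hψ _)),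
      hn.pd_trace2 (hd.tensor.smooth ψ hψ), hn.pd_traceLast (hN.smooth ψ hψ), hn.trace2_eq,
      hn.traceLast_eq, e]
  refine hu.eq_zero_of_normal hg (fun ψ hψ z hn => ?_) hφ hy
  have h1 := hξ.diver_eq_zero_of_normal hg (fun ψ hψ z hn => by
    rw [hval ψ hψ z hn]
    exact add_nonneg (Finset.sum_nonneg fun _ _ => sq_nonneg _)
      (mul_nonneg (by linarith) (sq_nonneg _))) hψ hn.mem
  rw [hval ψ hψ z hn] at h1
  have h2 : 0 ≤ ∑ k, (∑ i, cov2 (g ψ) (b ψ) z k i i) ^ 2 :=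
    Finset.sum_nonneg fun _ _ => sq_nonneg _
  rw [hn.trace2_eq]
  have h3 : (∑ i, b ψ z i i) ^ 2 ≤ 0 := by
    by_contra! h
    have := mul_pos (sub_pos.2 hlam) h
    linarith
  exact pow_eq_zero_iff two_ne_zero |>.1 (le_antisymm h3 (sq_nonneg _))

theorem IsEigenData.sum_diag_eq_zero (hd : IsEigenData g b lam) (hlam : lam < 4 / 9)
    (hφ : φ ∈ IsManifold.maximalAtlas (𝓡 3) ∞ M) (hn : NormalPoint φ.target (g φ) y) :
    ∑ i, b φ y i i = 0 := by
  rw [← hn.trace2_eq, hd.trace_eq_zero hlam hφ hn.mem]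

theorem IsEigenData.sum_nabla_diag_eq_zero (hd : IsEigenData g b lam) (hlam : lam < 4 / 9)
    (hφ : φ ∈ IsManifold.maximalAtlas (𝓡 3) ∞ M) (hn : NormalPoint φ.target (g φ) y) (k : Fin 3) :
    ∑ i, cov2 (g φ) (b φ) y k i i = 0 := by
  have h1 := hn.pd_trace2 (hd.tensor.smooth φ hφ) k
  rw [pd_congr (f' := fun _ => 0), pd_const] at h1
  · simp only [cov2, hn.nabla_eq]
    exact h1.symm
  · filter_upwards [hn.isOpen.mem_nhds hn.mem] with z hz using hd.trace_eq_zero hlam hφ hz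

theorem IsEigenData.sum_nabla_nabla_of_lt (hd : IsEigenData g b lam) (hlam : lam < 4 / 9)
    (hφ : φ ∈ IsManifold.maximalAtlas (𝓡 3) ∞ M) (hn : NormalPoint φ.target (g φ) y)
    (i j : Fin 3) : ∑ k, pd k (fun z => cov2 (g φ) (b φ) z k i j) y =
      - (2 / 9 + lam) * b φ y i j := by
  rw [hd.sum_nabla_nabla hφ hn, hd.sum_diag_eq_zero hlam hφ hn, ite_self]
  ring

/-- There are no eigentensors with eigenvalue below `1/9`:
`½ |∇_k b_{ij} - ∇_i b_{kj}|² + |div b|² + (1/9 - λ) |b|²` is a divergence. -/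
theorem IsEigenData.eq_zero_of_lt (hd : IsEigenData g b lam) (hlam : lam < 1 / 9)
    (hφ : φ ∈ IsManifold.maximalAtlas (𝓡 3) ∞ M) (hy : y ∈ φ.target) (i j : Fin 3) :
    b φ y i j = 0 := by
  have hlam' : lam < 4 / 9 := by linarith
  have hg := hd.metric
  have hN := hd.tensor.cov hg
  have hη := hd.isTensor1_div
  have hA := hη.contrRight hd.tensor hg
  have hB := hN.contrLast hd.tensor hg
  have hC := hN.contrFirst hd.tensor hg
  have hξ := (hB.add (hC.const_mul (-1))).add hA
  have hval : ∀ ψ ∈ IsManifold.maximalAtlas (𝓡 3) ∞ M, ∀ z, NormalPoint ψ.target (g ψ) z →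
      diver (g ψ) (fun y k => (contrLast (g ψ y) (b ψ y) (cov2 (g ψ) (b ψ) y) k
        + (-1) * contrFirst (g ψ y) (b ψ y) (cov2 (g ψ) (b ψ) y) k)
        + contrRight (g ψ y) (b ψ y) (divTensor g b ψ y) k) z =
      (1 / 2 : ℝ) * ∑ k, ∑ i, ∑ j, (cov2 (g ψ) (b ψ) z k i j - cov2 (g ψ) (b ψ) z i k j) ^ 2
        + ∑ i, divTensor g b ψ z i ^ 2 + (1 / 9 - lam) * ∑ i, ∑ j, b ψ z i j ^ 2 := by
    intro ψ hψ z hn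
    have hb := hd.tensor.smooth ψ hψ
    have hNs := hN.smooth ψ hψ
    have hηs := hη.smooth ψ hψ
    have e : ∀ k i j, pd k (fun w => b ψ w i j) z = cov2 (g ψ) (b ψ) z k i j := fun k i j =>
      (hn.nabla_eq k i j).symm
    rw [← bound_algebra (hd.symm ψ z) (hd.nabla_symm hn) (hd.sum_diag_eq_zero hlam' hψ hn)
      (hn.ricciIdentity2 (hd.ricci ψ hψ z hn.mem) hb) (hd.sum_nabla_nabla_of_lt hlam' hψ hn)
      (hn.traceFirst_eq _) (fun k i => hn.pd_traceFirst hNs k i)]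
    rw [hn.diver_add ((hB.add (hC.const_mul (-1))).smooth ψ hψ) (hA.smooth ψ hψ),
      hn.diver_add (hB.smooth ψ hψ) ((hC.const_mul (-1)).smooth ψ hψ),
      hn.diver_const_mul (hC.smooth ψ hψ)]
    simp only [hn.diver_eq, hn.pd_contrLast hb hNs, hn.pd_contrFirst hb hNs,
      hn.pd_contrRight hb hηs, e]
    conv_rhs => rw [Finset.sum_add_distrib, Finset.sum_sub_distrib]
    simp only [cov2]
    ring
  refine hd.tensor.eq_zero_of_normal hg (fun ψ hψ z hn => ?_) hφ hy i j
  have hpos : ∀ ψ : OpenPartialHomeomorph M E3, ∀ z, 0 ≤ (1 / 2 : ℝ) * ∑ k, ∑ i, ∑ j,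
      (cov2 (g ψ) (b ψ) z k i j - cov2 (g ψ) (b ψ) z i k j) ^ 2 + ∑ i, divTensor g b ψ z i ^ 2 :=
    fun ψ z => by positivity
  have h1 := hξ.diver_eq_zero_of_normal hg (fun ψ hψ z hn => by
    rw [hval ψ hψ z hn]
    exact add_nonneg (hpos ψ z) (mul_nonneg (by linarith) (by positivity))) hψ hn.mem
  rw [hval ψ hψ z hn] at h1
  have h3 : ∑ i, ∑ j, b ψ z i j ^ 2 ≤ 0 := by
    by_contra! h
    have := mul_pos (sub_pos.2 hlam) h
    linarith [hpos ψ z]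
  intro i j
  have h4 : b ψ z i j ^ 2 ≤ ∑ i, ∑ j, b ψ z i j ^ 2 :=
    (Finset.single_le_sum (f := fun j => b ψ z i j ^ 2) (fun _ _ => sq_nonneg _)
      (Finset.mem_univ j)).trans
    (Finset.single_le_sum (f := fun i => ∑ j, b ψ z i j ^ 2)
      (fun _ _ => Finset.sum_nonneg fun _ _ => sq_nonneg _) (Finset.mem_univ i))
  exact pow_eq_zero_iff two_ne_zero |>.1 (le_antisymm (h4.trans h3) (sq_nonneg _))

/-- Eigentensors with eigenvalue below `4/9` are divergence-free: with `η` the divergence,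
`½ |∇_i η_j - ∇_j η_i|² + (div η)² + (4/9 - λ) |η|²` is a divergence. -/
theorem IsEigenData.div_eq_zero (hd : IsEigenData g b lam) (hlam : lam < 4 / 9)
    (hφ : φ ∈ IsManifold.maximalAtlas (𝓡 3) ∞ M) (hy : y ∈ φ.target) (i : Fin 3) :
    divTensor g b φ y i = 0 := by
  have hg := hd.metric
  have hN := hd.tensor.cov hg
  have hη := hd.isTensor1_div
  have hΩ := hη.cov hg
  have hA := hη.contrRight hd.tensor hg
  have hB := hN.contrLast hΩ hg
  have hC := hN.contrFirst hΩ hg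
  have hL := hη.contrLeft hΩ hg
  have hu := hΩ.trace2 hg
  have hT := hη.smul hu
  have h1 := hC.add (hB.const_mul (-1))
  have h2 := h1.add (hA.const_mul (-(lam - 1 / 9)))
  have h3 := h2.add (hL.const_mul (-1))
  have hξ := h3.add hT
  have hval : ∀ ψ ∈ IsManifold.maximalAtlas (𝓡 3) ∞ M, ∀ z, NormalPoint ψ.target (g ψ) z →
      diver (g ψ) (fun y k => (((contrFirst (g ψ y) (cov1 (g ψ) (divTensor g b ψ) y)
            (cov2 (g ψ) (b ψ) y) k
          + (-1) * contrLast (g ψ y) (cov1 (g ψ) (divTensor g b ψ) y) (cov2 (g ψ) (b ψ) y) k)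
          + (-(lam - 1 / 9)) * contrRight (g ψ y) (b ψ y) (divTensor g b ψ y) k)
          + (-1) * contrLeft (g ψ y) (cov1 (g ψ) (divTensor g b ψ) y) (divTensor g b ψ y) k)
          + trace2 (g ψ y) (cov1 (g ψ) (divTensor g b ψ) y) * divTensor g b ψ y k) z =
      (1 / 2 : ℝ) * ∑ i, ∑ j, (cov1 (g ψ) (divTensor g b ψ) z i j
          - cov1 (g ψ) (divTensor g b ψ) z j i) ^ 2
        + (∑ i, cov1 (g ψ) (divTensor g b ψ) z i i) ^ 2
        + (4 / 9 - lam) * ∑ i, divTensor g b ψ z i ^ 2 := by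
    intro ψ hψ z hn
    have hb := hd.tensor.smooth ψ hψ
    have hNs := hN.smooth ψ hψ
    have hηs := hη.smooth ψ hψ
    have hΩs := hΩ.smooth ψ hψ
    have e : ∀ k i j, pd k (fun w => b ψ w i j) z = cov2 (g ψ) (b ψ) z k i j := fun k i j =>
      (hn.nabla_eq k i j).symm
    have e1 : ∀ k i, pd k (fun w => divTensor g b ψ w i) z = cov1 (g ψ) (divTensor g b ψ) z k i :=
      fun k i => (hn.cov1_eq k i).symm
    rw [← divergence_free_algebra (hd.symm ψ z) (hd.nabla_symm hn)
      (hd.sum_diag_eq_zero hlam hψ hn) (hd.sum_nabla_diag_eq_zero hlam hψ hn)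
      (hn.ricciIdentity2 (hd.ricci ψ hψ z hn.mem) hb)
      (hn.ricciIdentity1 (hd.ricci ψ hψ z hn.mem) hηs) (hd.sum_nabla_nabla_of_lt hlam hψ hn)
      (hn.traceFirst_eq _) (fun k i => (hn.cov1_eq k i).trans (hn.pd_traceFirst hNs k i))]
    rw [hn.diver_add (h3.smooth ψ hψ) (hT.smooth ψ hψ),
      hn.diver_add (h2.smooth ψ hψ) ((hL.const_mul (-1)).smooth ψ hψ),
      hn.diver_add (h1.smooth ψ hψ) ((hA.const_mul (-(lam - 1 / 9))).smooth ψ hψ),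
      hn.diver_add (hC.smooth ψ hψ) ((hB.const_mul (-1)).smooth ψ hψ),
      hn.diver_const_mul (hB.smooth ψ hψ), hn.diver_const_mul (hA.smooth ψ hψ),
      hn.diver_const_mul (hL.smooth ψ hψ)]
    simp only [hn.diver_eq, hn.pd_contrLast hΩs hNs, hn.pd_contrFirst hΩs hNs,
      hn.pd_contrRight hb hηs, hn.pd_contrLeft hΩs hηs,
      pd_mul (hn.diff (hu.smooth ψ hψ)) (hn.diff (hηs _)), hn.pd_trace2 hΩs, hn.trace2_eq, e, e1]
    conv_rhs => rw [Finset.sum_add_distrib, Finset.sum_sub_distrib, Finset.sum_sub_distrib,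
      Finset.sum_sub_distrib, ← Finset.mul_sum]
    simp only [cov2]
    ring
  refine hη.eq_zero_of_normal hg (fun ψ hψ z hn => ?_) hφ hy i
  have hpos : ∀ ψ : OpenPartialHomeomorph M E3, ∀ z, 0 ≤ (1 / 2 : ℝ) * ∑ i, ∑ j,
      (cov1 (g ψ) (divTensor g b ψ) z i j - cov1 (g ψ) (divTensor g b ψ) z j i) ^ 2
        + (∑ i, cov1 (g ψ) (divTensor g b ψ) z i i) ^ 2 :=
    fun ψ z => by positivity
  have h4 := hξ.diver_eq_zero_of_normal hg (fun ψ hψ z hn => by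
    rw [hval ψ hψ z hn]
    exact add_nonneg (hpos ψ z) (mul_nonneg (by linarith) (by positivity))) hψ hn.mem
  rw [hval ψ hψ z hn] at h4
  have h5 : ∑ i, divTensor g b ψ z i ^ 2 ≤ 0 := by
    by_contra! h
    have := mul_pos (sub_pos.2 hlam) h
    linarith [hpos ψ z]
  intro i
  have h6 : divTensor g b ψ z i ^ 2 ≤ ∑ i, divTensor g b ψ z i ^ 2 :=
    Finset.single_le_sum (f := fun i => divTensor g b ψ z i ^ 2) (fun _ _ => sq_nonneg _)
      (Finset.mem_univ i)
  exact pow_eq_zero_iff two_ne_zero |>.1 (le_antisymm (h6.trans h5) (sq_nonneg _))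

end Global

/-! ### Components of bundle sections -/

section Bundles

open Coord

variable {M : Type*} [TopologicalSpace M] [ChartedSpace E3 M]
  {φ : OpenPartialHomeomorph M E3} {y : E3}

theorem mfderiv_symm_injective (hφ : φ ∈ IsManifold.maximalAtlas (𝓡 3) ∞ M) (hy : y ∈ φ.target) :
    Function.Injective (mfderiv (𝓡 3) (𝓡 3) φ.symm y : E3 →L[ℝ] E3) := by
  have h1 : MDifferentiableAt (𝓡 3) (𝓡 3) φ.symm y :=
    (contMDiffAt_symm_of_mem_maximalAtlas hφ hy).mdifferentiableAt (by simp)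
  have h2 : MDifferentiableAt (𝓡 3) (𝓡 3) φ (φ.symm y) :=
    (contMDiffAt_of_mem_maximalAtlas hφ (φ.map_target hy)).mdifferentiableAt (by simp)
  have h3 := h2.hasMFDerivAt.comp y h1.hasMFDerivAt
  have h4 : (id : E3 → E3) =ᶠ[𝓝 y] φ ∘ φ.symm := by
    filter_upwards [φ.open_target.mem_nhds hy] with z hz
    exact (φ.right_inv hz).symm
  have h5 := h3.congr_of_eventuallyEq h4
  have h6 := hasMFDerivAt_unique h5 (hasMFDerivAt_id (I := 𝓡 3) y)
  refine Function.LeftInverse.injective (g := (mfderiv (𝓡 3) (𝓡 3) φ (φ.symm y) : E3 →L[ℝ] E3))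
    fun v => ?_
  exact congrArg (fun L : E3 →L[ℝ] E3 => L v) h6

theorem mfderiv_symm_surjective (hφ : φ ∈ IsManifold.maximalAtlas (𝓡 3) ∞ M)
    (hy : y ∈ φ.target) :
    Function.Surjective (mfderiv (𝓡 3) (𝓡 3) φ.symm y : E3 →L[ℝ] E3) := by
  have h1 : ∀ L : E3 →L[ℝ] E3, Function.Injective L → Function.Surjective L := fun L hL =>
    LinearMap.surjective_of_injective (f := L.toLinearMap) hL
  exact h1 _ (mfderiv_symm_injective hφ hy)

variable [IsManifold (𝓡 3) ∞ M]

theorem isTensor2_components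
    {b : ∀ x : M, TangentSpace (𝓡 3) x →L[ℝ] TangentSpace (𝓡 3) x →L[ℝ] ℝ}
    (hb : ContMDiff (𝓡 3) ((𝓡 3).prod 𝓘(ℝ, E3 →L[ℝ] E3 →L[ℝ] ℝ)) ∞
      (fun x => TotalSpace.mk' (E3 →L[ℝ] E3 →L[ℝ] ℝ) x (b x))) :
    IsTensor2 (components b) where
  smooth _ hφ i j := contDiffOn_components hb hφ i j
  law _ hφ _ hψ _ hy v w := components_coordChange b hφ hψ hy v w

theorem isMetric_components (γ : SmoothMetric M) : IsMetric (components γ.inner) where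
  toIsTensor2 := isTensor2_components γ.contMDiff
  symm φ y i j := γ.symm _ _ _
  pos φ hφ y hy := by
    refine Matrix.PosDef.of_dotProduct_mulVec_pos ?_ fun v hv => ?_
    · ext i j
      exact γ.symm _ _ _
    · have h1 := form2_components γ.inner φ y (WithLp.toLp 2 v) (WithLp.toLp 2 v)
      have h2 : star v ⬝ᵥ (components γ.inner φ y).mulVec v =
          form2 (components γ.inner φ y) (WithLp.toLp 2 v) (WithLp.toLp 2 v) := by
        simp only [form2, dotProduct, Matrix.mulVec, Finset.mul_sum, star_trivial]
        exact Finset.sum_congr rfl fun i _ => Finset.sum_congr rfl fun j _ => by ring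
      rw [h2, h1]
      refine γ.pos _ _ fun h3 => hv ?_
      have h4 := mfderiv_symm_injective hφ hy (h3.trans (map_zero _).symm)
      exact congrArg WithLp.ofLp h4

/-- A tensor whose components vanish in every chart is zero. -/
theorem SymTensor.eq_zero_of_components {h : SymTensor M}
    (h0 : ∀ φ ∈ IsManifold.maximalAtlas (𝓡 3) ∞ M, ∀ y ∈ φ.target, ∀ i j,
      components h.toFun φ y i j = 0) : h = 0 := by
  have h1 : h.toFun = fun _ => 0 := by
    funext x
    have hx := mem_chart_source E3 x
    have hφ := IsManifold.chart_mem_maximalAtlas (I := 𝓡 3) (n := ∞) x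
    have hy := (chartAt E3 x).map_source hx
    have h2 : ∀ v w : E3, (h.toFun x : E3 →L[ℝ] E3 →L[ℝ] ℝ) v w = 0 := by
      intro v w
      rw [bilin_apply_congr h.toFun ((chartAt E3 x).left_inv hx).symm]
      obtain ⟨v, rfl⟩ := mfderiv_symm_surjective hφ hy v
      obtain ⟨w, rfl⟩ := mfderiv_symm_surjective hφ hy w
      refine (form2_components h.toFun _ _ v w).symm.trans ?_
      simp [form2, h0 _ hφ _ hy]
    exact ContinuousLinearMap.ext fun v => ContinuousLinearMap.ext fun w => h2 v w
  cases h
  cases h1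
  rfl

theorem components_smul (lam : ℝ) (h : SymTensor M) (φ : OpenPartialHomeomorph M E3) (y : E3)
    (i j : Fin 3) : components (lam • h).toFun φ y i j = lam * components h.toFun φ y i j := rfl

theorem components_zero (φ : OpenPartialHomeomorph M E3) :
    components (0 : SymTensor M).toFun φ = 0 := rfl

theorem IsEigentensor.isEigenData {γ : SmoothMetric M} (hγ : IsEinsteinMetric γ (-2 / 9))
    {lam : ℝ} {h : SymTensor M} (hh : IsEigentensor γ lam h) :
    IsEigenData (components γ.inner) (components h.toFun) lam where
  metric := isMetric_components γ
  tensor := isTensor2_components h.contMDiff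
  symm _ _ _ _ := h.symm _ _ _
  ricci := hγ
  eigen := hh.2

theorem Coord.trace_eq_trace2 (g h : E3 → Matrix (Fin 3) (Fin 3) ℝ) (y : E3) :
    trace g h y = trace2 (g y) (h y) := by
  simp [trace, trace2, contr, ginv]

theorem Coord.divergence_eq_traceFirst (g h : E3 → Matrix (Fin 3) (Fin 3) ℝ) (y : E3)
    (i : Fin 3) : divergence g h i y = traceFirst (g y) (cov2 g h y) i := by
  simp [divergence, traceFirst, contr, ginv, cov2]

theorem Coord.einsteinOp_zero (g : E3 → Matrix (Fin 3) (Fin 3) ℝ) (i j : Fin 3) (y : E3) :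
    einsteinOp g 0 i j y = 0 := by
  have h1 : ∀ k i j, nabla g 0 k i j = fun _ => 0 := by
    intro k i j
    funext z
    simp [nabla, pd]
  simp [einsteinOp, roughLaplacian, curvAction, nabla2, h1, pd]

end Bundles

end

theorem mainTheorem2 {M : Type*} [TopologicalSpace M] [ChartedSpace E3 M]
    [IsManifold (𝓡 3) ∞ M] [CompactSpace M] [T2Space M]
    (γ : SmoothMetric M) (hγ : IsEinsteinMetric γ (-2 / 9)) :
    (∀ lam₀ : ℝ, IsLeast {lam : ℝ | 0 < lam ∧ IsEinsteinEigenvalue γ lam} lam₀ → 1 / 9 ≤ lam₀) ∧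
    (∀ lam : ℝ, IsEinsteinEigenvalue γ lam → 1 / 9 ≤ lam) ∧
    (∀ (lam : ℝ) (h : SymTensor M), IsEigentensor γ lam h → lam < 4 / 9 → IsTT γ h) ∧
    einsteinKernel γ = {0} := by
  have bound : ∀ lam : ℝ, IsEinsteinEigenvalue γ lam → 1 / 9 ≤ lam := by
    rintro lam ⟨h, hh⟩
    by_contra! hlam
    exact hh.1 (SymTensor.eq_zero_of_components fun φ hφ y hy =>
      (hh.isEigenData hγ).eq_zero_of_lt hlam hφ hy)
  refine ⟨fun lam₀ h₀ => bound lam₀ h₀.1.2, bound, fun lam h hh hlam φ hφ y hy => ⟨?_, fun i => ?_⟩,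
    Set.Subset.antisymm (fun h hh => ?_) ?_⟩
  · rw [Coord.trace_eq_trace2]
    exact (hh.isEigenData hγ).trace_eq_zero hlam hφ hy
  · rw [Coord.divergence_eq_traceFirst]
    exact (hh.isEigenData hγ).div_eq_zero hlam hφ hy i
  · by_contra h0
    have h1 : IsEigentensor γ 0 h := ⟨h0, fun φ hφ y hy i j => by
      rw [hh φ hφ y hy i j, components_smul, components_zero, zero_mul]
      rfl⟩
    linarith [bound 0 ⟨h, h1⟩]
  · rintro h rfl φ - y - i j
    exact Coord.einsteinOp_zero _ i j y
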